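/- Let $L$ denote Lebesgue measure on $\mathbb C$, let $$\mathcal E=\{u(z)=e^{-|z|^2/2}f(z):\ f \text{ entire}\}\cap L^2(\mathbb C)$$ be the Bargmann–Fock space, and for $u\in\mathcal E$ put $$M(u)=\int_{\mathbb C}|u|^2\,dL,\qquad \mathcal H(u)=\frac14\int_{\mathbb C}|u|^4\,dL,\qquad P(u)=\int_{\mathbb C}(|z|^2-1)|u(z)|^2\,dL(z)\in(-\infty,+\infty].$$ For $\mu>0$ let $\mathcal G_\mu=8\pi\mathcal H+\mu P$, with values in $(-\infty,+\infty]$. A global minimizer is a function $u\in\mathcal E$ with $M(u)=1$ and $\mathcal G_\mu(u)\le\mathcal G_\mu(v)$ for all $v\in\mathcal E$ with $M(v)=1$. A local minimizer is a function $u\in\mathcal E$ with $M(u)=1$ and $P(u)<\infty$ for which there is $\varepsilon>0$ such that $\mathcal G_\mu(u)\le\mathcal G_\mu(v)$ for all $v\in\mathcal E$ with $M(v)=1$ and $\int_{\mathbb C}(1+|z|^2)|v-u|^2\,dL<\varepsilon^2$. Let $$\phi_0(z)=\frac{1}{\sqrt\pi}e^{-|z|^2/2},\qquad \phi_1(z)=\frac{1}{\sqrt\pi}\,z\,e^{-|z|^2/2},$$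 $$\psi_b(z)=\frac{e^{-\frac12\left(\frac{b}{1+b^2}\right)^2}}{\sqrt{\pi(1+b^2)}}\left(z-\frac{b(2+b^2)}{1+b^2}\right)e^{\frac{b}{1+b^2}z-\frac{|z|^2}{2}}\qquad(b\ge0).$$ "Up to rotations" means up to the phase rotations $u\mapsto e^{i\gamma}u$ and the space rotations $u\mapsto u(e^{i\theta}\,\cdot)$, $\gamma,\theta\in\mathbb R$. Then: (i) For every $\mu>0$ there exists a global minimizer of $\mathcal G_\mu$. (ii) For every $\mu>\frac12$, the function $\phi_0$ is, up to rotations, the unique global minimizer of $\mathcal G_\mu$. (iii) For $\mu=\frac12$, the global minimizers of $\mathcal G_\mu$ are, up to rotations, exactly $\phi_0$, $\phi_1$ and the functions $\psi_b$, $b\ge0$. (iv) There exists $\mu_0\in[\frac5{32},\frac12)$ such that: (a) for every $\mu\in(\mu_0,\frac12)$, the function $\phi_1$ is, up to rotations, the unique global minimizer of $\mathcal G_\mu$; (b) for every $\mu\in(0,\mu_0)$, every global minimizer of $\mathcal G_\mu$ has infinitely many zeros. (v) For every $\mu\in(0,\frac5{32})$, every local or global minimizer of $\mathcal G_\mu$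 has infinitely many zeros. -/

import Mathlib

open MeasureTheory
open scoped ENNReal Nat

noncomputable section

namespace LLL

/-- The Bargmann-Fock space: functions `u(z) = e^{-|z|²/2} f(z)` with `f` entire and `u ∈ L²(ℂ)`.
Its elements are continuous, so they are treated as genuine functions. -/
def bargmannFock : Set (ℂ → ℂ) :=
  {u | (∃ f : ℂ → ℂ, Differentiable ℂ f ∧
      ∀ z : ℂ, u z = Complex.exp (-((‖z‖ ^ 2 / 2 : ℝ) : ℂ)) * f z) ∧
    MemLp u 2 (volume : Measure ℂ)}

/-- The mass `M(u) = ∫ |u|²`. -/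
def mass (u : ℂ → ℂ) : ℝ := ∫ z : ℂ, ‖u z‖ ^ 2

/-- The Hamiltonian `H(u) = (1/4) ∫ |u|⁴`. -/
def hamiltonian (u : ℂ → ℂ) : ℝ := (1 / 4) * ∫ z : ℂ, ‖u z‖ ^ 4

/-- The angular momentum `P(u) = ∫ (|z|² - 1) |u|²`, for `u` in the weighted space `L^{2,1}`. -/
def angularMomentum (u : ℂ → ℂ) : ℝ := ∫ z : ℂ, (‖z‖ ^ 2 - 1) * ‖u z‖ ^ 2

/-- The norm of the weighted space `L^{2,1}(ℂ)`, that is the `L²` norm of `√(1 + |z|²) u(z)`,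
with value `∞` outside this space. -/
def weightedNorm (u : ℂ → ℂ) : ℝ≥0∞ :=
  eLpNorm (fun z : ℂ => Real.sqrt (1 + ‖z‖ ^ 2) • u z) 2 (volume : Measure ℂ)

open Classical in
/-- The energy `G_μ(u) = 8π H(u) + μ P(u)` for `μ > 0` and `u` in the Bargmann-Fock space. It is
`+∞` when `u ∉ L^{2,1}`, because then `P(u) = +∞`. -/
def energy (μ : ℝ) (u : ℂ → ℂ) : EReal :=
  if weightedNorm u < ∞ then
    ((8 * Real.pi * hamiltonian u + μ * angularMomentum u : ℝ) : EReal)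
  else ⊤

/-- The constraint set `{u ∈ E : M(u) = 1}`. -/
def unitMass : Set (ℂ → ℂ) := {u | u ∈ bargmannFock ∧ mass u = 1}

/-- Global minimizers of `G_μ` under the constraint of unit mass. -/
def IsGlobalMinimizer (μ : ℝ) (u : ℂ → ℂ) : Prop :=
  u ∈ unitMass ∧ ∀ v ∈ unitMass, energy μ u ≤ energy μ v

/-- Local minimizers of `G_μ` under the constraint of unit mass, in the energy space `L^{2,1}`:
`u` has finite energy and minimizes `G_μ` among the competitors in an `L^{2,1}`-ball around it. -/
def IsLocalMinimizer (μ : ℝ) (u : ℂ → ℂ) : Prop :=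
  u ∈ unitMass ∧ weightedNorm u < ∞ ∧
    ∃ ε : ℝ, 0 < ε ∧ ∀ v ∈ unitMass,
      weightedNorm (v - u) < ENNReal.ofReal ε → energy μ u ≤ energy μ v

/-- The phase rotation `T_γ u (z) = e^{iγ} u(z)`. -/
def phaseRotation (γ : ℝ) (u : ℂ → ℂ) : ℂ → ℂ := fun z => Complex.exp (γ * Complex.I) * u z

/-- The space rotation `L_θ u (z) = u(e^{iθ} z)`. -/
def spaceRotation (θ : ℝ) (u : ℂ → ℂ) : ℂ → ℂ := fun z => u (Complex.exp (θ * Complex.I) * z)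

/-- `u` and `v` agree up to phase and space rotations. -/
def EqUpToRotations (u v : ℂ → ℂ) : Prop :=
  ∃ γ θ : ℝ, u = phaseRotation γ (spaceRotation θ v)

/-- The special Hermite function `φ_n(z) = (π n!)^{-1/2} zⁿ e^{-|z|²/2}`. -/
def phi (n : ℕ) : ℂ → ℂ := fun z =>
  ((1 / Real.sqrt (Real.pi * (n ! : ℝ)) : ℝ) : ℂ) * z ^ n *
    Complex.exp (-((‖z‖ ^ 2 / 2 : ℝ) : ℂ))

/-- `ψ_b(z) = e^{-(b/(1+b²))²/2} (π(1+b²))^{-1/2} (z - b(2+b²)/(1+b²)) e^{bz/(1+b²) - |z|²/2}`. -/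
def psi (b : ℝ) : ℂ → ℂ := fun z =>
  ((Real.exp (-(1 / 2) * (b / (1 + b ^ 2)) ^ 2) / Real.sqrt (Real.pi * (1 + b ^ 2)) : ℝ) : ℂ) *
    (z - ((b * (2 + b ^ 2) / (1 + b ^ 2) : ℝ) : ℂ)) *
    Complex.exp (((b / (1 + b ^ 2) : ℝ) : ℂ) * z - ((‖z‖ ^ 2 / 2 : ℝ) : ℂ))

/-- `u` has infinitely many zeros. -/
def HasInfinitelyManyZeros (u : ℂ → ℂ) : Prop := {z : ℂ | u z = 0}.Infinite

end LLL

end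

/-! Write u = e^{-|z|²/2} f and regard u(z)u(w) as a two-particle function. In the variables s =
(z+w)/2 and t = (z-w)/2 the Gaussian factorizes and f(s+t)f(s-t) is entire and even in t. Let w_l be
the mass of its t^l component (`relWeight`); only even l occur. Radial two-body integrals are
diagonal in l (`lintegral_pair_radial`), which gives Σ w_l = M², w_0 = 8πH and Σ l·w_l = P·M - |Q|²,
where Q = ∫ z|u|². At unit mass this reads G_{1/2} - 1 = |Q|²/2 + Σ_{l≥4} (l/2 - 1) w_l, a sum of
nonnegative terms (`coordEnergy_half`). Equality means Q = 0 and f(s+t)f(s-t) = f(s)² + B(s)t², a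
functional equation solved only by (p + qz)e^{αz}; the centred solutions are, up to rotations, φ₀
and the ψ_b (φ₁ being ψ_0). Since G_μ is affine in μ with slope P ≥ 0, and P = 0 only for φ₀, this
settles μ ≥ 1/2.

Below 1/2 one more inequality is needed. The squared modulus of the Fourier transform of |u|² is
nonnegative; averaged over the frequencies of a well chosen length it gives (1 - e^{-2})w_0 + (1 +
e^{-2})w_2 ≤ M² (`relWeight_constraint`), which suffices for φ₁ to be minimal at μ = 5/12
(`le_coordEnergy`). By affineness in μ, minimality of φ₁ at some ν < 1/2 propagates to all of (ν,
1/2), with uniqueness (`isGlobalMinimizer_iff_phi_one`), so μ₀ is the infimum of the parameters in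
(0, 1/2) at which φ₁ is minimal.

For the zeros, let u be a local minimizer with finitely many of them. Factorization of entire
functions of order two gives f = p·e^{αz+γz²} with p a polynomial. Finite energy forces |γ| < 1/2,
hence geometric decay of the coordinates of u in the basis φ_n; the Euler-Lagrange equation improves
this to decay faster than any geometric sequence (`decay_all`), so γ = 0. A magnetic translation
removes e^{αz} and leaves finitely many coordinates; the Euler-Lagrange equations at the extreme
indices then leave a single φ_n when μ ≠ 1/2 (`QMin.eq_single`). The second variation excludes n ≥ 2
always, n = 0 for μ < 1/2 and n = 1 for μ < 5/32.

Existence follows from compactness: bounded second moment prevents loss of mass in the coordinates.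
-/

namespace LLL

/-! ### Parseval identities for entire functions -/

/-- The coefficients `a` are those of a power series which converges to `g` on the whole plane. -/
def IsEntireSeries (a : ℕ → ℂ) (g : ℂ → ℂ) : Prop :=
  ∀ z : ℂ, HasSum (fun n => a n * z ^ n) (g z)

lemma IsEntireSeries.summable_norm {a : ℕ → ℂ} {g : ℂ → ℂ} (h : IsEntireSeries a g) (r : ℝ) :
    Summable fun n => ‖a n‖ * |r| ^ n := by
  have := (h r).summable.norm
  simpa [norm_mul, norm_pow] using this

lemma Differentiable.isEntireSeries {g : ℂ → ℂ} (hg : Differentiable ℂ g) :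
    IsEntireSeries (fun n => (n ! : ℂ)⁻¹ * iteratedDeriv n g 0) g := by
  intro z
  have := Complex.hasSum_taylorSeries_of_entire hg 0 z
  refine this.congr_fun ?_ |> id
  intro n
  simp only [smul_eq_mul, sub_zero]
  ring

lemma IsEntireSeries.differentiable {a : ℕ → ℂ} {g : ℂ → ℂ} (h : IsEntireSeries a g) :
    Differentiable ℂ g := by
  have hg : g = fun z => ∑' n, a n * z ^ n := funext fun z => (h z).tsum_eq.symm
  intro z
  have hd : DifferentiableOn ℂ (fun z => ∑' n, a n * z ^ n) (Metric.ball 0 (‖z‖ + 1)) := by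
    refine Complex.differentiableOn_tsum_of_summable_norm
      (u := fun n => ‖a n‖ * |‖z‖ + 1| ^ n) (h.summable_norm _) ?_ Metric.isOpen_ball ?_
    · intro n; fun_prop
    · intro n w hw
      rw [norm_mul, norm_pow]
      have : ‖w‖ ≤ |‖z‖ + 1| := by
        rw [abs_of_pos (by positivity)]
        exact (mem_ball_zero_iff.mp hw).le
      gcongr
  rw [hg]
  exact (hd z (by simp)).differentiableAt (Metric.isOpen_ball.mem_nhds (by simp))

lemma intervalIntegral_exp_int (k : ℤ) :
    ∫ θ in (-Real.pi)..Real.pi, Complex.exp (k * θ * Complex.I) =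
      if k = 0 then 2 * (Real.pi : ℂ) else 0 := by
  split_ifs with hk
  · subst hk
    simp
    ring
  · have hc : (k : ℂ) * Complex.I ≠ 0 := mul_ne_zero (by exact_mod_cast hk) Complex.I_ne_zero
    have := integral_exp_mul_complex (a := -Real.pi) (b := Real.pi) hc
    have h2 : ∀ θ : ℝ, (k : ℂ) * θ * Complex.I = (k : ℂ) * Complex.I * θ := fun θ => by ring
    simp only [h2, this]
    rw [div_eq_zero_iff]
    left
    rw [sub_eq_zero, Complex.exp_eq_exp_iff_exists_int]
    exact ⟨k, by push_cast; ring⟩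

/-- Expand |g|² as an absolutely convergent double series of characters e^{i(m-n)θ}; integration
over the circle keeps only m = n. -/
lemma hasSum_circle {a : ℕ → ℂ} {g : ℂ → ℂ} (h : IsEntireSeries a g) (r : ℝ) :
    HasSum (fun n => 2 * Real.pi * (‖a n‖ ^ 2 * r ^ (2 * n)))
      (∫ θ in (-Real.pi)..Real.pi, ‖g (r * Complex.exp (θ * Complex.I))‖ ^ 2) := by
  set F : ℕ × ℕ → C(ℝ, ℂ) := fun p =>
    ⟨fun θ => (a p.1 * (r * Complex.exp (θ * Complex.I)) ^ p.1) *
      (starRingEnd ℂ) (a p.2 * (r * Complex.exp (θ * Complex.I)) ^ p.2), by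
        have : Continuous (starRingEnd ℂ) := Complex.continuous_conj
        fun_prop⟩ with hF
  have hs := h.summable_norm r
  have hnn : ∀ n, 0 ≤ ‖a n‖ * |r| ^ n := fun n => by positivity
  have hsum2 : Summable fun p : ℕ × ℕ => (‖a p.1‖ * |r| ^ p.1) * (‖a p.2‖ * |r| ^ p.2) :=
    hs.mul_of_nonneg hs hnn hnn
  have hFn : ∀ p θ, ‖F p θ‖ = (‖a p.1‖ * |r| ^ p.1) * (‖a p.2‖ * |r| ^ p.2) := by
    intro p θ
    simp [hF, norm_pow, Complex.norm_exp_ofReal_mul_I]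
  have key := intervalIntegral.hasSum_intervalIntegral_of_summable_norm (a := -Real.pi) (b := Real.pi)
    (f := F) (by
      refine Summable.of_nonneg_of_le (fun _ => norm_nonneg _) (fun p => ?_) hsum2
      refine (ContinuousMap.norm_le _ (by positivity)).2 fun θ => ?_
      exact (hFn p θ).le)
  have h1 : ∀ p : ℕ × ℕ, ∫ θ in (-Real.pi)..Real.pi, F p θ =
      if p.1 = p.2 then ((2 * Real.pi * (‖a p.1‖ ^ 2 * r ^ (2 * p.1)) : ℝ) : ℂ) else 0 := by
    intro p
    have e : ∀ θ : ℝ, F p θ = (a p.1 * r ^ p.1 * (starRingEnd ℂ) (a p.2) * r ^ p.2) *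
        Complex.exp (((p.1 : ℤ) - p.2 : ℤ) * θ * Complex.I) := by
      intro θ
      have : Complex.exp (((p.1 : ℤ) - p.2 : ℤ) * θ * Complex.I) =
          Complex.exp (θ * Complex.I) ^ p.1 * (starRingEnd ℂ) (Complex.exp (θ * Complex.I)) ^ p.2 := by
        rw [← Complex.exp_conj, ← Complex.exp_nat_mul, ← Complex.exp_nat_mul, ← Complex.exp_add]
        congr 1
        push_cast
        simp
        ring
      rw [this]
      simp only [hF, ContinuousMap.coe_mk, map_mul, map_pow, Complex.conj_ofReal, mul_pow]
      ring
    simp only [e]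
    rw [intervalIntegral.integral_const_mul, intervalIntegral_exp_int]
    by_cases hp : p.1 = p.2
    · rw [if_pos (by omega), if_pos hp, ← hp]
      have : a p.1 * (starRingEnd ℂ) (a p.1) = ((‖a p.1‖ ^ 2 : ℝ) : ℂ) := by
        rw [Complex.mul_conj, Complex.normSq_eq_norm_sq]
      calc _ = (a p.1 * (starRingEnd ℂ) (a p.1)) * (r ^ (2 * p.1)) * (2 * Real.pi) := by ring
        _ = _ := by rw [this]; push_cast; ring
    · rw [if_neg (by omega), if_neg hp, mul_zero]
  have h2 : ∫ θ in (-Real.pi)..Real.pi, ∑' p, F p θ =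
      ((∫ θ in (-Real.pi)..Real.pi, ‖g (r * Complex.exp (θ * Complex.I))‖ ^ 2 : ℝ) : ℂ) := by
    rw [← intervalIntegral.integral_ofReal]
    refine intervalIntegral.integral_congr fun θ _ => ?_
    have hg := h (r * Complex.exp (θ * Complex.I))
    have hgc := Complex.hasSum_conj'.2 hg
    have := hg.mul hgc (by
      have := hsum2
      refine Summable.of_norm ?_
      refine hsum2.congr fun p => ?_
      exact (hFn p θ).symm)
    have h3 := this.tsum_eq
    simp only [hF, ContinuousMap.coe_mk]
    rw [h3, Complex.mul_conj, Complex.normSq_eq_norm_sq]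
  rw [h2] at key
  simp only [h1] at key
  rw [← Complex.hasSum_ofReal]
  -- The double sum is supported on the diagonal, hence is a sum over ℕ.
  have hinj : Function.Injective fun n : ℕ => (n, n) := fun a b hab => (Prod.ext_iff.1 hab).1
  have := (hinj.hasSum_iff (f := fun p : ℕ × ℕ => if p.1 = p.2 then
    ((2 * Real.pi * (‖a p.1‖ ^ 2 * r ^ (2 * p.1)) : ℝ) : ℂ) else 0) (by
      rintro ⟨x, y⟩ hxy
      rw [if_neg]
      intro hx
      exact hxy ⟨x, Prod.ext rfl hx⟩)).2 key
  refine this.congr_fun ?_ |> id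
  intro n
  simp

/-- In extended nonnegative form the identity can be integrated in r and summed in n without any
integrability condition. -/
lemma lintegral_circle {a : ℕ → ℂ} {g : ℂ → ℂ} (h : IsEntireSeries a g) (r : ℝ) :
    ∫⁻ θ in Set.Ioo (-Real.pi) Real.pi, ‖g (r * Complex.exp (θ * Complex.I))‖ₑ ^ 2 =
      ∑' n, ENNReal.ofReal (2 * Real.pi * (‖a n‖ ^ 2 * r ^ (2 * n))) := by
  have hs := hasSum_circle h r
  have hc := h.differentiable.continuous
  rw [← ENNReal.ofReal_tsum_of_nonneg (fun n => by rw [pow_mul]; positivity) hs.summable, hs.tsum_eq,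
    intervalIntegral.integral_of_le (by linarith [Real.pi_pos]), integral_Ioc_eq_integral_Ioo,
    ofReal_integral_eq_lintegral_ofReal]
  · refine lintegral_congr fun θ => ?_
    rw [ENNReal.ofReal_pow (norm_nonneg _), ofReal_norm]
  · refine (Continuous.integrableOn_Icc (by fun_prop)).mono_set Set.Ioo_subset_Icc_self
  · exact Filter.Eventually.of_forall fun θ => by positivity

lemma lintegral_polar {F : ℂ → ℝ≥0∞} (hF : Measurable F) {W : ℝ → ℝ≥0∞} (hW : Measurable W) :
    ∫⁻ z : ℂ, F z * W ‖z‖ = ∫⁻ r in Set.Ioi (0 : ℝ), (ENNReal.ofReal r * W r) *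
      ∫⁻ θ in Set.Ioo (-Real.pi) Real.pi, F (r * Complex.exp (θ * Complex.I)) := by
  rw [← Complex.lintegral_comp_polarCoord_symm, polarCoord_target, Measure.volume_eq_prod,
    ← Measure.prod_restrict, lintegral_prod]
  · refine setLIntegral_congr_fun measurableSet_Ioi fun r hr => ?_
    rw [← lintegral_const_mul]
    · refine lintegral_congr fun θ => ?_
      have : ‖Complex.polarCoord.symm (r, θ)‖ = r := by
        rw [Complex.norm_polarCoord_symm, abs_of_pos hr]
      rw [this, Complex.polarCoord_symm_apply, Complex.exp_mul_I]
      simp only [smul_eq_mul, Complex.ofReal_cos, Complex.ofReal_sin]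
      ring
    · exact hF.comp (by fun_prop)
  · have : Measurable fun p : ℝ × ℝ => Complex.polarCoord.symm p := by
      simp only [Complex.polarCoord_symm_apply]
      fun_prop
    fun_prop

/-- Parseval's identity for entire functions and radial weights. -/
lemma lintegral_radial {a : ℕ → ℂ} {g : ℂ → ℂ} (h : IsEntireSeries a g) {W : ℝ → ℝ≥0∞}
    (hW : Measurable W) :
    ∫⁻ z : ℂ, ‖g z‖ₑ ^ 2 * W ‖z‖ = ∑' n, ‖a n‖ₑ ^ 2 * ∫⁻ z : ℂ, ‖z‖ₑ ^ (2 * n) * W ‖z‖ := by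
  have hc := h.differentiable.continuous
  rw [lintegral_polar (by fun_prop) hW]
  simp only [lintegral_circle h, ← ENNReal.tsum_mul_left]
  rw [lintegral_tsum (fun n => by fun_prop)]
  refine tsum_congr fun n => ?_
  rw [lintegral_polar (by fun_prop) hW, ← lintegral_const_mul' _ _ (by finiteness)]
  refine setLIntegral_congr_fun measurableSet_Ioi fun r hr => ?_
  have hr' : (0:ℝ) < r := hr
  have : ∀ θ : ℝ, ‖(r : ℂ) * Complex.exp (θ * Complex.I)‖ₑ = ENNReal.ofReal r := by
    intro θ
    rw [← ofReal_norm, norm_mul, Complex.norm_exp_ofReal_mul_I]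
    simp [abs_of_pos hr']
  simp only [this, lintegral_const, Measure.restrict_apply MeasurableSet.univ, Set.univ_inter,
    Real.volume_Ioo]
  rw [ENNReal.ofReal_mul (p := 2 * Real.pi) (by positivity),
    ENNReal.ofReal_mul (p := ‖a n‖ ^ 2) (by positivity),
    ENNReal.ofReal_pow (norm_nonneg _), ofReal_norm, ENNReal.ofReal_pow hr'.le,
    show Real.pi - -Real.pi = 2 * Real.pi by ring]
  ring

lemma integrable_norm_pow_mul_gaussian (n : ℕ) {κ : ℝ} (hκ : 0 < κ) :
    Integrable fun z : ℂ => ‖z‖ ^ n * Real.exp (-(κ * ‖z‖ ^ 2)) := by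
  have hi : IntegrableOn (fun r : ℝ => r ^ (n + 1 : ℝ) * Real.exp (-κ * r ^ 2)) (Set.Ioi 0) :=
    integrableOn_rpow_mul_exp_neg_mul_sq hκ (by linarith [(Nat.cast_nonneg n : (0:ℝ) ≤ n)])
  refine ⟨by fun_prop, ?_⟩
  have h0 : ∫⁻ z : ℂ, ‖‖z‖ ^ n * Real.exp (-(κ * ‖z‖ ^ 2))‖ₑ =
      ∫⁻ z : ℂ, 1 * ENNReal.ofReal (‖z‖ ^ n * Real.exp (-(κ * ‖z‖ ^ 2))) := by
    refine lintegral_congr fun z => ?_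
    rw [one_mul, Real.enorm_of_nonneg (by positivity)]
  rw [HasFiniteIntegral, h0, lintegral_polar (F := fun _ => 1)
    (W := fun r => ENNReal.ofReal (r ^ n * Real.exp (-(κ * r ^ 2)))) measurable_const (by fun_prop)]
  simp only [lintegral_const, Measure.restrict_apply MeasurableSet.univ, Set.univ_inter,
    Real.volume_Ioo]
  rw [lintegral_mul_const _ (by fun_prop)]
  refine ENNReal.mul_lt_top ?_ (by finiteness)
  have := hi.2
  rw [HasFiniteIntegral] at this
  refine lt_of_le_of_lt (le_of_eq ?_) this
  refine setLIntegral_congr_fun measurableSet_Ioi fun r hr => ?_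
  have hr' : (0:ℝ) < r := hr
  rw [Real.enorm_of_nonneg (by positivity), ← ENNReal.ofReal_mul hr'.le]
  congr 1
  rw [Real.rpow_add_one hr'.ne', Real.rpow_natCast]
  ring_nf

lemma integral_norm_pow_mul_gaussian (n : ℕ) {κ : ℝ} (hκ : 0 < κ) :
    ∫ z : ℂ, ‖z‖ ^ (2 * n) * Real.exp (-(κ * ‖z‖ ^ 2)) = Real.pi * n ! / κ ^ (n + 1) := by
  have := Complex.integral_rpow_mul_exp_neg_mul_rpow (p := 2) (q := (2 * n : ℕ)) (b := κ)
    (by norm_num) (by linarith [(Nat.cast_nonneg (2 * n) : (0:ℝ) ≤ (2 * n : ℕ))]) hκ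
  simp only [Real.rpow_natCast, Real.rpow_two, neg_mul] at this
  rw [this]
  have e : (((2 * n : ℕ) : ℝ) + 2) / 2 = n + 1 := by push_cast; ring
  rw [neg_div, e, Real.Gamma_nat_eq_factorial, Real.rpow_neg hκ.le]
  have : κ ^ ((n : ℝ) + 1) = κ ^ (n + 1) := by exact_mod_cast Real.rpow_natCast κ (n + 1)
  rw [this]
  field_simp

lemma lintegral_norm_pow_mul_gaussian (n : ℕ) {κ : ℝ} (hκ : 0 < κ) :
    ∫⁻ z : ℂ, ‖z‖ₑ ^ (2 * n) * ENNReal.ofReal (Real.exp (-(κ * ‖z‖ ^ 2))) =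
      ENNReal.ofReal (Real.pi * n ! / κ ^ (n + 1)) := by
  rw [← integral_norm_pow_mul_gaussian n hκ, ofReal_integral_eq_lintegral_ofReal
    (integrable_norm_pow_mul_gaussian _ hκ) (Filter.Eventually.of_forall fun _ => by positivity)]
  refine lintegral_congr fun z => ?_
  rw [ENNReal.ofReal_mul (by positivity), ENNReal.ofReal_pow (norm_nonneg _), ofReal_norm]

/-- Parseval's identity for entire functions and Gaussian weights. -/
lemma lintegral_gaussian {a : ℕ → ℂ} {g : ℂ → ℂ} (h : IsEntireSeries a g) {κ : ℝ} (hκ : 0 < κ) :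
    ∫⁻ z : ℂ, ‖g z‖ₑ ^ 2 * ENNReal.ofReal (Real.exp (-(κ * ‖z‖ ^ 2))) =
      ∑' n, ‖a n‖ₑ ^ 2 * ENNReal.ofReal (Real.pi * n ! / κ ^ (n + 1)) := by
  rw [lintegral_radial h (W := fun r => ENNReal.ofReal (Real.exp (-(κ * r ^ 2)))) (by fun_prop)]
  simp only [lintegral_norm_pow_mul_gaussian _ hκ]

/-! ### Coordinates in the basis of special Hermite functions -/

/-- The entire function `∑ cₙ zⁿ / √(π n!)`. -/
noncomputable def holo (c : ℕ → ℂ) (z : ℂ) : ℂ := ∑' n, c n / (√(Real.pi * n !) : ℝ) * z ^ n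

/-- The function of the Bargmann-Fock space with coordinates `c` in the basis of the `φₙ`. -/
noncomputable def wave (c : ℕ → ℂ) (z : ℂ) : ℂ :=
  Complex.exp (-((‖z‖ ^ 2 / 2 : ℝ) : ℂ)) * holo c z

def SqSummable (c : ℕ → ℂ) : Prop := Summable fun n => ‖c n‖ ^ 2

lemma pi_mul_factorial_pos (n : ℕ) : 0 < Real.pi * n ! := by positivity

lemma SqSummable.isEntireSeries {c : ℕ → ℂ} (hc : SqSummable c) :
    IsEntireSeries (fun n => c n / (√(Real.pi * n !) : ℝ)) (holo c) := by
  intro z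
  refine Summable.hasSum (Summable.of_norm ?_)
  have h1 : Summable fun n : ℕ => (‖z‖ ^ 2) ^ n / n ! := Real.summable_pow_div_factorial _
  refine Summable.of_nonneg_of_le (fun _ => norm_nonneg _) (fun n => ?_) (hc.add h1)
  rw [norm_mul, norm_div, norm_pow, Complex.norm_real, Real.norm_of_nonneg (Real.sqrt_nonneg _)]
  have h2 : √(n ! : ℝ) ≤ √(Real.pi * n !) := by
    apply Real.sqrt_le_sqrt
    have : (0:ℝ) < n ! := by positivity
    nlinarith [Real.pi_gt_three]
  have h3 : 0 < √(n ! : ℝ) := by positivity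
  calc ‖c n‖ / √(Real.pi * n !) * ‖z‖ ^ n ≤ ‖c n‖ / √(n ! : ℝ) * ‖z‖ ^ n := by gcongr
    _ = ‖c n‖ * (‖z‖ ^ n / √(n ! : ℝ)) := by ring
    _ ≤ ‖c n‖ ^ 2 + (‖z‖ ^ n / √(n ! : ℝ)) ^ 2 := by
      nlinarith [sq_nonneg (‖c n‖ - ‖z‖ ^ n / √(n ! : ℝ)), sq_nonneg (‖c n‖),
        sq_nonneg (‖z‖ ^ n / √(n ! : ℝ))]
    _ = _ := by rw [div_pow, Real.sq_sqrt (by positivity)]; ring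

lemma norm_wave (c : ℕ → ℂ) (z : ℂ) : ‖wave c z‖ = Real.exp (-(‖z‖ ^ 2 / 2)) * ‖holo c z‖ := by
  rw [wave, norm_mul, ← Complex.ofReal_neg, ← Complex.ofReal_exp, Complex.norm_real,
    Real.norm_of_nonneg (Real.exp_nonneg _)]

lemma enorm_wave_sq (c : ℕ → ℂ) (z : ℂ) : ‖wave c z‖ₑ ^ 2 =
    ‖holo c z‖ₑ ^ 2 * ENNReal.ofReal (Real.exp (-(1 * ‖z‖ ^ 2))) := by
  rw [← ofReal_norm, norm_wave, ← ENNReal.ofReal_pow (by positivity), mul_pow, ← Real.exp_nat_mul,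
    ENNReal.ofReal_mul (by positivity), ENNReal.ofReal_pow (norm_nonneg _), ofReal_norm, mul_comm]
  congr 3
  push_cast; ring

lemma SqSummable.continuous_wave {c : ℕ → ℂ} (hc : SqSummable c) : Continuous (wave c) := by
  have := hc.isEntireSeries.differentiable.continuous
  unfold wave
  fun_prop

lemma enorm_coef_sq_mul (x : ℂ) (n : ℕ) :
    ‖x / (√(Real.pi * n !) : ℝ)‖ₑ ^ 2 * ENNReal.ofReal (Real.pi * n ! / 1 ^ (n + 1)) = ‖x‖ₑ ^ 2 := by
  have h := pi_mul_factorial_pos n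
  rw [← ofReal_norm, ← ofReal_norm, ← ENNReal.ofReal_pow (norm_nonneg _),
    ← ENNReal.ofReal_pow (norm_nonneg _), ← ENNReal.ofReal_mul (by positivity), norm_div,
    Complex.norm_real, Real.norm_of_nonneg (Real.sqrt_nonneg _), div_pow, Real.sq_sqrt h.le]
  congr 1
  field_simp
  simp

lemma lintegral_wave {c : ℕ → ℂ} (hc : SqSummable c) :
    ∫⁻ z, ‖wave c z‖ₑ ^ 2 = ∑' n, ‖c n‖ₑ ^ 2 := by
  simp only [enorm_wave_sq]
  rw [lintegral_gaussian hc.isEntireSeries one_pos]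
  simp only [enorm_coef_sq_mul]

/-- The coordinates of `(z - a) u`. -/
noncomputable def shiftCoef (a : ℂ) (c : ℕ → ℂ) (n : ℕ) : ℂ := (√n : ℝ) * c (n - 1) - a * c n

lemma isEntireSeries_shift (a : ℂ) {c : ℕ → ℂ} (hc : SqSummable c) :
    IsEntireSeries (fun n => shiftCoef a c n / (√(Real.pi * n !) : ℝ))
      (fun z => (z - a) * holo c z) := by
  intro z
  have h := hc.isEntireSeries z
  have h1 : HasSum (fun n : ℕ => (√n : ℝ) * c (n - 1) / (√(Real.pi * n !) : ℝ) * z ^ n)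
      (z * holo c z) := by
    -- The term n = 0 vanishes because of `√0`, so the truncated index n - 1 = 0 is harmless there.
    rw [← hasSum_nat_add_iff' 1]
    simp only [Finset.range_one, Finset.sum_singleton, Nat.cast_zero, Real.sqrt_zero,
      Complex.ofReal_zero, zero_mul, zero_div, sub_zero]
    refine (h.mul_left z).congr_fun ?_ |> id
    intro n
    have e : √(Real.pi * (n + 1)!) = √(n + 1 : ℕ) * √(Real.pi * n !) := by
      rw [← Real.sqrt_mul (by positivity), Nat.factorial_succ]
      congr 1
      push_cast; ring
    have h1 : ((√(n + 1 : ℕ) : ℝ) : ℂ) ≠ 0 := by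
      exact_mod_cast (Real.sqrt_pos.2 (by positivity)).ne'
    have h2 : ((√(Real.pi * n !) : ℝ) : ℂ) ≠ 0 := by
      exact_mod_cast (Real.sqrt_pos.2 (by positivity)).ne'
    rw [e, Nat.add_sub_cancel]
    push_cast at h1 h2 ⊢
    field_simp
    ring
  have h2 := h1.sub (h.mul_left a)
  rw [← sub_mul] at h2
  refine h2.congr_fun ?_ |> id
  intro n
  simp only [shiftCoef]
  ring

/-- Multiplication by z - a is a weighted shift on coordinates, so the second moment about any point
is an ℓ² norm. -/
lemma lintegral_shift (a : ℂ) {c : ℕ → ℂ} (hc : SqSummable c) :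
    ∫⁻ z, ‖z - a‖ₑ ^ 2 * ‖wave c z‖ₑ ^ 2 = ∑' n, ‖shiftCoef a c n‖ₑ ^ 2 := by
  have := lintegral_gaussian (isEntireSeries_shift a hc) one_pos
  simp only [enorm_coef_sq_mul] at this
  rw [← this]
  refine lintegral_congr fun z => ?_
  rw [enorm_wave_sq, enorm_mul]
  ring

lemma tsum_enorm_sq {d : ℕ → ℂ} (hd : SqSummable d) :
    ∑' n, ‖d n‖ₑ ^ 2 = ENNReal.ofReal (∑' n, ‖d n‖ ^ 2) := by
  rw [ENNReal.ofReal_tsum_of_nonneg (fun _ => by positivity) hd]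
  refine tsum_congr fun n => ?_
  rw [ENNReal.ofReal_pow (norm_nonneg _), ofReal_norm]

lemma sqSummable_iff {d : ℕ → ℂ} : SqSummable d ↔ ∑' n, ‖d n‖ₑ ^ 2 < ∞ := by
  constructor
  · intro h
    rw [tsum_enorm_sq h]
    exact ENNReal.ofReal_lt_top
  · intro h
    have := ENNReal.summable_toReal h.ne
    refine this.congr fun n => ?_
    simp

lemma integrable_and_integral_of_lintegral {g : ℂ → ℂ} (hg : Continuous g) {x : ℝ} (hx : 0 ≤ x)
    (h : ∫⁻ z, ‖g z‖ₑ ^ 2 = ENNReal.ofReal x) :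
    Integrable (fun z => ‖g z‖ ^ 2) ∧ ∫ z, ‖g z‖ ^ 2 = x := by
  have e : ∀ z, ENNReal.ofReal (‖g z‖ ^ 2) = ‖g z‖ₑ ^ 2 := fun z => by
    rw [ENNReal.ofReal_pow (norm_nonneg _), ofReal_norm]
  have hm : AEStronglyMeasurable (fun z => ‖g z‖ ^ 2) volume := by fun_prop
  have hnn : ∀ z, 0 ≤ ‖g z‖ ^ 2 := fun z => by positivity
  constructor
  · rw [← lintegral_ofReal_ne_top_iff_integrable hm (Filter.Eventually.of_forall hnn)]
    simp only [e, h]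
    finiteness
  · rw [integral_eq_lintegral_of_nonneg_ae (Filter.Eventually.of_forall hnn) hm]
    simp only [e, h, ENNReal.toReal_ofReal hx]

lemma SqSummable.integrable_wave {c : ℕ → ℂ} (hc : SqSummable c) :
    Integrable (fun z => ‖wave c z‖ ^ 2) ∧ ∫ z, ‖wave c z‖ ^ 2 = ∑' n, ‖c n‖ ^ 2 :=
  integrable_and_integral_of_lintegral hc.continuous_wave (tsum_nonneg fun _ => by positivity)
    (by rw [lintegral_wave hc, tsum_enorm_sq hc])

lemma mass_wave {c : ℕ → ℂ} (hc : SqSummable c) : mass (wave c) = ∑' n, ‖c n‖ ^ 2 :=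
  hc.integrable_wave.2

lemma SqSummable.wave_mem {c : ℕ → ℂ} (hc : SqSummable c) : wave c ∈ bargmannFock := by
  refine ⟨⟨holo c, hc.isEntireSeries.differentiable, fun z => rfl⟩, ?_⟩
  rw [memLp_two_iff_integrable_sq_norm hc.continuous_wave.aestronglyMeasurable]
  exact hc.integrable_wave.1

lemma isEntireSeries_coef {f : ℂ → ℂ} (hf : Differentiable ℂ f) :
    ∃ c : ℕ → ℂ, IsEntireSeries (fun n => c n / (√(Real.pi * n !) : ℝ)) f := by
  refine ⟨fun n => (√(Real.pi * n !) : ℝ) * ((n ! : ℂ)⁻¹ * iteratedDeriv n f 0), ?_⟩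
  have := Differentiable.isEntireSeries hf
  convert this using 2 with n
  have h2 : ((√(Real.pi * n !) : ℝ) : ℂ) ≠ 0 := by
    exact_mod_cast (Real.sqrt_pos.2 (by positivity)).ne'
  field_simp

lemma holo_eq {c : ℕ → ℂ} {f : ℂ → ℂ}
    (h : IsEntireSeries (fun n => c n / (√(Real.pi * n !) : ℝ)) f) : holo c = f :=
  funext fun z => (h z).tsum_eq

/-- Parseval with the weight e^{-|z|²} turns square integrability into square summability; from here
on the problem lives in ℓ². -/
lemma exists_eq_wave {u : ℂ → ℂ} (hu : u ∈ bargmannFock) : ∃ c, SqSummable c ∧ u = wave c := by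
  obtain ⟨⟨f, hf, hfu⟩, hu2⟩ := hu
  obtain ⟨c, hc⟩ := isEntireSeries_coef hf
  have hw : u = wave c := by
    funext z
    rw [hfu, wave, holo_eq hc]
  refine ⟨c, ?_, hw⟩
  rw [sqSummable_iff]
  have := lintegral_gaussian hc one_pos
  simp only [enorm_coef_sq_mul] at this
  rw [← this]
  have h2 := hu2.2
  rw [eLpNorm_lt_top_iff_lintegral_rpow_enorm_lt_top two_ne_zero ENNReal.ofNat_ne_top] at h2
  refine lt_of_le_of_lt (le_of_eq (lintegral_congr fun z => ?_)) h2
  rw [hw, ← holo_eq hc, ← enorm_wave_sq]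
  simp

lemma SqSummable.continuous_shift {c : ℕ → ℂ} (hc : SqSummable c) (a : ℂ) :
    Continuous (fun z => (z - a) * wave c z) := by
  have := hc.continuous_wave
  fun_prop

lemma integrable_shift {a : ℂ} {c : ℕ → ℂ} (hc : SqSummable c) (hd : SqSummable (shiftCoef a c)) :
    Integrable (fun z => ‖(z - a) * wave c z‖ ^ 2) ∧
      ∫ z, ‖(z - a) * wave c z‖ ^ 2 = ∑' n, ‖shiftCoef a c n‖ ^ 2 := by
  refine integrable_and_integral_of_lintegral (hc.continuous_shift a)
    (tsum_nonneg fun _ => by positivity) ?_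
  rw [← tsum_enorm_sq hd, ← lintegral_shift a hc]
  simp only [enorm_mul, mul_pow]

/-! ### Finite second moment in coordinates -/

/-- Coordinates of functions of finite energy. -/
def WSummable (c : ℕ → ℂ) : Prop := Summable fun n : ℕ => ((n : ℝ) + 1) * ‖c n‖ ^ 2

lemma WSummable.sq {c : ℕ → ℂ} (hc : WSummable c) : SqSummable c := by
  refine Summable.of_nonneg_of_le (fun _ => by positivity) (fun n => ?_) hc
  have : (0:ℝ) ≤ n := Nat.cast_nonneg n
  nlinarith [sq_nonneg ‖c n‖]

lemma sqrt_mul_sqSummable {c : ℕ → ℂ} (hc : WSummable c) :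
    SqSummable fun n => (√n : ℝ) * c (n - 1) := by
  unfold SqSummable
  rw [← summable_nat_add_iff 1]
  refine Summable.congr hc fun n => ?_
  rw [norm_mul, mul_pow, Complex.norm_real, Real.norm_of_nonneg (Real.sqrt_nonneg _),
    Real.sq_sqrt (by positivity)]
  push_cast
  simp

lemma SqSummable.add {c d : ℕ → ℂ} (hc : SqSummable c) (hd : SqSummable d) :
    SqSummable (fun n => c n + d n) := by
  refine Summable.of_nonneg_of_le (fun _ => by positivity) (fun n => ?_)
    ((hc.mul_left 2).add (hd.mul_left 2))
  have := norm_add_le (c n) (d n)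
  nlinarith [norm_nonneg (c n + d n), norm_nonneg (c n), norm_nonneg (d n),
    sq_nonneg (‖c n‖ - ‖d n‖)]

lemma SqSummable.const_mul {c : ℕ → ℂ} (hc : SqSummable c) (a : ℂ) :
    SqSummable (fun n => a * c n) := by
  unfold SqSummable
  simp only [norm_mul, mul_pow]
  exact Summable.mul_left _ hc

lemma WSummable.shift {c : ℕ → ℂ} (hc : WSummable c) (a : ℂ) : SqSummable (shiftCoef a c) := by
  have := (sqrt_mul_sqSummable hc).add (hc.sq.const_mul (-a))
  refine Summable.congr this fun n => ?_
  simp only [shiftCoef]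
  congr 2
  ring

lemma wsummable_iff {c : ℕ → ℂ} : WSummable c ↔ SqSummable (shiftCoef 0 c) := by
  unfold SqSummable WSummable
  rw [← summable_nat_add_iff (f := fun n => ‖shiftCoef 0 c n‖ ^ 2) 1]
  refine summable_congr fun n => ?_
  simp only [shiftCoef, zero_mul, sub_zero]
  rw [norm_mul, mul_pow, Complex.norm_real, Real.norm_of_nonneg (Real.sqrt_nonneg _),
    Real.sq_sqrt (by positivity)]
  push_cast
  simp

lemma tsum_shift_zero {c : ℕ → ℂ} (hc : WSummable c) :
    ∑' n, ‖shiftCoef 0 c n‖ ^ 2 = ∑' n : ℕ, ((n : ℝ) + 1) * ‖c n‖ ^ 2 := by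
  rw [(wsummable_iff.1 hc).tsum_eq_zero_add]
  simp only [shiftCoef, zero_mul, sub_zero, Nat.cast_zero, Real.sqrt_zero, Complex.ofReal_zero,
    norm_zero, Nat.add_sub_cancel]
  rw [zero_pow two_ne_zero, zero_add]
  refine tsum_congr fun n => ?_
  rw [norm_mul, mul_pow, Complex.norm_real, Real.norm_of_nonneg (Real.sqrt_nonneg _),
    Real.sq_sqrt (by positivity)]
  push_cast
  simp

lemma weightedNorm_sq (u : ℂ → ℂ) (hu : Continuous u) :
    weightedNorm u ^ 2 = (∫⁻ z, ‖u z‖ₑ ^ 2) + ∫⁻ z, ‖z - 0‖ₑ ^ 2 * ‖u z‖ₑ ^ 2 := by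
  rw [weightedNorm, eLpNorm_eq_lintegral_rpow_enorm_toReal two_ne_zero ENNReal.ofNat_ne_top,
    ← lintegral_add_left (by fun_prop), ← ENNReal.rpow_natCast, ← ENNReal.rpow_mul]
  simp only [ENNReal.toReal_ofNat, Nat.cast_ofNat, one_div, ne_eq, OfNat.ofNat_ne_zero,
    not_false_eq_true, inv_mul_cancel₀, ENNReal.rpow_one, ENNReal.rpow_ofNat, sub_zero]
  refine lintegral_congr fun z => ?_
  rw [enorm_smul, mul_pow, Real.enorm_of_nonneg (Real.sqrt_nonneg _),
    ← ENNReal.ofReal_pow (Real.sqrt_nonneg _), Real.sq_sqrt (by positivity),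
    ENNReal.ofReal_add (by positivity) (by positivity), ENNReal.ofReal_one,
    ENNReal.ofReal_pow (norm_nonneg _), ofReal_norm]
  ring

lemma weightedNorm_wave_sq {c : ℕ → ℂ} (hc : SqSummable c) :
    weightedNorm (wave c) ^ 2 = (∑' n, ‖c n‖ₑ ^ 2) + ∑' n, ‖shiftCoef 0 c n‖ₑ ^ 2 := by
  rw [weightedNorm_sq _ hc.continuous_wave, lintegral_wave hc, lintegral_shift 0 hc]

lemma weightedNorm_wave_lt_top {c : ℕ → ℂ} (hc : SqSummable c) :
    weightedNorm (wave c) < ∞ ↔ WSummable c := by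
  rw [wsummable_iff, sqSummable_iff]
  have h1 := sqSummable_iff.1 hc
  have h2 := weightedNorm_wave_sq hc
  constructor
  · intro h
    have : weightedNorm (wave c) ^ 2 < ∞ := by finiteness
    rw [h2] at this
    exact (ENNReal.add_lt_top.1 this).2
  · intro h
    have : weightedNorm (wave c) ^ 2 < ∞ := by
      rw [h2]; exact ENNReal.add_lt_top.2 ⟨h1, h⟩
    exact (ENNReal.pow_lt_top_iff.1 this).resolve_right two_ne_zero

lemma WSummable.integrable_weight {c : ℕ → ℂ} (hc : WSummable c) (a : ℂ) :
    Integrable (fun z => (‖z - a‖ ^ 2 - 1) * ‖wave c z‖ ^ 2) ∧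
    ∫ z, (‖z - a‖ ^ 2 - 1) * ‖wave c z‖ ^ 2 =
      (∑' n, ‖shiftCoef a c n‖ ^ 2) - ∑' n, ‖c n‖ ^ 2 := by
  have h1 := integrable_shift hc.sq (hc.shift a)
  have h2 := hc.sq.integrable_wave
  have e : (fun z => (‖z - a‖ ^ 2 - 1) * ‖wave c z‖ ^ 2) =
      fun z => ‖(z - a) * wave c z‖ ^ 2 - ‖wave c z‖ ^ 2 := by
    funext z
    rw [norm_mul]; ring
  rw [e]
  exact ⟨h1.1.sub h2.1, by rw [integral_sub h1.1 h2.1, h1.2, h2.2]⟩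

lemma angularMomentum_wave {c : ℕ → ℂ} (hc : WSummable c) :
    angularMomentum (wave c) = ∑' n : ℕ, (n : ℝ) * ‖c n‖ ^ 2 := by
  have := (hc.integrable_weight 0).2
  simp only [sub_zero] at this
  rw [angularMomentum, this, tsum_shift_zero hc, ← Summable.tsum_sub hc hc.sq]
  exact tsum_congr fun n => by ring

/-! ### The quartic energy in coordinates -/

/-- Square roots of the binomial weights. -/
noncomputable def gw (k i : ℕ) : ℝ := √((k.choose i : ℝ) / 2 ^ k)

lemma gw_nonneg (k i : ℕ) : 0 ≤ gw k i := Real.sqrt_nonneg _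

lemma gw_sq (k i : ℕ) : gw k i ^ 2 = (k.choose i : ℝ) / 2 ^ k := Real.sq_sqrt (by positivity)

lemma gw_symm {k i j : ℕ} (h : i + j = k) : gw k i = gw k j := by
  rw [gw, gw, Nat.choose_symm_of_eq_add h.symm]

/-- The coordinates of the (normalized) product of two functions. -/
noncomputable def bil (c d : ℕ → ℂ) (k : ℕ) : ℂ :=
  ∑ p ∈ Finset.HasAntidiagonal.antidiagonal k, gw k p.1 * (c p.1 * d p.2)

/-- Cauchy-Schwarz: the squared weights of a row are binomial probabilities and sum to one. -/
lemma norm_bil_sq_le (c d : ℕ → ℂ) (k : ℕ) :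
    ‖bil c d k‖ ^ 2 ≤ ∑ p ∈ Finset.HasAntidiagonal.antidiagonal k, ‖c p.1‖ ^ 2 * ‖d p.2‖ ^ 2 := by
  have h1 : ‖bil c d k‖ ≤ ∑ p ∈ Finset.HasAntidiagonal.antidiagonal k, gw k p.1 * (‖c p.1‖ * ‖d p.2‖) := by
    refine (norm_sum_le _ _).trans (le_of_eq (Finset.sum_congr rfl fun p _ => ?_))
    rw [norm_mul, norm_mul, Complex.norm_real, Real.norm_of_nonneg (gw_nonneg _ _)]
  have h2 : ∑ p ∈ Finset.HasAntidiagonal.antidiagonal k, gw k p.1 ^ 2 = 1 := by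
    simp only [gw_sq]
    rw [← Finset.sum_div, Finset.Nat.sum_antidiagonal_eq_sum_range_succ_mk]
    rw [div_eq_one_iff_eq (by positivity)]
    exact_mod_cast Nat.sum_range_choose k
  calc ‖bil c d k‖ ^ 2 ≤ (∑ p ∈ Finset.HasAntidiagonal.antidiagonal k, gw k p.1 * (‖c p.1‖ * ‖d p.2‖)) ^ 2 := by
        gcongr
    _ ≤ (∑ p ∈ Finset.HasAntidiagonal.antidiagonal k, gw k p.1 ^ 2) *
          ∑ p ∈ Finset.HasAntidiagonal.antidiagonal k, (‖c p.1‖ * ‖d p.2‖) ^ 2 :=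
        Finset.sum_mul_sq_le_sq_mul_sq _ _ _
    _ = _ := by simp only [h2, one_mul, mul_pow]

lemma summable_antidiagonal {c d : ℕ → ℂ} (hc : SqSummable c) (hd : SqSummable d) :
    Summable fun k => ∑ p ∈ Finset.HasAntidiagonal.antidiagonal k, ‖c p.1‖ ^ 2 * ‖d p.2‖ ^ 2 :=
  summable_sum_mul_antidiagonal_of_summable_mul
    (f := fun n => ‖c n‖ ^ 2) (g := fun n => ‖d n‖ ^ 2)
    (Summable.mul_of_nonneg hc hd (fun _ => by positivity) (fun _ => by positivity))

lemma SqSummable.bil {c d : ℕ → ℂ} (hc : SqSummable c) (hd : SqSummable d) :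
    SqSummable (bil c d) :=
  Summable.of_nonneg_of_le (fun _ => by positivity) (norm_bil_sq_le c d)
    (summable_antidiagonal hc hd)

/-- The Cauchy product gives the coefficients of f². The prefactor is the one for which z^k has
squared norm 1/(2π) under the weight e^{-2|z|²}, independently of k. -/
lemma isEntireSeries_sq {c : ℕ → ℂ} (hc : SqSummable c) :
    IsEntireSeries (fun k => (√(2 ^ k / (Real.pi * (Real.pi * k !))) : ℝ) * bil c c k)
      (fun z => holo c z ^ 2) := by
  intro z
  have h := hc.isEntireSeries z
  have hn : Summable fun n => ‖c n / (√(Real.pi * n !) : ℝ) * z ^ n‖ := h.summable.norm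
  have h2 := (summable_norm_sum_mul_antidiagonal_of_summable_norm hn hn).of_norm.hasSum
  rw [← tsum_mul_tsum_eq_tsum_sum_antidiagonal_of_summable_norm hn hn, h.tsum_eq, ← sq] at h2
  refine h2.congr_fun ?_ |> id
  intro k
  simp only [bil]
  rw [Finset.mul_sum, Finset.sum_mul]
  refine Finset.sum_congr rfl fun p hp => ?_
  have hp' : p.1 + p.2 = k := Finset.HasAntidiagonal.mem_antidiagonal.1 hp
  have e : √(2 ^ k / (Real.pi * (Real.pi * k !))) * gw k p.1 =
      1 / (√(Real.pi * p.1 !) * √(Real.pi * p.2 !)) := by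
    rw [gw, ← Real.sqrt_mul (by positivity), ← Real.sqrt_mul (by positivity), ← Real.sqrt_one,
      ← Real.sqrt_div (by norm_num)]
    congr 1
    have := Nat.choose_mul_factorial_mul_factorial (n := k) (k := p.1) (by omega)
    rw [show k - p.1 = p.2 by omega] at this
    have h3 : (k ! : ℝ) = k.choose p.1 * p.1 ! * p.2 ! := by exact_mod_cast this.symm
    rw [h3]
    have : (0:ℝ) < k.choose p.1 := by exact_mod_cast Nat.choose_pos (by omega)
    field_simp
  have e' : ((√(2 ^ k / (Real.pi * (Real.pi * k !))) : ℝ) : ℂ) * (gw k p.1 : ℝ) =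
      1 / ((√(Real.pi * p.1 !) : ℝ) * (√(Real.pi * p.2 !) : ℝ)) := by exact_mod_cast e
  calc _ = (((√(2 ^ k / (Real.pi * (Real.pi * k !))) : ℝ) : ℂ) * (gw k p.1 : ℝ)) *
        (c p.1 * c p.2) * z ^ k := by ring
    _ = _ := by
      rw [e', ← hp', pow_add]
      field_simp

/-- Since |u|⁴ = |f²|² e^{-2|z|²}, this is Parseval for the entire function f² with the Gaussian of
parameter two. -/
lemma lintegral_wave_four {c : ℕ → ℂ} (hc : SqSummable c) :
    ENNReal.ofReal (2 * Real.pi) * ∫⁻ z, ‖wave c z‖ₑ ^ 4 = ∑' k, ‖bil c c k‖ₑ ^ 2 := by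
  have h := lintegral_gaussian (isEntireSeries_sq hc) (κ := 2) two_pos
  have e : ∀ z, ‖wave c z‖ₑ ^ 4 =
      ‖holo c z ^ 2‖ₑ ^ 2 * ENNReal.ofReal (Real.exp (-(2 * ‖z‖ ^ 2))) := by
    intro z
    rw [show 4 = 2 * 2 from rfl, pow_mul, enorm_wave_sq, mul_pow, enorm_pow,
      ← ENNReal.ofReal_pow (by positivity), ← Real.exp_nat_mul]
    congr 4
    push_cast; ring
  simp only [e, h]
  rw [← ENNReal.tsum_mul_left]
  refine tsum_congr fun k => ?_
  rw [← ofReal_norm, ← ofReal_norm, ← ENNReal.ofReal_pow (norm_nonneg _),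
    ← ENNReal.ofReal_pow (norm_nonneg _), ← ENNReal.ofReal_mul (by positivity),
    ← ENNReal.ofReal_mul (by positivity), norm_mul, Complex.norm_real,
    Real.norm_of_nonneg (Real.sqrt_nonneg _), mul_pow, Real.sq_sqrt (by positivity)]
  congr 1
  rw [pow_succ]
  field_simp
  ring

lemma hamiltonian_wave {c : ℕ → ℂ} (hc : SqSummable c) :
    8 * Real.pi * hamiltonian (wave c) = ∑' k, ‖bil c c k‖ ^ 2 := by
  have h := lintegral_wave_four hc
  have hE := hc.bil hc
  rw [tsum_enorm_sq hE] at h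
  have h2 : ∫⁻ z, ‖wave c z ^ 2‖ₑ ^ 2 =
      ENNReal.ofReal ((∑' k, ‖bil c c k‖ ^ 2) / (2 * Real.pi)) := by
    rw [ENNReal.ofReal_div_of_pos (by positivity), ← h, mul_comm,
      ENNReal.mul_div_cancel_right (by positivity) (by finiteness)]
    refine lintegral_congr fun z => ?_
    rw [enorm_pow, ← pow_mul]
  have hcont := hc.continuous_wave
  have h3 := (integrable_and_integral_of_lintegral (g := fun z => wave c z ^ 2) (by fun_prop)
    (div_nonneg (tsum_nonneg fun _ => by positivity) (by positivity)) h2).2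
  rw [hamiltonian]
  have e : ∀ z, ‖wave c z‖ ^ 4 = ‖wave c z ^ 2‖ ^ 2 := fun z => by rw [norm_pow, ← pow_mul]
  simp only [e, h3]
  field_simp
  ring

/-! ### Variations and the Euler-Lagrange equation -/

/-- The real inner product of `ℓ²`. -/
noncomputable def ip (x y : ℕ → ℂ) : ℝ := ∑' n, ((starRingEnd ℂ) (x n) * y n).re

noncomputable def msq (c : ℕ → ℂ) : ℝ := ∑' n, ‖c n‖ ^ 2

/-- The interaction energy in coordinates. -/
noncomputable def en (c : ℕ → ℂ) : ℝ := msq (bil c c)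

/-- The second moment about the point `a` in coordinates. -/
noncomputable def kin (a : ℂ) (c : ℕ → ℂ) : ℝ := msq (shiftCoef a c)

lemma summable_conj_mul {x y : ℕ → ℂ} (hx : SqSummable x) (hy : SqSummable y) :
    Summable fun n => (starRingEnd ℂ) (x n) * y n := by
  refine Summable.of_norm (Summable.of_nonneg_of_le (fun _ => norm_nonneg _) (fun n => ?_)
    (Summable.add hx hy))
  rw [norm_mul, RCLike.norm_conj]
  nlinarith [sq_nonneg (‖x n‖ - ‖y n‖), sq_nonneg ‖x n‖, sq_nonneg ‖y n‖]

lemma summable_ip {x y : ℕ → ℂ} (hx : SqSummable x) (hy : SqSummable y) :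
    Summable fun n => ((starRingEnd ℂ) (x n) * y n).re :=
  (Complex.hasSum_re (summable_conj_mul hx hy).hasSum).summable

lemma ip_eq_re {x y : ℕ → ℂ} (hx : SqSummable x) (hy : SqSummable y) :
    ip x y = (∑' n, (starRingEnd ℂ) (x n) * y n).re :=
  (Complex.hasSum_re (summable_conj_mul hx hy).hasSum).tsum_eq

lemma msq_quad {X Y Z : ℕ → ℂ} (hX : SqSummable X) (hY : SqSummable Y) (hZ : SqSummable Z)
    (t : ℝ) : msq (fun n => X n + 2 * t * Y n + t ^ 2 * Z n) =
      msq X + t * (4 * ip X Y) + t ^ 2 * (4 * msq Y + 2 * ip X Z) + t ^ 3 * (4 * ip Y Z) +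
        t ^ 4 * msq Z := by
  have h1 := (summable_ip hX hY).hasSum
  have h2 := (summable_ip hX hZ).hasSum
  have h3 := (summable_ip hY hZ).hasSum
  have hX' := Summable.hasSum hX
  have hY' := Summable.hasSum hY
  have hZ' := Summable.hasSum hZ
  have := ((((hX'.add ((h1.mul_left 4).mul_left t)).add
    (((hY'.mul_left 4).add (h2.mul_left 2)).mul_left (t ^ 2))).add
    ((h3.mul_left 4).mul_left (t ^ 3))).add (hZ'.mul_left (t ^ 4)))
  refine (HasSum.tsum_eq ?_)
  refine this.congr_fun ?_ |> id
  intro n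
  simp only [← Complex.normSq_eq_norm_sq, Complex.normSq_apply]
  simp [← Complex.ofReal_pow]
  ring

lemma msq_lin {X Y : ℕ → ℂ} (hX : SqSummable X) (hY : SqSummable Y) (t : ℝ) :
    msq (fun n => X n + t * Y n) = msq X + t * (2 * ip X Y) + t ^ 2 * msq Y := by
  have h1 := (summable_ip hX hY).hasSum
  have hX' := Summable.hasSum hX
  have hY' := Summable.hasSum hY
  have := (hX'.add ((h1.mul_left 2).mul_left t)).add (hY'.mul_left (t ^ 2))
  refine (HasSum.tsum_eq ?_)
  refine this.congr_fun ?_ |> id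
  intro n
  simp only [← Complex.normSq_eq_norm_sq, Complex.normSq_apply]
  simp
  ring

lemma bil_comm (c d : ℕ → ℂ) : bil c d = bil d c := by
  funext k
  simp only [bil]
  refine Finset.sum_equiv (Equiv.prodComm ℕ ℕ) ?_ ?_
  · intro p
    simp [Finset.HasAntidiagonal.mem_antidiagonal, add_comm]
  · intro p hp
    have := Finset.HasAntidiagonal.mem_antidiagonal.1 hp
    simp only [Equiv.prodComm_apply, Prod.fst_swap, Prod.snd_swap]
    rw [gw_symm this]
    ring

lemma bil_add_smul (c d : ℕ → ℂ) (t : ℝ) (k : ℕ) :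
    bil (fun n => c n + t * d n) (fun n => c n + t * d n) k =
      bil c c k + 2 * t * bil c d k + t ^ 2 * bil d d k := by
  have h : 2 * t * bil c d k = t * bil c d k + t * bil d c k := by rw [bil_comm d c]; ring
  rw [h]
  simp only [bil, Finset.mul_sum, ← Finset.sum_add_distrib]
  exact Finset.sum_congr rfl fun p _ => by ring

lemma shift_add_smul (a : ℂ) (c d : ℕ → ℂ) (t : ℝ) :
    shiftCoef a (fun n => c n + t * d n) = fun n => shiftCoef a c n + t * shiftCoef a d n := by
  funext n
  simp only [shiftCoef]
  ring

/-- The homogeneous functional whose nonnegativity near `c` expresses local minimality. -/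
noncomputable def quart (μ g : ℝ) (a : ℂ) (c : ℕ → ℂ) : ℝ :=
  en c + μ * (kin a c - msq c) * msq c - g * msq c ^ 2

/-- The homogeneous functional has a local minimum at `c`, with value zero. -/
def QMin (μ g : ℝ) (a : ℂ) (c : ℕ → ℂ) : Prop :=
  quart μ g a c = 0 ∧ ∀ d, WSummable d →
    IsLocalMin (fun t : ℝ => quart μ g a (fun n => c n + t * d n)) 0

lemma en_line {c d : ℕ → ℂ} (hc : SqSummable c) (hd : SqSummable d) (t : ℝ) :
    en (fun n => c n + t * d n) = en c + t * (4 * ip (bil c c) (bil c d)) +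
      t ^ 2 * (4 * msq (bil c d) + 2 * ip (bil c c) (bil d d)) +
      t ^ 3 * (4 * ip (bil c d) (bil d d)) + t ^ 4 * en d := by
  rw [en, funext (bil_add_smul c d t), msq_quad (hc.bil hc) (hc.bil hd) (hd.bil hd)]
  rfl

lemma kin_line {a : ℂ} {c d : ℕ → ℂ} (hc : WSummable c) (hd : WSummable d) (t : ℝ) :
    kin a (fun n => c n + t * d n) = kin a c + t * (2 * ip (shiftCoef a c) (shiftCoef a d)) +
      t ^ 2 * kin a d := by
  rw [kin, shift_add_smul, msq_lin (hc.shift a) (hd.shift a)]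
  rfl

/-- Homogeneity of degree four has absorbed the mass constraint into `quart`, so the derivative
along every line vanishes and L plays the part of the Lagrange multiplier. -/
lemma QMin.first_order {μ g : ℝ} {a : ℂ} {c : ℕ → ℂ} (hc : WSummable c) (h1 : msq c = 1)
    (h : QMin μ g a c) : ∃ L : ℝ, ∀ d, WSummable d →
      2 * ip (bil c c) (bil c d) + μ * ip (shiftCoef a c) (shiftCoef a d) = L * ip c d := by
  -- Half of the derivative at t = 0, with every multiple of `ip c d` moved to the right-hand side.
  refine ⟨2 * g + μ - μ * (kin a c - 1), fun d hd => ?_⟩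
  have hl := h.2 d hd
  have e : (fun t : ℝ => quart μ g a (fun n => c n + t * d n)) = fun t : ℝ =>
      (en c + t * (4 * ip (bil c c) (bil c d)) +
      t ^ 2 * (4 * msq (bil c d) + 2 * ip (bil c c) (bil d d)) +
      t ^ 3 * (4 * ip (bil c d) (bil d d)) + t ^ 4 * en d) +
      μ * ((kin a c + t * (2 * ip (shiftCoef a c) (shiftCoef a d)) + t ^ 2 * kin a d) -
        (msq c + t * (2 * ip c d) + t ^ 2 * msq d)) * (msq c + t * (2 * ip c d) + t ^ 2 * msq d) -
      g * (msq c + t * (2 * ip c d) + t ^ 2 * msq d) ^ 2 := by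
    funext t
    rw [quart, en_line hc.sq hd.sq, kin_line hc hd, msq_lin hc.sq hd.sq]
  rw [e] at hl
  have hlin : ∀ A B C : ℝ, HasDerivAt (fun t : ℝ => A + t * B + t ^ 2 * C) B 0 := by
    intro A B C
    have := (((hasDerivAt_id' (0:ℝ)).mul_const B).const_add A).add
      ((hasDerivAt_pow 2 (0:ℝ)).mul_const C)
    exact this.congr_deriv (by simp)
  have hq : ∀ A B C D E : ℝ,
      HasDerivAt (fun t : ℝ => A + t * B + t ^ 2 * C + t ^ 3 * D + t ^ 4 * E) B 0 := by
    intro A B C D E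
    have := ((hlin A B C).add ((hasDerivAt_pow 3 (0:ℝ)).mul_const D)).add
      ((hasDerivAt_pow 4 (0:ℝ)).mul_const E)
    exact this.congr_deriv (by simp)
  have hd1 := hq (en c) (4 * ip (bil c c) (bil c d))
    (4 * msq (bil c d) + 2 * ip (bil c c) (bil d d)) (4 * ip (bil c d) (bil d d)) (en d)
  have hd2 := hlin (kin a c) (2 * ip (shiftCoef a c) (shiftCoef a d)) (kin a d)
  have hd3 := hlin (msq c) (2 * ip c d) (msq d)
  have hD := (hd1.add (((hd2.sub hd3).const_mul μ).mul hd3)).sub ((hd3.pow 2).const_mul g)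
  have := hl.hasDerivAt_eq_zero hD
  simp only [h1] at this
  norm_num at this
  linarith

lemma wsummable_of_finite {d : ℕ → ℂ} {N : ℕ} (h : ∀ n, N < n → d n = 0) : WSummable d := by
  refine summable_of_ne_finset_zero (s := Finset.range (N + 1)) fun n hn => ?_
  rw [h n (by simpa using hn)]
  simp

lemma bil_single_right (c : ℕ → ℂ) (ω : ℂ) (j k : ℕ) :
    bil c (Pi.single j ω) k = if j ≤ k then gw k j * (c (k - j) * ω) else 0 := by
  rw [bil]
  split_ifs with h
  · rw [Finset.sum_eq_single (k - j, j)]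
    · simp only [Pi.single_eq_same]
      rw [gw_symm (Nat.sub_add_cancel h)]
    · rintro ⟨x, y⟩ hp hne
      have := Finset.HasAntidiagonal.mem_antidiagonal.1 hp
      simp only at this
      have hy : y ≠ j := by
        rintro rfl
        exact hne (Prod.ext (by simp; omega) rfl)
      simp [Pi.single_eq_of_ne hy]
    · intro hn
      exact absurd (Finset.HasAntidiagonal.mem_antidiagonal.2 (by simp; omega)) hn
  · refine Finset.sum_eq_zero fun p hp => ?_
    have := Finset.HasAntidiagonal.mem_antidiagonal.1 hp
    rw [Pi.single_eq_of_ne (by omega)]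
    simp

lemma ip_mul_right (x y : ℕ → ℂ) (ω : ℂ) (hx : SqSummable x) (hy : SqSummable y) :
    ip x (fun n => ω * y n) = (ω * ∑' n, (starRingEnd ℂ) (x n) * y n).re := by
  rw [ip_eq_re hx (hy.const_mul ω), ← tsum_mul_left]
  congr 1
  exact tsum_congr fun n => by ring

lemma wsummable_single (j : ℕ) (ω : ℂ) : WSummable (Pi.single j ω) :=
  wsummable_of_finite (N := j) fun n hn => Pi.single_eq_of_ne (by omega) _

/-- The Euler-Lagrange equation in coordinates. -/
lemma QMin.euler_lagrange {μ g : ℝ} {a : ℂ} {c : ℕ → ℂ} (hc : WSummable c) (h1 : msq c = 1)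
    (h : QMin μ g a c) : ∃ L : ℝ, ∀ j : ℕ,
      2 * ∑' i, (starRingEnd ℂ) (bil c c (j + i)) * (gw (j + i) j * c i) +
        μ * ((√(j + 1 : ℕ) : ℝ) * (starRingEnd ℂ) (shiftCoef a c (j + 1)) -
          a * (starRingEnd ℂ) (shiftCoef a c j)) = L * (starRingEnd ℂ) (c j) := by
  obtain ⟨L, hL⟩ := h.first_order hc h1
  refine ⟨L, fun j => ?_⟩
  set X := 2 * ∑' i, (starRingEnd ℂ) (bil c c (j + i)) * (gw (j + i) j * c i) +
        μ * ((√(j + 1 : ℕ) : ℝ) * (starRingEnd ℂ) (shiftCoef a c (j + 1)) -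
          a * (starRingEnd ℂ) (shiftCoef a c j)) - L * (starRingEnd ℂ) (c j) with hX
  have he := wsummable_single j 1
  -- The first order condition is only real; testing with all complex multiples ω of the j-th basis
  -- vector recovers the complex equation, finally with ω the conjugate of X.
  have key : ∀ ω : ℂ, (ω * X).re = 0 := by
    intro ω
    have hs : (Pi.single j ω : ℕ → ℂ) = fun n => ω * (Pi.single j 1 : ℕ → ℂ) n := by
      funext n
      by_cases hn : n = j
      · subst hn; simp
      · simp [Pi.single_eq_of_ne hn]
    have := hL _ (wsummable_single j ω)
    have hb : bil c (Pi.single j ω) = fun k => ω * bil c (Pi.single j 1) k := by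
      funext k
      rw [bil_single_right, bil_single_right]
      split_ifs <;> ring
    have hsh : shiftCoef a (Pi.single j ω) = fun k => ω * shiftCoef a (Pi.single j 1) k := by
      funext k
      rw [hs]
      simp only [shiftCoef]
      ring
    rw [hb, hsh, hs, ip_mul_right _ _ _ (hc.sq.bil hc.sq) (hc.sq.bil he.sq),
      ip_mul_right _ _ _ (hc.shift a) (he.shift a), ip_mul_right _ _ _ hc.sq he.sq] at this
    have e1 : ∑' k, (starRingEnd ℂ) (bil c c k) * bil c (Pi.single j 1) k =
        ∑' i, (starRingEnd ℂ) (bil c c (j + i)) * (gw (j + i) j * c i) := by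
      rw [← (summable_conj_mul (hc.sq.bil hc.sq) (hc.sq.bil he.sq)).sum_add_tsum_nat_add j,
        Finset.sum_eq_zero, zero_add]
      · refine tsum_congr fun i => ?_
        rw [bil_single_right, if_pos (by omega), Nat.add_sub_cancel, add_comm i j, mul_one]
      · intro i hi
        rw [bil_single_right, if_neg (by simpa using hi), mul_zero]
    have e2 : ∑' n, (starRingEnd ℂ) (shiftCoef a c n) * shiftCoef a (Pi.single j 1) n =
        (√(j + 1 : ℕ) : ℝ) * (starRingEnd ℂ) (shiftCoef a c (j + 1)) -
          a * (starRingEnd ℂ) (shiftCoef a c j) := by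
      rw [tsum_eq_sum (s := {j, j + 1}), Finset.sum_pair (by omega)]
      · have : ∀ j : ℕ, (√(j : ℝ) : ℂ) * (Pi.single j 1 : ℕ → ℂ) (j - 1) = 0 := by
          intro j
          rcases j with _ | j
          · simp
          · rw [Pi.single_eq_of_ne (by omega), mul_zero]
        simp only [shiftCoef, this, Pi.single_eq_same, Nat.add_sub_cancel,
          Pi.single_eq_of_ne (show j + 1 ≠ j by omega)]
        ring
      · intro n hn
        simp only [Finset.mem_insert, Finset.mem_singleton, not_or] at hn
        have h2 : (√(n : ℝ) : ℂ) * (Pi.single j 1 : ℕ → ℂ) (n - 1) = 0 := by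
          rcases n with _ | n
          · simp
          · rw [Pi.single_eq_of_ne (by omega), mul_zero]
        simp only [shiftCoef, h2, Pi.single_eq_of_ne hn.1]
        ring
    have e3 : ∑' n, (starRingEnd ℂ) (c n) * (Pi.single j 1 : ℕ → ℂ) n = (starRingEnd ℂ) (c j) := by
      rw [tsum_eq_single j]
      · simp
      · intro n hn
        simp [Pi.single_eq_of_ne hn]
    rw [e1, e2, e3] at this
    have hr : ∀ (r : ℝ) (z : ℂ), r * (ω * z).re = (ω * (r * z)).re := by
      intro r z
      rw [← Complex.re_ofReal_mul]
      congr 1; ring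
    rw [hr, hr, hr, ← Complex.add_re, ← sub_eq_zero, ← Complex.sub_re] at this
    rw [← this, hX]
    congr 1
    push_cast
    ring
  have := key ((starRingEnd ℂ) X)
  rw [mul_comm, Complex.mul_conj, Complex.ofReal_re, Complex.normSq_eq_zero] at this
  exact sub_eq_zero.1 this

/-! ### Decay of the coordinates of critical points -/

lemma gw_le_one (k i : ℕ) : gw k i ≤ 1 := by
  refine Real.sqrt_le_one.2 ((div_le_one (by positivity)).2 ?_)
  exact_mod_cast Nat.choose_le_two_pow k i

lemma norm_bil_le_geom {c : ℕ → ℂ} {K r : ℝ} (hc : ∀ n, ‖c n‖ ≤ K * r ^ n) (k : ℕ) :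
    ‖bil c c k‖ ≤ (k + 1) * (K ^ 2 * r ^ k) := by
  refine (norm_sum_le _ _).trans ?_
  have : ∀ p ∈ Finset.HasAntidiagonal.antidiagonal k,
      ‖(gw k p.1 : ℂ) * (c p.1 * c p.2)‖ ≤ K ^ 2 * r ^ k := by
    intro p hp
    rw [norm_mul, norm_mul, Complex.norm_real, Real.norm_of_nonneg (gw_nonneg _ _)]
    calc gw k p.1 * (‖c p.1‖ * ‖c p.2‖) ≤ 1 * ((K * r ^ p.1) * (K * r ^ p.2)) := by
          have h1 := gw_le_one k p.1
          have h2 := gw_nonneg k p.1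
          have h3 := hc p.1
          have h4 := hc p.2
          have h5 := (norm_nonneg _).trans h3
          gcongr
      _ = K ^ 2 * r ^ k := by
          rw [← Finset.HasAntidiagonal.mem_antidiagonal.1 hp, pow_add]; ring
  refine (Finset.sum_le_card_nsmul _ _ _ this).trans (le_of_eq ?_)
  rw [Finset.Nat.card_antidiagonal, nsmul_eq_mul]
  push_cast
  ring

/-- One term of Σ_m C(j+m, j) y^m = (1 - y)^{-(j+1)} bounds the binomial coefficient. The free
parameter y trades decay in j against growth in m. -/
lemma gw_le_geom {y : ℝ} (hy0 : 0 < y) (hy1 : y < 1) (j m : ℕ) :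
    gw (j + m) j ≤ √(1 / (1 - y)) * √(1 / (2 * (1 - y))) ^ j * √(1 / (2 * y)) ^ m := by
  have h1y : 0 < 1 - y := by linarith
  have h : ((j + m).choose j : ℝ) * y ^ m ≤ (1 / (1 - y)) ^ (j + 1) := by
    have hs := hasSum_choose_mul_geometric_of_norm_lt_one j (r := y)
      (by rw [Real.norm_of_nonneg hy0.le]; exact hy1)
    have := le_hasSum hs m (fun i _ => by positivity)
    rw [add_comm j m]
    refine this.trans (le_of_eq ?_)
    simp
  rw [gw]
  apply Real.sqrt_le_iff.2
  refine ⟨by positivity, ?_⟩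
  rw [mul_pow, mul_pow, ← pow_mul, ← pow_mul, mul_comm j 2, mul_comm m 2, pow_mul, pow_mul,
    Real.sq_sqrt (by positivity), Real.sq_sqrt (by positivity), Real.sq_sqrt (by positivity),
    div_le_iff₀ (by positivity)]
  have hm : 0 < y ^ m := by positivity
  refine le_of_mul_le_mul_right (h.trans (le_of_eq ?_)) hm
  simp only [pow_add, pow_one, div_pow, mul_pow, one_pow]
  field_simp

lemma exists_mul_pow_le_pow {s q : ℝ} (hs : 0 ≤ s) (hsq : s < q) :
    ∃ C : ℝ, 0 ≤ C ∧ ∀ j : ℕ, ((j : ℝ) + 1) * s ^ j ≤ C * q ^ j := by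
  have hq : 0 < q := lt_of_le_of_lt hs hsq
  have hx : s / q < 1 := (div_lt_one hq).2 hsq
  have hx0 : 0 ≤ s / q := by positivity
  have h1 : Summable fun j : ℕ => ((j : ℝ) + 1) * (s / q) ^ j := by
    have h := (summable_pow_mul_geometric_of_norm_lt_one 1 (r := s / q)
      (by rwa [Real.norm_of_nonneg hx0])).add (summable_geometric_of_lt_one hx0 hx)
    refine h.congr fun j => ?_
    ring
  refine ⟨∑' j : ℕ, ((j : ℝ) + 1) * (s / q) ^ j, tsum_nonneg fun j => by positivity, fun j => ?_⟩
  have := h1.le_tsum j (fun i _ => by positivity)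
  rw [div_pow, mul_div_assoc'] at this
  rwa [← div_le_iff₀ (by positivity)]

/-- One step of the improvement of decay for solutions of the Euler-Lagrange equation. -/
lemma decay_step {μ : ℝ} (hμ : 0 < μ) {L : ℝ} {c : ℕ → ℂ}
    (hEL : ∀ j : ℕ, 2 * ∑' i, (starRingEnd ℂ) (bil c c (j + i)) * (gw (j + i) j * c i) +
        μ * ((√(j + 1 : ℕ) : ℝ) * (starRingEnd ℂ) (shiftCoef 0 c (j + 1)) -
          0 * (starRingEnd ℂ) (shiftCoef 0 c j)) = L * (starRingEnd ℂ) (c j))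
    {r₀ : ℝ} (h0 : 0 < r₀) (h1 : r₀ < 1) :
    ∃ q : ℝ, 0 < q ∧ q < 1 ∧ ∀ r, 0 < r → r ≤ r₀ → (∃ K, ∀ n, ‖c n‖ ≤ K * r ^ n) →
      ∃ K, ∀ n, ‖c n‖ ≤ K * (q * r) ^ n := by
  -- The midpoint of r₀⁴/2 and 1/2: y < 1/2 makes the rate s in j smaller than one, while y > r₀⁴/2
  -- makes the sum over m converge.
  set y := (1 + r₀ ^ 4) / 4 with hy
  have hr4 : r₀ ^ 4 < 1 := pow_lt_one₀ h0.le h1 (by norm_num)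
  have hr4' : 0 < r₀ ^ 4 := by positivity
  have hy0 : 0 < y := by positivity
  have hy1 : y < 1 / 2 := by rw [hy]; linarith
  set s := √(1 / (2 * (1 - y))) with hs
  have hs0 : 0 ≤ s := Real.sqrt_nonneg _
  have hs1 : s < 1 := by
    rw [hs, Real.sqrt_lt' one_pos, one_pow, div_lt_one (by linarith)]
    linarith
  -- A rate strictly between s and 1 absorbs the polynomial factor j + 1. It depends on r₀ only,
  -- which permits iteration.
  obtain ⟨C, hC, hCj⟩ := exists_mul_pow_le_pow hs0 (show s < (1 + s) / 2 by linarith)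
  refine ⟨(1 + s) / 2, by linarith, by linarith, fun r hr hrr ⟨K, hK⟩ => ?_⟩
  set q := (1 + s) / 2
  have hq0 : 0 < q := by simp only [q]; linarith
  have hK0 : 0 ≤ K := by simpa using (norm_nonneg _).trans (hK 0)
  set ρ := r ^ 2 * √(1 / (2 * y)) with hρ
  have hρ0 : 0 ≤ ρ := by positivity
  have hρ1 : ρ < 1 := by
    have h2 : r ^ 4 ≤ r₀ ^ 4 := by gcongr
    have : ρ ^ 2 < 1 := by
      rw [hρ, mul_pow, Real.sq_sqrt (by positivity), ← pow_mul, mul_one_div, div_lt_one (by positivity),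
        hy]
      norm_num
      linarith
    nlinarith
  have hsumρ : Summable fun m : ℕ => ((m : ℝ) + 1) * ρ ^ m := by
    have h := (summable_pow_mul_geometric_of_norm_lt_one 1 (r := ρ)
      (by rwa [Real.norm_of_nonneg hρ0])).add (summable_geometric_of_lt_one hρ0 hρ1)
    exact h.congr fun j => by ring
  set B := ∑' m : ℕ, ((m : ℝ) + 1) * ρ ^ m
  have hB0 : 0 ≤ B := tsum_nonneg fun m => by positivity
  set D := K ^ 3 * √(1 / (1 - y)) * B * C with hD
  have hD0 : 0 ≤ D := by positivity
  have hS : ∀ j : ℕ, ‖∑' i, (starRingEnd ℂ) (bil c c (j + i)) * (gw (j + i) j * c i)‖ ≤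
      D * (q * r) ^ j := by
    intro j
    have hb : ∀ m, ‖(starRingEnd ℂ) (bil c c (j + m)) * (gw (j + m) j * c m)‖ ≤
        (K ^ 3 * √(1 / (1 - y)) * (((j : ℝ) + 1) * s ^ j) * r ^ j) * (((m : ℝ) + 1) * ρ ^ m) := by
      intro m
      rw [norm_mul, norm_mul, RCLike.norm_conj, Complex.norm_real,
        Real.norm_of_nonneg (gw_nonneg _ _)]
      have e1 := norm_bil_le_geom hK (j + m)
      have e2 := gw_le_geom hy0 (by linarith) j m
      have e3 := hK m
      have e4 : (((j + m : ℕ) : ℝ) + 1) ≤ ((j : ℝ) + 1) * ((m : ℝ) + 1) := by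
        push_cast
        nlinarith [(Nat.cast_nonneg j : (0:ℝ) ≤ j), (Nat.cast_nonneg m : (0:ℝ) ≤ m)]
      calc ‖bil c c (j + m)‖ * (gw (j + m) j * ‖c m‖)
          ≤ ((((j : ℝ) + 1) * ((m : ℝ) + 1)) * (K ^ 2 * r ^ (j + m))) *
            ((√(1 / (1 - y)) * s ^ j * √(1 / (2 * y)) ^ m) * (K * r ^ m)) := by
            have h0 := gw_nonneg (j + m) j
            gcongr
            exact e1.trans (by gcongr)
        _ = _ := by
            rw [hρ, mul_pow, ← pow_mul, pow_add, mul_comm 2 m, pow_mul]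
            ring
    have hsum := hsumρ.mul_left
      (K ^ 3 * √(1 / (1 - y)) * (((j : ℝ) + 1) * s ^ j) * r ^ j)
    refine (tsum_of_norm_bounded hsum.hasSum hb).trans ?_
    rw [tsum_mul_left]
    calc K ^ 3 * √(1 / (1 - y)) * (((j : ℝ) + 1) * s ^ j) * r ^ j * B
        ≤ K ^ 3 * √(1 / (1 - y)) * (C * q ^ j) * r ^ j * B := by
          gcongr K ^ 3 * √(1 / (1 - y)) * ?_ * r ^ j * B
          exact hCj j
      _ = D * (q * r) ^ j := by rw [hD, mul_pow]; ring
  -- Beyond N the linear coefficient μ(j+1) - L is at least one, so the coordinate is controlled by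
  -- the cubic sum.
  obtain ⟨N, hN⟩ := exists_nat_gt ((|L| + 1) / μ)
  have hbig : ∀ j, N ≤ j → ‖c j‖ ≤ 2 * D * (q * r) ^ j := by
    intro j hj
    have hE := hEL j
    have e1 : (√(j + 1 : ℕ) : ℝ) * (starRingEnd ℂ) (shiftCoef 0 c (j + 1)) =
        ((j + 1 : ℕ) : ℝ) * (starRingEnd ℂ) (c j) := by
      simp only [shiftCoef, Nat.add_sub_cancel, zero_mul, sub_zero, map_mul, Complex.conj_ofReal]
      rw [← mul_assoc, ← Complex.ofReal_mul, Real.mul_self_sqrt (by positivity)]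
    rw [e1, zero_mul, sub_zero] at hE
    have e2 : (((L - μ * (j + 1 : ℕ) : ℝ)) : ℂ) * (starRingEnd ℂ) (c j) =
        2 * ∑' i, (starRingEnd ℂ) (bil c c (j + i)) * (gw (j + i) j * c i) := by
      push_cast at hE ⊢
      linear_combination -hE
    have e3 := congrArg norm e2
    rw [norm_mul, norm_mul, RCLike.norm_conj, Complex.norm_real, Real.norm_eq_abs] at e3
    have e4 : 1 ≤ |L - μ * (j + 1 : ℕ)| := by
      rw [abs_sub_comm]
      refine le_trans ?_ (le_abs_self _)
      have h5 : (N : ℝ) ≤ j := by exact_mod_cast hj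
      rw [div_lt_iff₀ hμ] at hN
      push_cast
      nlinarith [le_abs_self L]
    have e5 := hS j
    have e6 : ‖(2:ℂ)‖ = 2 := by simp
    rw [e6] at e3
    nlinarith [norm_nonneg (c j)]
  -- The finitely many coordinates below N are absorbed into the constant.
  refine ⟨2 * D + ∑ j ∈ Finset.range N, ‖c j‖ / (q * r) ^ j, fun n => ?_⟩
  have hqr : 0 < (q * r) ^ n := by positivity
  have hnn : ∀ j, 0 ≤ ‖c j‖ / (q * r) ^ j := fun j => by positivity
  rw [add_mul]
  rcases le_or_gt N n with h | h
  · exact (hbig n h).trans (le_add_of_nonneg_right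
      (mul_nonneg (Finset.sum_nonneg fun j _ => hnn j) hqr.le))
  · have := Finset.single_le_sum (fun j _ => hnn j) (Finset.mem_range.2 h)
    rw [div_le_iff₀ hqr] at this
    have : 0 ≤ 2 * D * (q * r) ^ n := by positivity
    linarith

/-- Solutions of the Euler-Lagrange equation with some Gaussian decay of their coordinates decay
faster than any geometric sequence. -/
lemma decay_all {μ : ℝ} (hμ : 0 < μ) {L : ℝ} {c : ℕ → ℂ}
    (hEL : ∀ j : ℕ, 2 * ∑' i, (starRingEnd ℂ) (bil c c (j + i)) * (gw (j + i) j * c i) +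
        μ * ((√(j + 1 : ℕ) : ℝ) * (starRingEnd ℂ) (shiftCoef 0 c (j + 1)) -
          0 * (starRingEnd ℂ) (shiftCoef 0 c j)) = L * (starRingEnd ℂ) (c j))
    {r₀ : ℝ} (h0 : 0 < r₀) (h1 : r₀ < 1) (hc : ∃ K, ∀ n, ‖c n‖ ≤ K * r₀ ^ n) {r : ℝ} (hr : 0 < r) :
    ∃ K, ∀ n, ‖c n‖ ≤ K * r ^ n := by
  obtain ⟨q, hq0, hq1, hq⟩ := decay_step hμ hEL h0 h1
  -- The same factor q serves at every rate below r₀, so k applications give the rate q^k r₀.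
  have hk : ∀ k : ℕ, ∃ K, ∀ n, ‖c n‖ ≤ K * (q ^ k * r₀) ^ n := by
    intro k
    induction k with
    | zero => simpa using hc
    | succ k ih =>
      have h2 : q ^ k * r₀ ≤ r₀ := mul_le_of_le_one_left h0.le (pow_le_one₀ hq0.le hq1.le)
      have := hq _ (by positivity) h2 ih
      simpa [pow_succ', mul_assoc] using this
  obtain ⟨k, hk1⟩ := exists_pow_lt_of_lt_one (show 0 < r / r₀ by positivity) hq1
  obtain ⟨K, hK⟩ := hk k
  refine ⟨K, fun n => (hK n).trans ?_⟩
  have hK0 : 0 ≤ K := by simpa using (norm_nonneg _).trans (hK 0)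
  have : q ^ k * r₀ ≤ r := by
    rw [lt_div_iff₀ h0] at hk1
    exact hk1.le
  gcongr

/-! ### Critical points with finitely many coordinates -/

lemma bil_eq_zero_of_lt {c : ℕ → ℂ} {n k : ℕ} (hn : ∀ i, n < i → c i = 0) (hk : 2 * n < k) :
    bil c c k = 0 := by
  refine Finset.sum_eq_zero fun p hp => ?_
  have := Finset.HasAntidiagonal.mem_antidiagonal.1 hp
  rcases lt_or_ge n p.1 with h | h
  · rw [hn _ h]; ring
  · rw [hn p.2 (by omega)]; ring

lemma bil_eq_zero_of_gt {c : ℕ → ℂ} {m k : ℕ} (hm : ∀ i, i < m → c i = 0) (hk : k < 2 * m) :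
    bil c c k = 0 := by
  refine Finset.sum_eq_zero fun p hp => ?_
  have := Finset.HasAntidiagonal.mem_antidiagonal.1 hp
  rcases lt_or_ge p.1 m with h | h
  · rw [hm _ h]; ring
  · rw [hm p.2 (by omega)]; ring

/-- The extreme coefficient of a square, at the top or at the bottom, receives a single
contribution. -/
lemma bil_two_mul {c : ℕ → ℂ} {n : ℕ}
    (h : (∀ i, n < i → c i = 0) ∨ ∀ i, i < n → c i = 0) :
    bil c c (2 * n) = gw (2 * n) n * (c n * c n) := by
  rw [bil, Finset.sum_eq_single (n, n)]
  · rintro ⟨x, y⟩ hp hne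
    have hxy := Finset.HasAntidiagonal.mem_antidiagonal.1 hp
    simp only at hxy
    have : x ≠ n := by
      rintro rfl
      exact hne (Prod.ext rfl (by simp; omega))
    simp only
    rcases h with h | h
    · rcases lt_or_gt_of_ne this with h' | h'
      · rw [h y (by omega)]; ring
      · rw [h x h']; ring
    · rcases lt_or_gt_of_ne this with h' | h'
      · rw [h x h']; ring
      · rw [h y (by omega)]; ring
  · intro hn
    exact absurd (Finset.HasAntidiagonal.mem_antidiagonal.2 (by simp; omega)) hn

lemma gw_pos {k i : ℕ} (h : i ≤ k) : 0 < gw k i :=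
  Real.sqrt_pos.2 (div_pos (by exact_mod_cast Nat.choose_pos h) (by positivity))

/-- The two expressions of the shift obtained from the extreme Euler-Lagrange equations of a
combination of two consecutive monomials are incompatible. -/
lemma shift_incompatible (k : ℕ) {μ : ℝ} {a z : ℂ} (hz : z ≠ 0)
    (h1 : 2 * ((gw (2 * (k + 2)) (k + 2) * gw (2 * (k + 2)) (k + 3) : ℝ) : ℂ) * z =
      μ * a * (√(k + 3 : ℕ) : ℝ))
    (h2 : 2 * ((gw (2 * (k + 1)) (k + 1) * gw (2 * (k + 1)) k : ℝ) : ℂ) * z =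
      μ * a * (√(k + 1 : ℕ) : ℝ)) : False := by
  -- Eliminate μa between the two equations and divide by z.
  have h3 : ((gw (2 * (k + 2)) (k + 2) * gw (2 * (k + 2)) (k + 3)) * √(k + 1 : ℕ) : ℝ) =
      ((gw (2 * (k + 1)) (k + 1) * gw (2 * (k + 1)) k) * √(k + 3 : ℕ) : ℝ) := by
    have : ((((gw (2 * (k + 2)) (k + 2) * gw (2 * (k + 2)) (k + 3)) * √(k + 1 : ℕ) : ℝ)) : ℂ) * z =
      ((((gw (2 * (k + 1)) (k + 1) * gw (2 * (k + 1)) k) * √(k + 3 : ℕ) : ℝ)) : ℂ) * z := by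
      rw [Complex.ofReal_mul, Complex.ofReal_mul (_ * _)]
      linear_combination (1/2) * ((√(k + 1 : ℕ) : ℝ) : ℂ) * h1 - (1/2) * ((√(k + 3 : ℕ) : ℝ) : ℂ) * h2
    exact_mod_cast mul_right_cancel₀ hz this
  have h4 := congrArg (· ^ 2) h3
  simp only [mul_pow, gw_sq] at h4
  rw [Real.sq_sqrt (by positivity), Real.sq_sqrt (by positivity)] at h4
  set X : ℝ := ((2 * (k + 2)).choose (k + 2) : ℝ) with hX
  set Y : ℝ := ((2 * (k + 1)).choose (k + 1) : ℝ) with hY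
  have hYpos : 0 < Y := by
    rw [hY]; exact_mod_cast Nat.choose_pos (by omega)
  have e1 : ((2 * (k + 2)).choose (k + 3) : ℝ) * (k + 3) = X * (k + 2) := by
    have := Nat.choose_succ_right_eq (2 * (k + 2)) (k + 2)
    rw [show 2 * (k + 2) - (k + 2) = k + 2 by omega] at this
    rw [hX]
    exact_mod_cast this
  have e2 : Y * (k + 1) = ((2 * (k + 1)).choose k : ℝ) * (k + 2) := by
    have := Nat.choose_succ_right_eq (2 * (k + 1)) k
    rw [show 2 * (k + 1) - k = k + 2 by omega] at this
    rw [hY]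
    exact_mod_cast this
  have e3 : (k + 2) * X = 2 * (2 * k + 3) * Y := by
    have := Nat.succ_mul_centralBinom_succ (k + 1)
    rw [Nat.centralBinom, Nat.centralBinom] at this
    rw [hX, hY]
    have h' : ((k + 1 : ℕ) + 1 : ℝ) * ((2 * (k + 1 + 1)).choose (k + 1 + 1) : ℝ) =
        2 * (2 * (k + 1 : ℕ) + 1) * ((2 * (k + 1)).choose (k + 1) : ℝ) := by exact_mod_cast this
    push_cast at h'
    linear_combination h'
  set X' : ℝ := ((2 * (k + 2)).choose (k + 3) : ℝ)
  set Y' : ℝ := ((2 * (k + 1)).choose k : ℝ)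
  have hk : (0:ℝ) ≤ k := Nat.cast_nonneg k
  have p1 : (2:ℝ) ^ (2 * (k + 2)) = 4 * 2 ^ (2 * (k + 1)) := by
    rw [show 2 * (k + 2) = 2 * (k + 1) + 2 by ring, pow_add]; ring
  rw [p1] at h4
  have hp : (0:ℝ) < 2 ^ (2 * (k + 1)) := by positivity
  have x1 : X' = X * (k + 2) / (k + 3) := by field_simp; linarith
  have y1 : Y' = Y * (k + 1) / (k + 2) := by field_simp; linarith
  have x2 : X = 2 * (2 * k + 3) * Y / (k + 2) := by field_simp; linarith
  rw [x1, y1, x2] at h4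
  push_cast at h4
  field_simp at h4
  -- After the binomial ratios are inserted, what remains is 2(2k+3) = 4(k+3), that is 6 = 12.
  have h5 : ((2 * (k:ℝ) + 3) * 2) ^ 2 = (4 * (k + 3)) ^ 2 := by nlinarith
  have := (pow_left_inj₀ (by positivity) (by positivity) two_ne_zero).1 h5
  linarith

lemma gw_two_one : gw 2 1 = √(1 / 2) := by
  rw [gw]; norm_num

lemma gw_two_two : gw 2 2 = 1 / 2 := by
  rw [gw, show ((Nat.choose 2 2 : ℕ) : ℝ) / 2 ^ 2 = (1 / 2) ^ 2 by norm_num]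
  exact Real.sqrt_sq (by norm_num)

lemma gw_one (i : ℕ) (hi : i ≤ 1) : gw 1 i = √(1 / 2) := by
  interval_cases i <;> rw [gw] <;> norm_num

lemma gw_zero : gw 0 0 = 1 := by
  rw [gw]; norm_num

lemma msq_pair {c : ℕ → ℂ} (h : ∀ i, 1 < i → c i = 0) : msq c = ‖c 0‖ ^ 2 + ‖c 1‖ ^ 2 := by
  rw [msq, tsum_eq_sum (s := Finset.range 2)]
  · simp [Finset.sum_range_succ]
  · intro i hi
    rw [h i (by simpa using hi)]
    simp

lemma sum_bil_eq_sum {c : ℕ → ℂ} {n : ℕ} (hn : ∀ i, n < i → c i = 0) (j : ℕ) :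
    ∑' i, (starRingEnd ℂ) (bil c c (j + i)) * (gw (j + i) j * c i) =
      ∑ i ∈ Finset.range (n + 1), (starRingEnd ℂ) (bil c c (j + i)) * (gw (j + i) j * c i) :=
  tsum_eq_sum fun i hi => by rw [hn i (by simpa using hi)]; ring

/-- The equation at index 2 determines μa in terms of the two coordinates. Substituting it into the
combination of the equations 0 and 1 that eliminates L, and using unit mass, leaves μ = 1/2. -/
lemma half_of_two_terms {μ : ℝ} {a : ℂ} {c : ℕ → ℂ} (h : ∀ i, 1 < i → c i = 0)
    (h0 : c 0 ≠ 0) (h1 : c 1 ≠ 0) (hm : msq c = 1) {L : ℝ} (hEL : ∀ j : ℕ,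
      2 * ∑' i, (starRingEnd ℂ) (bil c c (j + i)) * (gw (j + i) j * c i) +
        μ * ((√(j + 1 : ℕ) : ℝ) * (starRingEnd ℂ) (shiftCoef a c (j + 1)) -
          a * (starRingEnd ℂ) (shiftCoef a c j)) = L * (starRingEnd ℂ) (c j)) : μ = 1 / 2 := by
  rw [msq_pair h] at hm
  have b0 : bil c c 0 = c 0 * c 0 := by simp [bil, gw_zero]
  have b1 : bil c c 1 = 2 * (√(1 / 2) : ℝ) * (c 0 * c 1) := by
    rw [bil, show Finset.HasAntidiagonal.antidiagonal 1 = {(0, 1), (1, 0)} by rfl,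
      Finset.sum_pair (by simp), gw_one 0 (by norm_num), gw_one 1 le_rfl]
    ring
  have b2 : bil c c 2 = (√(1 / 2) : ℝ) * (c 1 * c 1) := by
    have := bil_two_mul (c := c) (n := 1) (Or.inl h)
    rwa [mul_one, gw_two_one] at this
  have b3 : bil c c 3 = 0 := bil_eq_zero_of_lt h (by norm_num)
  have E0 := hEL 0
  have E1 := hEL 1
  have E2 := hEL 2
  rw [sum_bil_eq_sum h] at E0 E1 E2
  simp only [Finset.sum_range_succ, Finset.range_zero, Finset.sum_empty, zero_add, add_zero,
    shiftCoef, Nat.reduceAdd, Nat.reduceSub, b0, b1, b2, b3, h 2 (by norm_num), h 3 (by norm_num),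
    gw_zero, gw_one 0 (by norm_num), gw_one 1 le_rfl, gw_two_one, gw_two_two,
    map_mul, map_sub, Complex.conj_ofReal, map_ofNat, map_zero, Nat.cast_one, Nat.cast_zero,
    Real.sqrt_one, Real.sqrt_zero, Complex.ofReal_one, Complex.ofReal_zero, mul_zero, zero_mul,
    sub_zero, one_mul, Nat.sub_self] at E0 E1 E2
  have hs : ((√(1 / 2) : ℝ) : ℂ) * (√(1 / 2) : ℝ) = 1 / 2 := by
    rw [← Complex.ofReal_mul, Real.mul_self_sqrt (by norm_num)]; norm_num
  have hs2 : ((√(2 : ℕ) : ℝ) : ℂ) * (√(2 : ℕ) : ℝ) = 2 := by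
    rw [← Complex.ofReal_mul, Real.mul_self_sqrt (by norm_num)]; norm_num
  have hs3 : ((√(2 : ℕ) : ℝ) : ℂ) * (√(1 / 2) : ℝ) = 1 := by
    rw [← Complex.ofReal_mul, ← Real.sqrt_mul (by norm_num)]; norm_num
  set x := c 0
  set y := c 1
  set s := ((√(1 / 2) : ℝ) : ℂ)
  set w := ((√(2 : ℕ) : ℝ) : ℂ)
  set x' := (starRingEnd ℂ) x with hx'
  set y' := (starRingEnd ℂ) y with hy'
  set a' := (starRingEnd ℂ) a with ha'
  have hx0 : x' ≠ 0 := by rwa [hx', map_ne_zero]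
  have hy0 : y' ≠ 0 := by rwa [hy', map_ne_zero]
  have hm' : x * x' + y * y' = 1 := by
    rw [hx', hy', Complex.mul_conj, Complex.mul_conj, Complex.normSq_eq_norm_sq,
      Complex.normSq_eq_norm_sq]
    exact_mod_cast hm
  -- Equation 2: its cubic part has one term and its linear part contains only a.
  have A1 : μ * a = y' * x / 2 := by
    have : y' * (μ * a - y' * x / 2) = 0 := by
      have hE : w * (y' * (μ * a) ) = s * y' * y' * x := by
        push_cast at E2
        linear_combination -E2
      linear_combination s * hE - y' * (μ * a) * hs3 + y' * y' * x * hs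
    exact sub_eq_zero.1 ((mul_eq_zero.1 this).resolve_left hy0)
  have A2 : μ * a' = y * x' / 2 := by
    have := congrArg (starRingEnd ℂ) A1
    simpa [hx', hy', ha', map_ofNat (starRingEnd ℂ) 2] using this
  have key : x' * y' * (μ - 1 / 2) = 0 := by
    linear_combination -(y' * E0 - x' * E1) + (2 * x' * y' ^ 2 * y - 4 * x' ^ 2 * y' * x) * hs -
      μ * x' * y' * hs2 - y' ^ 2 * A2 + x' ^ 2 * A1 + x' * y' / 2 * hm'
  have : (μ : ℂ) - 1 / 2 = 0 := (mul_eq_zero.1 key).resolve_left (mul_ne_zero hx0 hy0)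
  have h2 : ((μ - 1 / 2 : ℝ) : ℂ) = 0 := by push_cast; exact this
  linarith [Complex.ofReal_eq_zero.1 h2]

/-- A local minimizer with finitely many nonzero coordinates is a special Hermite function. -/
lemma QMin.eq_single {μ g : ℝ} (hμ : 0 < μ) (hμ2 : μ ≠ 1 / 2) {a : ℂ} {c : ℕ → ℂ} {N : ℕ}
    (hN : ∀ n, N < n → c n = 0) (hm : msq c = 1) (h : QMin μ g a c) :
    a = 0 ∧ ∃ n, ∀ i, i ≠ n → c i = 0 := by
  classical
  obtain ⟨L, hEL⟩ := h.euler_lagrange (wsummable_of_finite hN) hm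
  have hne : ∃ n, c n ≠ 0 := by
    by_contra! h0
    simp [msq, h0] at hm
  obtain ⟨n, hn0, hn⟩ : ∃ n, c n ≠ 0 ∧ ∀ i, n < i → c i = 0 := by
    obtain ⟨n0, hn0⟩ := hne
    refine ⟨Nat.findGreatest (fun i => c i ≠ 0) N, Nat.findGreatest_spec (P := fun i => c i ≠ 0)
      (m := n0) (by by_contra hh; exact hn0 (hN _ (by omega))) hn0, fun i hi => ?_⟩
    rcases le_or_gt i N with h2 | h2
    · by_contra hh
      exact Nat.findGreatest_is_greatest hi h2 hh
    · exact hN i h2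
  obtain ⟨m, hm0, hmin⟩ : ∃ m, c m ≠ 0 ∧ ∀ i, i < m → c i = 0 :=
    ⟨Nat.find hne, Nat.find_spec hne, fun i hi => by
      have := Nat.find_min hne hi
      simpa using this⟩
  have hmn : m ≤ n := by
    by_contra hh
    exact hm0 (hn m (by omega))
  have hμc : (μ : ℂ) ≠ 0 := by exact_mod_cast hμ.ne'
  have hconj : ∀ {z : ℂ}, z ≠ 0 → (starRingEnd ℂ) z ≠ 0 := fun hz => by rwa [map_ne_zero]
  have hsq : ∀ k : ℕ, ((√(k + 1 : ℕ) : ℝ) : ℂ) ≠ 0 := fun k => by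
    exact_mod_cast (Real.sqrt_pos.2 (by positivity)).ne'
  have hgw : ∀ {k i : ℕ}, i ≤ k → (gw k i : ℂ) ≠ 0 := fun hk => by
    exact_mod_cast (gw_pos hk).ne'
  -- At index 2n - m only i = m survives: smaller i lie below the bottom index, and larger ones push
  -- the degree above 2n.
  have htop : ∑' i, (starRingEnd ℂ) (bil c c (2 * n - m + i)) *
      (gw (2 * n - m + i) (2 * n - m) * c i) =
      (starRingEnd ℂ) (gw (2 * n) n * (c n * c n)) * (gw (2 * n) (2 * n - m) * c m) := by
    rw [tsum_eq_single m]
    · rw [show 2 * n - m + m = 2 * n by omega, bil_two_mul (Or.inl hn)]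
    · intro i hi
      rcases lt_or_gt_of_ne hi with h' | h'
      · rw [hmin i h']; ring
      · rw [bil_eq_zero_of_lt hn (by omega)]; simp
  -- If n ≥ m + 2, the index 2n - m exceeds n + 1, so the linear part vanishes while the cubic part
  -- does not.
  have hcase : m = n ∨ m + 1 = n := by
    by_contra! hh
    have E := hEL (2 * n - m)
    rw [htop] at E
    simp only [shiftCoef] at E
    rw [hn (2 * n - m) (by omega), hn (2 * n - m + 1) (by omega), Nat.add_sub_cancel,
      hn (2 * n - m) (by omega), hn (2 * n - m - 1) (by omega)] at E
    simp only [mul_zero, sub_zero, map_zero, add_zero, mul_eq_zero, OfNat.ofNat_ne_zero,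
      false_or] at E
    rcases E with E | E | E
    · rw [map_eq_zero] at E
      exact mul_ne_zero (hgw (by omega)) (mul_ne_zero hn0 hn0) E
    · exact hgw (by omega) E
    · exact hm0 E
  rcases hcase with rfl | rfl
  · refine ⟨?_, m, fun i hi => ?_⟩
    -- For a single monomial, the equation one step above has no cubic part and its linear part
    -- forces a = 0.
    · have E := hEL (m + 1)
      rw [show ∑' i, (starRingEnd ℂ) (bil c c (m + 1 + i)) * (gw (m + 1 + i) (m + 1) * c i) = 0 by
        rw [tsum_eq_single m]
        · rw [bil_eq_zero_of_lt hn (by omega)]; simp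
        · intro i hi
          rcases lt_or_gt_of_ne hi with h' | h'
          · rw [hmin i h']; ring
          · rw [hn i h']; ring] at E
      simp only [shiftCoef] at E
      rw [hn (m + 1) (by omega), hn (m + 1 + 1) (by omega), Nat.add_sub_cancel,
        Nat.add_sub_cancel, hn (m + 1) (by omega)] at E
      simp only [mul_zero, sub_zero, map_zero, zero_sub, zero_add, mul_eq_zero, neg_eq_zero,
        map_mul, Complex.conj_ofReal, hμc, false_or] at E
      rcases E with E | E | E
      · exact E
      · exact absurd E (hsq m)
      · exact absurd E (hconj hn0)
    · rcases lt_or_gt_of_ne hi with h' | h'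
      · exact hmin i h'
      · exact hn i h'
  · exfalso
    have E := hEL (m + 2)
    rw [show 2 * (m + 1) - m = m + 2 by omega] at htop
    rw [htop] at E
    simp only [shiftCoef] at E
    rw [hn (m + 2) (by omega), hn (m + 2 + 1) (by omega), Nat.add_sub_cancel,
      hn (m + 2) (by omega), show m + 2 - 1 = m + 1 by omega] at E
    simp only [mul_zero, sub_zero, map_zero, zero_sub, map_mul, Complex.conj_ofReal] at E
    have F1 : 2 * ((gw (2 * (m + 1)) (m + 1) * gw (2 * (m + 1)) (m + 2) : ℝ) : ℂ) *
        ((starRingEnd ℂ) (c (m + 1)) * c m) = μ * a * (√(m + 2 : ℕ) : ℝ) := by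
      apply mul_right_cancel₀ (hconj hn0)
      push_cast at E ⊢
      linear_combination E
    rcases m with _ | k
    · exact hμ2 (half_of_two_terms (by simpa using hn) hm0 hn0 hm hEL)
    -- The mirror equation, one index below the bottom one m = k + 1. The top and bottom equations
    -- prescribe incompatible values of μa.
    · have E' := hEL k
      rw [tsum_eq_single (k + 2)] at E'
      · rw [show k + (k + 2) = 2 * (k + 1) by omega, bil_two_mul (Or.inr hmin)] at E'
        simp only [shiftCoef] at E'
        rw [hmin k (by omega), Nat.add_sub_cancel, hmin k (by omega), hmin (k - 1) (by omega)] at E'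
        simp only [mul_zero, sub_zero, map_zero, zero_sub, map_mul, Complex.conj_ofReal,
          map_neg] at E'
        refine shift_incompatible k (μ := μ) (a := a)
          (mul_ne_zero (hconj hn0) hm0) F1 ?_
        have F2 : 2 * ((gw (2 * (k + 1)) (k + 1) * gw (2 * (k + 1)) k : ℝ) : ℂ) *
            ((starRingEnd ℂ) (c (k + 1)) * c (k + 2)) =
              μ * (starRingEnd ℂ) a * (√(k + 1 : ℕ) : ℝ) := by
          apply mul_right_cancel₀ (hconj hm0)
          push_cast at E' ⊢
          linear_combination E'
        have := congrArg (starRingEnd ℂ) F2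
        simp only [map_mul, Complex.conj_conj, Complex.conj_ofReal, map_ofNat] at this
        rw [← this]
        ring
      · intro i hi
        rcases lt_or_ge i (k + 1) with h' | h'
        · rw [hmin i h']; ring
        · rcases lt_or_ge (k + 2) i with h3 | h3
          · rw [hn i (by omega)]; ring
          · rw [bil_eq_zero_of_gt hmin (by omega)]; simp

/-! ### Second variation at the special Hermite functions -/

lemma msq_const_mul (ζ : ℂ) (c : ℕ → ℂ) : msq (fun n => ζ * c n) = ‖ζ‖ ^ 2 * msq c := by
  simp only [msq, norm_mul, mul_pow, tsum_mul_left]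

lemma quart_phase {ζ : ℂ} (hζ : ‖ζ‖ = 1) (μ g : ℝ) (a : ℂ) (c : ℕ → ℂ) :
    quart μ g a (fun n => ζ * c n) = quart μ g a c := by
  have h1 : bil (fun n => ζ * c n) (fun n => ζ * c n) = fun k => ζ ^ 2 * bil c c k := by
    funext k
    simp only [bil, Finset.mul_sum]
    exact Finset.sum_congr rfl fun p _ => by ring
  have h2 : shiftCoef a (fun n => ζ * c n) = fun k => ζ * shiftCoef a c k := by
    funext k
    simp only [shiftCoef]
    ring
  rw [quart, en, kin, h1, h2, msq_const_mul, msq_const_mul, msq_const_mul, norm_pow, hζ]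
  simp [quart, en, kin]

lemma bil_single_left (d : ℕ → ℂ) (m k : ℕ) :
    bil (Pi.single m 1) d k = if m ≤ k then gw k m * d (k - m) else 0 := by
  rw [bil_comm, bil_single_right]
  simp

lemma bil_single_single (m : ℕ) :
    bil (Pi.single m 1) (Pi.single m 1) = Pi.single (2 * m) (gw (2 * m) m : ℂ) := by
  funext k
  rw [bil_single_left]
  rcases lt_or_ge k m with h | h
  · rw [if_neg (by omega), Pi.single_eq_of_ne (by omega)]
  · rw [if_pos h]
    by_cases hk : k = 2 * m
    · subst hk
      rw [show 2 * m - m = m by omega]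
      simp
    · rw [Pi.single_eq_of_ne (by omega), Pi.single_eq_of_ne hk, mul_zero]

lemma msq_single (m : ℕ) (z : ℂ) : msq (Pi.single m z) = ‖z‖ ^ 2 := by
  rw [msq, tsum_eq_single m]
  · simp
  · intro n hn
    simp [Pi.single_eq_of_ne hn]

lemma ip_single_left (m : ℕ) (z : ℂ) (x : ℕ → ℂ) :
    ip (Pi.single m z) x = ((starRingEnd ℂ) z * x m).re := by
  rw [ip, tsum_eq_single m]
  · simp
  · intro n hn
    simp [Pi.single_eq_of_ne hn]

lemma kin_zero {c : ℕ → ℂ} (hc : WSummable c) :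
    kin 0 c = ∑' n : ℕ, ((n : ℝ) + 1) * ‖c n‖ ^ 2 := tsum_shift_zero hc

lemma nonneg_of_isLocalMin {q2 q3 q4 : ℝ}
    (h : IsLocalMin (fun t : ℝ => t ^ 2 * q2 + t ^ 3 * q3 + t ^ 4 * q4) 0) : 0 ≤ q2 := by
  have hc : Filter.Tendsto (fun t : ℝ => q2 + t * q3 + t ^ 2 * q4) (nhdsWithin 0 {0}ᶜ) (nhds q2) := by
    have : Continuous fun t : ℝ => q2 + t * q3 + t ^ 2 * q4 := by fun_prop
    simpa using (this.tendsto 0).mono_left nhdsWithin_le_nhds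
  refine ge_of_tendsto hc ?_
  filter_upwards [nhdsWithin_le_nhds h, self_mem_nhdsWithin] with t ht ht0
  have h2 : 0 < t ^ 2 := by
    have : t ≠ 0 := ht0
    positivity
  have : 0 ≤ t ^ 2 * (q2 + t * q3 + t ^ 2 * q4) := by
    calc (0:ℝ) = 0 ^ 2 * q2 + 0 ^ 3 * q3 + 0 ^ 4 * q4 := by ring
      _ ≤ _ := ht
      _ = _ := by ring
  exact nonneg_of_mul_nonneg_right this h2

/-- The second order condition at a special Hermite function. -/
lemma QMin.second_order {μ g : ℝ} {m : ℕ} {ζ : ℂ} (hζ : ‖ζ‖ = 1)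
    (h : QMin μ g 0 (Pi.single m ζ)) {d : ℕ → ℂ} (hd : WSummable d) (hdm : d m = 0) :
    0 ≤ (4 * msq (bil (Pi.single m 1) d) + 2 * (gw (2 * m) m * (bil d d (2 * m)).re)) +
      μ * (kin 0 d - msq d) - μ * m * msq d - 2 * gw (2 * m) m ^ 2 * msq d := by
  have he := wsummable_single m 1
  have hs : (Pi.single m ζ : ℕ → ℂ) = fun n => ζ * (Pi.single m 1 : ℕ → ℂ) n := by
    funext n
    by_cases hn : n = m
    · subst hn; simp
    · simp [Pi.single_eq_of_ne hn]
  -- Multiplying the direction by ζ as well reduces to the phase one.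
  have hloc := h.2 _ (show WSummable (fun n => ζ * d n) by
    refine Summable.congr hd fun n => ?_
    rw [norm_mul, hζ, one_mul])
  have h0 := h.1
  rw [hs, quart_phase hζ] at h0
  have hq : ∀ t : ℝ, quart μ g 0 (fun n => (Pi.single m ζ : ℕ → ℂ) n + t * (ζ * d n)) =
      quart μ g 0 (fun n => (Pi.single m 1 : ℕ → ℂ) n + t * d n) := by
    intro t
    rw [← quart_phase hζ μ g 0 (fun n => (Pi.single m 1 : ℕ → ℂ) n + t * d n)]
    congr 1
    funext n
    rw [hs]
    ring
  simp only [hq] at hloc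
  have e1 : en (Pi.single m 1) = gw (2 * m) m ^ 2 := by
    rw [en, bil_single_single, msq_single, Complex.norm_real, Real.norm_eq_abs, sq_abs]
  have e2 : ip (bil (Pi.single m 1) (Pi.single m 1)) (bil (Pi.single m 1) d) = 0 := by
    rw [bil_single_single, ip_single_left, bil_single_left, if_pos (by omega),
      show 2 * m - m = m by omega, hdm]
    simp
  have e3 : ip (bil (Pi.single m 1) (Pi.single m 1)) (bil d d) =
      gw (2 * m) m * (bil d d (2 * m)).re := by
    rw [bil_single_single, ip_single_left, Complex.conj_ofReal, Complex.re_ofReal_mul]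
  have e4 : ip (shiftCoef 0 (Pi.single m 1)) (shiftCoef 0 d) = 0 := by
    rw [ip]
    convert tsum_zero with n
    simp only [shiftCoef, zero_mul, sub_zero]
    by_cases hn : n - 1 = m
    · rw [hn, hdm]; simp
    · rw [Pi.single_eq_of_ne hn]; simp
  have e5 : ip (Pi.single m 1) d = 0 := by
    rw [ip_single_left, hdm]; simp
  have e6 : msq (Pi.single m 1) = 1 := by rw [msq_single]; simp
  have e7 : kin 0 (Pi.single m 1) = m + 1 := by
    rw [kin_zero he, tsum_eq_single m]
    · simp
    · intro n hn
      simp [Pi.single_eq_of_ne hn]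
  rw [quart, e1, e6, e7] at h0
  -- The vanishing of `quart` at the base point fixes g as the energy of φ_m.
  have hg : g = gw (2 * m) m ^ 2 + μ * m := by linarith
  have e8 : (fun t : ℝ => quart μ g 0 (fun n => (Pi.single m 1 : ℕ → ℂ) n + t * d n)) =
      fun t : ℝ => t ^ 2 * ((4 * msq (bil (Pi.single m 1) d) +
        2 * (gw (2 * m) m * (bil d d (2 * m)).re)) +
        μ * (kin 0 d - msq d) - μ * m * msq d - 2 * gw (2 * m) m ^ 2 * msq d) +
        t ^ 3 * (4 * ip (bil (Pi.single m 1) d) (bil d d)) +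
        t ^ 4 * (en d + μ * (kin 0 d - msq d) * msq d - g * msq d ^ 2) := by
    funext t
    rw [quart, en_line he.sq hd.sq, kin_line he hd, msq_lin he.sq hd.sq, e1, e2, e3, e4, e5, e6,
      e7, hg]
    ring
  rw [e8] at hloc
  exact nonneg_of_isLocalMin hloc

lemma msq_bil_single_single (m n : ℕ) (z : ℂ) :
    msq (bil (Pi.single m 1) (Pi.single n z)) = gw (m + n) m ^ 2 * ‖z‖ ^ 2 := by
  rw [msq, tsum_eq_single (m + n)]
  · rw [bil_single_left, if_pos (by omega), show m + n - m = n by omega, Pi.single_eq_same,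
      norm_mul, Complex.norm_real, mul_pow, Real.norm_eq_abs, sq_abs]
  · intro k hk
    rw [bil_single_left]
    split_ifs with h
    · rw [Pi.single_eq_of_ne (by omega)]; simp
    · simp

lemma kin_single (n : ℕ) (z : ℂ) : kin 0 (Pi.single n z) = (n + 1) * ‖z‖ ^ 2 := by
  rw [kin_zero (wsummable_single n z), tsum_eq_single n]
  · simp
  · intro k hk
    simp [Pi.single_eq_of_ne hk]

/-- In the direction φ₂ the second order condition is 1 + 2μ - 2 ≥ 0. -/
lemma QMin.zero_not_single {μ g : ℝ} {ζ : ℂ} (hζ : ‖ζ‖ = 1)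
    (h : QMin μ g 0 (Pi.single 0 ζ)) : 1 / 2 ≤ μ := by
  have := h.second_order hζ (wsummable_single 2 1) (by simp)
  have h0 : bil (Pi.single 2 1) (Pi.single 2 1) 0 = 0 := by
    rw [bil_single_left, if_neg (by omega)]
  rw [msq_bil_single_single, kin_single, msq_single, gw_sq, gw_sq, mul_zero, h0] at this
  norm_num at this
  linarith

/-- In the direction φ₅ the condition is 4·6/64 + 4μ - 1 ≥ 0, the source of the constant 5/32. -/
lemma QMin.one_not_single {μ g : ℝ} {ζ : ℂ} (hζ : ‖ζ‖ = 1)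
    (h : QMin μ g 0 (Pi.single 1 ζ)) : 5 / 32 ≤ μ := by
  have := h.second_order hζ (wsummable_single 5 1) (by simp)
  have h0 : bil (Pi.single 5 1) (Pi.single 5 1) (2 * 1) = 0 := by
    rw [bil_single_left, if_neg (by omega)]
  rw [msq_bil_single_single, kin_single, msq_single, gw_sq, gw_sq, h0] at this
  norm_num [Nat.choose] at this
  linarith

/-- The values at (C, A) and (B, C) are A(AB - C²) and B(AB - C²), so A, B ≤ 0; the value A + B - 2C
at (1, 1) is then negative. -/
lemma not_forall_quadratic_nonneg {A B C : ℝ} (hC : 0 < C) (hAB : A * B < C ^ 2)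
    (h : ∀ x y : ℝ, 0 ≤ A * x ^ 2 + B * y ^ 2 - 2 * C * (x * y)) : False := by
  have h1 := h C A
  have h2 := h B C
  have h3 := h 1 1
  have h4 : 0 ≤ A * (A * B - C ^ 2) := by linarith
  have h5 : 0 ≤ B * (A * B - C ^ 2) := by linarith
  have hA : A ≤ 0 := by by_contra! hh; nlinarith
  have hB : B ≤ 0 := by by_contra! hh; nlinarith
  linarith

/-- Perturb φ_m, m = k + 2, by xφ_{m+2} - yφ_{m-2}: these two levels are coupled through the
coefficient of z^{2m}. The contributions ±2μ of the angular momentum cancel in A + B, so the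
instability is uniform in μ. -/
lemma QMin.not_single_add_two {μ g : ℝ} {ζ : ℂ} (hζ : ‖ζ‖ = 1) (k : ℕ)
    (h : QMin μ g 0 (Pi.single (k + 2) ζ)) : False := by
  set m := k + 2 with hm
  have hd : ∀ x y : ℝ, ∀ n, k + 4 < n →
      (Pi.single (k + 4) (x : ℂ) + Pi.single k (-y : ℂ) : ℕ → ℂ) n = 0 := by
    intro x y n hn
    simp [Pi.single_eq_of_ne (show n ≠ k + 4 by omega), Pi.single_eq_of_ne (show n ≠ k by omega)]
  have hsum : ∀ (x y : ℝ) (F : ℕ → ℂ → ℝ), (∀ n, F n 0 = 0) →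
      ∑' n, F n ((Pi.single (k + 4) (x : ℂ) + Pi.single k (-y : ℂ) : ℕ → ℂ) n) =
        F (k + 4) x + F k (-y) := by
    intro x y F hF
    rw [tsum_eq_sum (s := {k + 4, k}), Finset.sum_pair (by omega)]
    · simp
    · intro n hn
      simp only [Finset.mem_insert, Finset.mem_singleton, not_or] at hn
      simp [Pi.single_eq_of_ne hn.1, Pi.single_eq_of_ne hn.2, hF]
  set W := gw (2 * m) m ^ 2 with hW
  set A := 4 * gw (m + (k + 4)) m ^ 2 - 2 * W + 2 * μ with hA
  set B := 4 * gw (m + k) m ^ 2 - 2 * W - 2 * μ with hB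
  set C := 2 * (gw (2 * m) m * gw (2 * m) (k + 4)) with hC
  have key : ∀ x y : ℝ, 0 ≤ A * x ^ 2 + B * y ^ 2 - 2 * C * (x * y) := by
    intro x y
    have hdw := wsummable_of_finite (hd x y)
    have := h.second_order hζ hdw (by
      simp [Pi.single_eq_of_ne (show m ≠ k + 4 by omega), Pi.single_eq_of_ne (show m ≠ k by omega)])
    have f1 : msq (Pi.single (k + 4) (x : ℂ) + Pi.single k (-y : ℂ) : ℕ → ℂ) = x ^ 2 + y ^ 2 := by
      rw [msq, hsum x y (fun n z => ‖z‖ ^ 2) (by simp)]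
      simp
    have f2 : kin 0 (Pi.single (k + 4) (x : ℂ) + Pi.single k (-y : ℂ) : ℕ → ℂ) =
        (k + 5) * x ^ 2 + (k + 1) * y ^ 2 := by
      rw [kin_zero hdw, hsum x y (fun n z => ((n : ℝ) + 1) * ‖z‖ ^ 2) (by simp)]
      simp only [norm_neg, Complex.norm_real, Real.norm_eq_abs, sq_abs]
      push_cast
      ring
    have f3 : msq (bil (Pi.single m 1) (Pi.single (k + 4) (x : ℂ) + Pi.single k (-y : ℂ))) =
        gw (m + (k + 4)) m ^ 2 * x ^ 2 + gw (m + k) m ^ 2 * y ^ 2 := by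
      have hs := ((wsummable_single m 1).sq.bil hdw.sq)
      rw [msq, ← Summable.sum_add_tsum_nat_add m hs, Finset.sum_eq_zero, zero_add]
      · have : ∀ n, ‖bil (Pi.single m 1)
            (Pi.single (k + 4) (x : ℂ) + Pi.single k (-y : ℂ)) (n + m)‖ ^ 2 =
            (fun (n : ℕ) (z : ℂ) => gw (m + n) m ^ 2 * ‖z‖ ^ 2) n
              ((Pi.single (k + 4) (x : ℂ) + Pi.single k (-y : ℂ) : ℕ → ℂ) n) := by
          intro n
          rw [bil_single_left, if_pos (by omega), Nat.add_sub_cancel, norm_mul, mul_pow,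
            Complex.norm_real, Real.norm_eq_abs, sq_abs, add_comm n m]
        simp only [this]
        rw [hsum x y (fun n z => gw (m + n) m ^ 2 * ‖z‖ ^ 2) (by simp)]
        simp
      · intro i hi
        rw [bil_single_left, if_neg (by simpa using hi)]
        simp
    have f4 : (bil (Pi.single (k + 4) (x : ℂ) + Pi.single k (-y : ℂ))
        (Pi.single (k + 4) (x : ℂ) + Pi.single k (-y : ℂ)) (2 * m)).re =
        -2 * gw (2 * m) (k + 4) * (x * y) := by
      have : bil (Pi.single (k + 4) (x : ℂ) + Pi.single k (-y : ℂ))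
        (Pi.single (k + 4) (x : ℂ) + Pi.single k (-y : ℂ)) (2 * m) =
        ((-2 * gw (2 * m) (k + 4) * (x * y) : ℝ) : ℂ) := by
        rw [bil, Finset.sum_eq_add_of_mem (k + 4, k) (k, k + 4)
          (Finset.HasAntidiagonal.mem_antidiagonal.2 (by simp; omega))
          (Finset.HasAntidiagonal.mem_antidiagonal.2 (by simp; omega)) (by simp)]
        · simp only [Pi.add_apply, Pi.single_eq_same, Pi.single_eq_of_ne (show k + 4 ≠ k by omega),
            Pi.single_eq_of_ne (show k ≠ k + 4 by omega)]
          rw [gw_symm (show k + (k + 4) = 2 * m by omega)]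
          push_cast
          ring
        · rintro ⟨i, j⟩ hij hne
          have := Finset.HasAntidiagonal.mem_antidiagonal.1 hij
          simp only at this
          have h1 : i ≠ k + 4 := by
            rintro rfl
            exact hne.1 (Prod.ext rfl (by simp; omega))
          have h2 : i ≠ k := by
            rintro rfl
            exact hne.2 (Prod.ext rfl (by simp; omega))
          simp [Pi.single_eq_of_ne h1, Pi.single_eq_of_ne h2]
      rw [this, Complex.ofReal_re]
    rw [f1, f2, f3, f4] at this
    have hmk : (m : ℝ) = k + 2 := by rw [hm]; push_cast; ring
    rw [hmk] at this
    rw [hA, hB, hC]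
    nlinarith
  refine not_forall_quadratic_nonneg (A := A) (B := B) (C := C)
    (mul_pos two_pos (mul_pos (gw_pos (by omega)) (gw_pos (by omega)))) ?_ key
  have hk : (0:ℝ) ≤ k := Nat.cast_nonneg k
  have hWpos : 0 < W := pow_pos (gw_pos (by omega)) 2
  have hWc : W = ((2 * m).choose m : ℝ) / 2 ^ (2 * m) := gw_sq _ _
  set X : ℝ := ((2 * m).choose m : ℝ) with hX
  have hp : (0:ℝ) < 2 ^ (2 * m) := by positivity
  -- All weights are expressed in units of the central one W, with rational ratios in k.
  have w1 : gw (m + (k + 4)) m ^ 2 = W * ((2 * k + 5) / (2 * (k + 4))) := by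
    rw [gw_sq, hWc, show m + (k + 4) = 2 * m + 2 by omega, pow_add]
    have c1 : ((2 * m + 1).choose m : ℝ) * (k + 3) = X * (2 * k + 5) := by
      have := Nat.add_one_mul_choose_eq (2 * m) m
      have h2 := Nat.choose_succ_right_eq (2 * m + 1) m
      rw [show 2 * m + 1 - m = k + 3 by omega] at h2
      have h3 : (2 * m + 1) * (2 * m).choose m = (2 * m + 1).choose m * (k + 3) := by
        rw [this, ← h2]
      have h4 : (2 * (m:ℝ) + 1) * X = ((2 * m + 1).choose m : ℝ) * (k + 3) := by
        rw [hX]; exact_mod_cast h3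
      rw [hm] at h4 ⊢
      push_cast at h4 ⊢
      linarith
    have c2 : ((2 * m + 2).choose m : ℝ) * (k + 4) = ((2 * m + 1).choose m : ℝ) * (2 * k + 6) := by
      have := Nat.add_one_mul_choose_eq (2 * m + 1) m
      have h2 := Nat.choose_succ_right_eq (2 * m + 2) m
      rw [show 2 * m + 2 - m = k + 4 by omega] at h2
      have h3 : (2 * m + 1 + 1) * (2 * m + 1).choose m = (2 * m + 2).choose m * (k + 4) := by
        rw [this, ← h2]
      have h4 : (2 * (m:ℝ) + 1 + 1) * ((2 * m + 1).choose m : ℝ) =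
        ((2 * m + 2).choose m : ℝ) * (k + 4) := by exact_mod_cast h3
      rw [hm] at h4 ⊢
      push_cast at h4 ⊢
      linarith
    have c3 : ((2 * m + 1).choose m : ℝ) = X * (2 * k + 5) / (k + 3) := by
      field_simp; linarith
    have c4 : ((2 * m + 2).choose m : ℝ) = ((2 * m + 1).choose m : ℝ) * (2 * k + 6) / (k + 4) := by
      field_simp; linarith
    rw [c4, c3]
    field_simp
    ring
  have w2 : gw (m + k) m ^ 2 = W * (2 * (k + 1) / (2 * k + 3)) := by
    have hp2 : (2:ℝ) ^ (2 * m) = 2 ^ (m + k) * 4 := by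
      rw [show 2 * m = m + k + 2 by omega, pow_add]; norm_num
    rw [gw_sq, hWc, hp2]
    have c1 : (2 * (k:ℝ) + 3) * ((m + k).choose m : ℝ) = ((m + k + 1).choose m : ℝ) * (k + 1) := by
      have := Nat.add_one_mul_choose_eq (m + k) m
      have h2 := Nat.choose_succ_right_eq (m + k + 1) m
      rw [show m + k + 1 - m = k + 1 by omega] at h2
      have h3 : (m + k + 1) * (m + k).choose m = (m + k + 1).choose m * (k + 1) := by
        rw [this, ← h2]
      have h4 : ((m:ℝ) + k + 1) * ((m + k).choose m : ℝ) =
        ((m + k + 1).choose m : ℝ) * (k + 1) := by exact_mod_cast h3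
      rw [hm] at h4 ⊢
      push_cast at h4 ⊢
      linarith
    have c2 : (2 * (k:ℝ) + 4) * ((m + k + 1).choose m : ℝ) = X * (k + 2) := by
      have := Nat.add_one_mul_choose_eq (m + k + 1) m
      have h2 := Nat.choose_succ_right_eq (m + k + 2) m
      rw [show m + k + 2 - m = k + 2 by omega] at h2
      have h3 : (m + k + 1 + 1) * (m + k + 1).choose m = (m + k + 2).choose m * (k + 2) := by
        rw [this, ← h2]
      have hX' : X = ((m + k + 2).choose m : ℝ) := by rw [hX, show 2 * m = m + k + 2 by omega]
      have h4 : ((m:ℝ) + k + 1 + 1) * ((m + k + 1).choose m : ℝ) =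
        ((m + k + 2).choose m : ℝ) * (k + 2) := by exact_mod_cast h3
      rw [hX']
      rw [hm] at h4 ⊢
      push_cast at h4 ⊢
      linarith
    have c3 : ((m + k + 1).choose m : ℝ) = X / 2 := by
      have : (0:ℝ) < k + 2 := by positivity
      nlinarith
    have c4 : ((m + k).choose m : ℝ) = X / 2 * (k + 1) / (2 * k + 3) := by
      rw [c3] at c1
      field_simp
      linarith
    rw [c4]
    field_simp
    ring
  have w3 : gw (2 * m) (k + 4) ^ 2 = W * ((k + 2) * (k + 1) / ((k + 3) * (k + 4))) := by
    rw [gw_sq, hWc]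
    have c1 : ((2 * m).choose (k + 3) : ℝ) * (k + 3) = X * (k + 2) := by
      have := Nat.choose_succ_right_eq (2 * m) m
      rw [show 2 * m - m = k + 2 by omega, show m + 1 = k + 3 by omega] at this
      rw [hX]
      exact_mod_cast this
    have c2 : ((2 * m).choose (k + 4) : ℝ) * (k + 4) = ((2 * m).choose (k + 3) : ℝ) * (k + 1) := by
      have := Nat.choose_succ_right_eq (2 * m) (k + 3)
      rw [show 2 * m - (k + 3) = k + 1 by omega] at this
      exact_mod_cast this
    have c3 : ((2 * m).choose (k + 3) : ℝ) = X * (k + 2) / (k + 3) := by field_simp; linarith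
    have c4 : ((2 * m).choose (k + 4) : ℝ) = X * (k + 2) / (k + 3) * (k + 1) / (k + 4) := by
      rw [c3] at c2
      field_simp at c2 ⊢
      linarith
    rw [c4]
    field_simp
  -- This bound involves A + B only, hence not μ.
  have hAB : A * B ≤ ((A + B) / 2) ^ 2 := by nlinarith [sq_nonneg (A - B)]
  refine hAB.trans_lt ?_
  have hC2 : C ^ 2 = 4 * (W * gw (2 * m) (k + 4) ^ 2) := by rw [hC, hW]; ring
  have hsumAB : (A + B) / 2 = W * (2 * ((2 * k + 5) / (2 * (k + 4))) +
      2 * (2 * (k + 1) / (2 * k + 3)) - 2) := by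
    rw [hA, hB, w1, w2]; ring
  rw [hC2, w3, hsumAB]
  have hfin : (2 * ((2 * (k:ℝ) + 5) / (2 * (k + 4))) + 2 * (2 * (k + 1) / (2 * k + 3)) - 2) ^ 2 <
      4 * ((k + 2) * (k + 1) / ((k + 3) * (k + 4))) := by
    rw [show 2 * ((2 * (k:ℝ) + 5) / (2 * (k + 4))) + 2 * (2 * (k + 1) / (2 * k + 3)) - 2 =
      (4 * k ^ 2 + 14 * k + 7) / ((k + 4) * (2 * k + 3)) by field_simp; ring]
    rw [div_pow, mul_div_assoc', div_lt_div_iff₀ (by positivity) (by positivity)]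
    have : 0 < 8 * (k:ℝ) ^ 3 + 100 * k ^ 2 + 251 * k + 141 := by positivity
    have h4 : (0:ℝ) < k + 4 := by positivity
    nlinarith [mul_pos h4 this]
  have : 0 < W ^ 2 := by positivity
  nlinarith

/-! ### Two particles: centre of mass and relative coordinates -/

lemma lintegral_comp_two_mul {G : ℂ → ℝ≥0∞} (hG : Measurable G) :
    ∫⁻ x, G x = 4 * ∫⁻ t, G (2 * t) := by
  have h := Measure.map_addHaar_smul (volume : Measure ℂ) (r := (2 : ℝ)) two_ne_zero
  have h2 : ∫⁻ t, G (2 * t) = ∫⁻ x, G x ∂(Measure.map (fun x : ℂ => (2 : ℝ) • x) volume) := by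
    rw [lintegral_map hG (by fun_prop)]
    simp
  rw [h2, h, lintegral_smul_measure, Complex.finrank_real_complex, smul_eq_mul, ← mul_assoc]
  rw [show (4 : ℝ≥0∞) = ENNReal.ofReal 4 by simp, ← ENNReal.ofReal_mul (by norm_num)]
  norm_num

/-- Passage to centre of mass and relative coordinates. -/
lemma lintegral_pair {Φ : ℂ → ℂ → ℝ≥0∞} (hΦ : Measurable (Function.uncurry Φ)) :
    ∫⁻ z, ∫⁻ w, Φ z w = 4 * ∫⁻ s, ∫⁻ t, Φ (s + t) (s - t) := by
  have hm : ∀ {α : Type} [MeasurableSpace α] {f g : α → ℂ}, Measurable f → Measurable g →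
      Measurable fun x => Φ (f x) (g x) := fun hf hg => hΦ.comp (hf.prodMk hg)
  calc ∫⁻ z, ∫⁻ w, Φ z w = ∫⁻ w, ∫⁻ z, Φ z w := lintegral_lintegral_swap hΦ.aemeasurable
    _ = ∫⁻ w, ∫⁻ x, Φ (x + w) w := by
      refine lintegral_congr fun w => ?_
      rw [lintegral_add_right_eq_self (fun x => Φ x w) w]
    _ = ∫⁻ w, 4 * ∫⁻ t, Φ (2 * t + w) w := by
      refine lintegral_congr fun w => ?_
      rw [lintegral_comp_two_mul (hm (by fun_prop) (by fun_prop))]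
    _ = 4 * ∫⁻ w, ∫⁻ t, Φ (2 * t + w) w := lintegral_const_mul' _ _ (by finiteness)
    _ = 4 * ∫⁻ t, ∫⁻ w, Φ (2 * t + w) w := by
      rw [lintegral_lintegral_swap]
      exact (hm (by fun_prop) (by fun_prop) :
        Measurable fun p : ℂ × ℂ => Φ (2 * p.2 + p.1) p.1).aemeasurable
    _ = 4 * ∫⁻ t, ∫⁻ s, Φ (s + t) (s - t) := by
      congr 1
      refine lintegral_congr fun t => ?_
      rw [← lintegral_add_right_eq_self (fun w => Φ (2 * t + w) w) (-t)]
      refine lintegral_congr fun s => ?_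
      congr 1
      ring
    _ = 4 * ∫⁻ s, ∫⁻ t, Φ (s + t) (s - t) := by
      rw [lintegral_lintegral_swap]
      exact (hm (by fun_prop) (by fun_prop) :
        Measurable fun p : ℂ × ℂ => Φ (p.2 + p.1) (p.2 - p.1)).aemeasurable

/-- The coefficient of `t ^ l` in `f (s + t) * f (s - t)`. -/
noncomputable def pairCoef (f : ℂ → ℂ) (l : ℕ) (s : ℂ) : ℂ :=
  ∑ p ∈ Finset.HasAntidiagonal.antidiagonal l,
    (((p.1 ! : ℂ)⁻¹ * iteratedDeriv p.1 f s) * ((-1) ^ p.2 * ((p.2 ! : ℂ)⁻¹ * iteratedDeriv p.2 f s)))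

lemma continuous_pairCoef {f : ℂ → ℂ} (hf : Differentiable ℂ f) (l : ℕ) :
    Continuous (pairCoef f l) := by
  have h : ∀ n, Continuous (iteratedDeriv n f) := fun n =>
    (hf.contDiff (n := n)).continuous_iteratedDeriv n le_rfl
  unfold pairCoef
  refine continuous_finsetSum _ fun p _ => ?_
  have h1 := h p.1
  have h2 := h p.2
  fun_prop

lemma isEntireSeries_pair {f : ℂ → ℂ} (hf : Differentiable ℂ f) (s : ℂ) :
    IsEntireSeries (fun l => pairCoef f l s) (fun t => f (s + t) * f (s - t)) := by
  intro t
  have h1 := Complex.hasSum_taylorSeries_of_entire hf s (s + t)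
  have h2 := Complex.hasSum_taylorSeries_of_entire hf s (s - t)
  have h3 := (summable_norm_sum_mul_antidiagonal_of_summable_norm h1.summable.norm
    h2.summable.norm).of_norm.hasSum
  rw [← tsum_mul_tsum_eq_tsum_sum_antidiagonal_of_summable_norm h1.summable.norm
    h2.summable.norm, h1.tsum_eq, h2.tsum_eq] at h3
  refine h3.congr_fun ?_ |> id
  intro l
  simp only [pairCoef]
  rw [Finset.sum_mul]
  refine Finset.sum_congr rfl fun p hp => ?_
  rw [← Finset.HasAntidiagonal.mem_antidiagonal.1 hp, pow_add]
  simp only [smul_eq_mul, add_sub_cancel_left, sub_sub_cancel_left]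
  rw [neg_pow]
  ring

lemma pairCoef_zero (f : ℂ → ℂ) (s : ℂ) : pairCoef f 0 s = f s ^ 2 := by
  simp [pairCoef, sq]

/-- The function f(s+t)f(s-t) is even in t; on coefficients this is the exchange of the two indices
of the antidiagonal. -/
lemma pairCoef_odd (f : ℂ → ℂ) {l : ℕ} (hl : Odd l) (s : ℂ) : pairCoef f l s = 0 := by
  have : pairCoef f l s = -pairCoef f l s := by
    conv_lhs => rw [pairCoef]
    rw [pairCoef, ← Finset.sum_neg_distrib]
    refine Finset.sum_equiv (Equiv.prodComm ℕ ℕ) ?_ ?_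
    · intro p
      simp [Finset.HasAntidiagonal.mem_antidiagonal, add_comm]
    · intro p hp
      have h := Finset.HasAntidiagonal.mem_antidiagonal.1 hp
      simp only [Equiv.prodComm_apply, Prod.fst_swap, Prod.snd_swap]
      have e : (-1 : ℂ) ^ p.1 = -(-1) ^ p.2 := by
        rcases Nat.even_or_odd p.2 with h2 | h2
        · have h1 : Odd p.1 := by
            rw [← h] at hl
            by_contra hh
            rw [Nat.not_odd_iff_even] at hh
            exact (Nat.not_odd_iff_even.2 (hh.add h2)) hl
          rw [h1.neg_one_pow, h2.neg_one_pow]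
        · have h1 : Even p.1 := by
            rw [← h] at hl
            by_contra hh
            rw [Nat.not_even_iff_odd] at hh
            exact (Nat.not_odd_iff_even.2 (hh.add_odd h2)) hl
          rw [h1.neg_one_pow, h2.neg_one_pow, neg_neg]
      rw [e]
      ring
  exact self_eq_neg.1 this

/-- Averaging over rotations in Parseval's identity. -/
lemma lintegral_rotation_average {a : ℕ → ℂ} {g : ℂ → ℂ} (h : IsEntireSeries a g)
    {G : ℂ → ℝ≥0∞} (hG : Measurable G) :
    ∫⁻ θ : ℝ in Set.Ioo (-Real.pi) Real.pi,
        ∫⁻ t : ℂ, ‖g t‖ₑ ^ 2 * G (Complex.exp (-(θ * Complex.I)) * t) =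
      ENNReal.ofReal (2 * Real.pi) * ∑' n, ‖a n‖ₑ ^ 2 * ∫⁻ t : ℂ, ‖t‖ₑ ^ (2 * n) * G t := by
  have hc := h.differentiable.continuous
  -- The rotation is moved from the weight to g by invariance of Lebesgue measure.
  have h1 : ∀ θ : ℝ, ∫⁻ t : ℂ, ‖g t‖ₑ ^ 2 * G (Complex.exp (-(θ * Complex.I)) * t) =
      ∫⁻ t : ℂ, ‖g (t * Complex.exp (θ * Complex.I))‖ₑ ^ 2 * G t := by
    intro θ
    have hmp := (rotation (Circle.exp θ)).measurePreserving
    rw [← hmp.lintegral_comp_emb (rotation (Circle.exp θ)).toHomeomorph.measurableEmbedding]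
    refine lintegral_congr fun t => ?_
    rw [rotation_apply, Circle.coe_exp, ← mul_assoc, ← Complex.exp_add, neg_add_cancel,
      Complex.exp_zero, one_mul, mul_comm t]
  simp only [h1]
  rw [lintegral_lintegral_swap]
  · have h2 : ∀ t : ℂ, ∫⁻ θ : ℝ in Set.Ioo (-Real.pi) Real.pi,
        ‖g (t * Complex.exp (θ * Complex.I))‖ₑ ^ 2 * G t =
        ∑' n, ENNReal.ofReal (2 * Real.pi) * (‖a n‖ₑ ^ 2 * (‖t‖ₑ ^ (2 * n) * G t)) := by
      intro t
      rw [lintegral_mul_const _ (Continuous.measurable (by fun_prop))]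
      -- For fixed t, Parseval on the unit circle applied to z ↦ g(tz) removes the cross terms,
      -- although the weight G need not be radial.
      have h3 : IsEntireSeries (fun n => a n * t ^ n) (fun z => g (t * z)) := by
        intro z
        have := h (t * z)
        simpa [mul_pow, mul_assoc] using this
      have h4 := lintegral_circle h3 1
      simp only [Complex.ofReal_one, one_mul, one_pow, mul_one] at h4
      rw [h4, ← ENNReal.tsum_mul_right]
      refine tsum_congr fun n => ?_
      rw [ENNReal.ofReal_mul (by positivity), ENNReal.ofReal_pow (norm_nonneg _), ofReal_norm,
        enorm_mul, enorm_pow, mul_pow, ← pow_mul, mul_comm n 2]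
      ring
    simp only [h2]
    rw [lintegral_tsum (fun n => by fun_prop), ← ENNReal.tsum_mul_left]
    refine tsum_congr fun n => ?_
    rw [lintegral_const_mul _ (by fun_prop), lintegral_const_mul _ (by fun_prop)]
  · fun_prop

/-- The squared norm of the `l`-th relative component of the two-particle function. -/
noncomputable def relNorm (f : ℂ → ℂ) (l : ℕ) : ℝ≥0∞ :=
  ∫⁻ s, ‖pairCoef f l s‖ₑ ^ 2 * ENNReal.ofReal (Real.exp (-(2 * ‖s‖ ^ 2)))

/-- By the parallelogram law, |s+t|² + |s-t|² = 2|s|² + 2|t|², so the Gaussian factorizes in the new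
variables. -/
lemma enorm_wave_pair (c : ℕ → ℂ) (s t : ℂ) :
    ‖wave c (s + t)‖ₑ ^ 2 * ‖wave c (s - t)‖ₑ ^ 2 =
      ENNReal.ofReal (Real.exp (-(2 * ‖s‖ ^ 2))) * (‖holo c (s + t) * holo c (s - t)‖ₑ ^ 2 *
        ENNReal.ofReal (Real.exp (-(2 * ‖t‖ ^ 2)))) := by
  rw [enorm_wave_sq, enorm_wave_sq, enorm_mul]
  have e : ENNReal.ofReal (Real.exp (-(1 * ‖s + t‖ ^ 2))) *
      ENNReal.ofReal (Real.exp (-(1 * ‖s - t‖ ^ 2))) =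
      ENNReal.ofReal (Real.exp (-(2 * ‖s‖ ^ 2))) * ENNReal.ofReal (Real.exp (-(2 * ‖t‖ ^ 2))) := by
    rw [← ENNReal.ofReal_mul (by positivity), ← ENNReal.ofReal_mul (by positivity),
      ← Real.exp_add, ← Real.exp_add]
    congr 2
    have := parallelogram_law_with_norm ℝ s t
    nlinarith
  calc _ = (‖holo c (s + t)‖ₑ ^ 2 * ‖holo c (s - t)‖ₑ ^ 2) *
      (ENNReal.ofReal (Real.exp (-(1 * ‖s + t‖ ^ 2))) *
      ENNReal.ofReal (Real.exp (-(1 * ‖s - t‖ ^ 2)))) := by ring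
    _ = _ := by rw [e]; ring

/-- Rotation averages of two-particle integrals in terms of the relative components. -/
lemma lintegral_pair_average {c : ℕ → ℂ} (hc : SqSummable c) {G : ℂ → ℝ≥0∞} (hG : Measurable G) :
    ∫⁻ θ : ℝ in Set.Ioo (-Real.pi) Real.pi, ∫⁻ z, ∫⁻ w, ‖wave c z‖ₑ ^ 2 * ‖wave c w‖ₑ ^ 2 *
        G (Complex.exp (-(θ * Complex.I)) * (z - w)) =
      ENNReal.ofReal (2 * Real.pi) * ∑' l, 4 * (relNorm (holo c) l *
        ∫⁻ t : ℂ, ‖t‖ₑ ^ (2 * l) * (ENNReal.ofReal (Real.exp (-(2 * ‖t‖ ^ 2))) * G (2 * t))) := by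
  have hcont := hc.continuous_wave
  have hf := hc.isEntireSeries.differentiable
  have hfc := hf.continuous
  have h1 : ∀ θ : ℝ, ∫⁻ z, ∫⁻ w, ‖wave c z‖ₑ ^ 2 * ‖wave c w‖ₑ ^ 2 *
        G (Complex.exp (-(θ * Complex.I)) * (z - w)) =
      4 * ∫⁻ s, ENNReal.ofReal (Real.exp (-(2 * ‖s‖ ^ 2))) *
        ∫⁻ t, ‖holo c (s + t) * holo c (s - t)‖ₑ ^ 2 *
          (ENNReal.ofReal (Real.exp (-(2 * ‖Complex.exp (-(θ * Complex.I)) * t‖ ^ 2))) *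
            G (2 * (Complex.exp (-(θ * Complex.I)) * t))) := by
    intro θ
    rw [lintegral_pair (Φ := fun z w => ‖wave c z‖ₑ ^ 2 * ‖wave c w‖ₑ ^ 2 *
        G (Complex.exp (-(θ * Complex.I)) * (z - w))) (by
      simp only [Function.uncurry_def]
      fun_prop)]
    congr 1
    refine lintegral_congr fun s => ?_
    rw [← lintegral_const_mul _ (by fun_prop)]
    refine lintegral_congr fun t => ?_
    rw [enorm_wave_pair]
    have e1 : ‖Complex.exp (-(θ * Complex.I)) * t‖ = ‖t‖ := by
      rw [norm_mul, ← neg_mul, ← Complex.ofReal_neg, Complex.norm_exp_ofReal_mul_I, one_mul]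
    have e2 : Complex.exp (-(θ * Complex.I)) * (s + t - (s - t)) =
        2 * (Complex.exp (-(θ * Complex.I)) * t) := by ring
    rw [e1, e2]
    ring
  simp only [h1]
  rw [lintegral_const_mul' _ _ (by finiteness), lintegral_lintegral_swap]
  · have h2 : ∀ s : ℂ, ∫⁻ θ : ℝ in Set.Ioo (-Real.pi) Real.pi,
        ENNReal.ofReal (Real.exp (-(2 * ‖s‖ ^ 2))) *
        ∫⁻ t, ‖holo c (s + t) * holo c (s - t)‖ₑ ^ 2 *
          (ENNReal.ofReal (Real.exp (-(2 * ‖Complex.exp (-(θ * Complex.I)) * t‖ ^ 2))) *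
            G (2 * (Complex.exp (-(θ * Complex.I)) * t))) =
        ∑' l, ENNReal.ofReal (2 * Real.pi) * ((‖pairCoef (holo c) l s‖ₑ ^ 2 *
          ENNReal.ofReal (Real.exp (-(2 * ‖s‖ ^ 2)))) * ∫⁻ t : ℂ, ‖t‖ₑ ^ (2 * l) *
            (ENNReal.ofReal (Real.exp (-(2 * ‖t‖ ^ 2))) * G (2 * t))) := by
      intro s
      rw [lintegral_const_mul' _ _ (by finiteness)]
      rw [lintegral_rotation_average (isEntireSeries_pair hf s)
        (G := fun t => ENNReal.ofReal (Real.exp (-(2 * ‖t‖ ^ 2))) * G (2 * t)) (by fun_prop)]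
      rw [← ENNReal.tsum_mul_left, ← ENNReal.tsum_mul_left]
      exact tsum_congr fun l => by ring
    simp only [h2]
    have hp : ∀ l, Measurable (pairCoef (holo c) l) := fun l =>
      (continuous_pairCoef hf l).measurable
    rw [lintegral_tsum (fun l => by have := hp l; fun_prop), ← ENNReal.tsum_mul_left,
      ← ENNReal.tsum_mul_left]
    refine tsum_congr fun l => ?_
    have := hp l
    rw [lintegral_const_mul _ (by fun_prop), lintegral_mul_const _ (by fun_prop), relNorm]
    ring
  · refine Measurable.aemeasurable ?_
    simp only [Function.uncurry_def]
    refine Measurable.mul (by fun_prop) ?_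
    exact Measurable.lintegral_prod_right' (f := fun q : (ℝ × ℂ) × ℂ =>
      ‖holo c (q.1.2 + q.2) * holo c (q.1.2 - q.2)‖ₑ ^ 2 *
          (ENNReal.ofReal (Real.exp (-(2 * ‖Complex.exp (-(q.1.1 * Complex.I)) * q.2‖ ^ 2))) *
            G (2 * (Complex.exp (-(q.1.1 * Complex.I)) * q.2)))) (by fun_prop)

/-- Two-particle integrals with a radial weight. -/
lemma lintegral_pair_radial {c : ℕ → ℂ} (hc : SqSummable c) {W : ℝ → ℝ≥0∞} (hW : Measurable W) :
    ∫⁻ z, ∫⁻ w, ‖wave c z‖ₑ ^ 2 * ‖wave c w‖ₑ ^ 2 * W ‖z - w‖ =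
      ∑' l, 4 * (relNorm (holo c) l *
        ∫⁻ t : ℂ, ‖t‖ₑ ^ (2 * l) * (ENNReal.ofReal (Real.exp (-(2 * ‖t‖ ^ 2))) * W (2 * ‖t‖))) := by
  -- A radial weight does not see the rotation, so the average only produces the factor 2π, which
  -- cancels.
  have h := lintegral_pair_average hc (G := fun z => W ‖z‖) (by fun_prop)
  have e1 : ∀ (θ : ℝ) (z : ℂ), ‖Complex.exp (-(θ * Complex.I)) * z‖ = ‖z‖ := by
    intro θ z
    rw [norm_mul, ← neg_mul, ← Complex.ofReal_neg, Complex.norm_exp_ofReal_mul_I, one_mul]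
  simp only [e1, norm_mul, Complex.norm_ofNat, lintegral_const, Measure.restrict_apply_univ,
    Real.volume_Ioo] at h
  rw [show Real.pi - -Real.pi = 2 * Real.pi by ring, mul_comm] at h
  exact (ENNReal.mul_right_inj (by simp [Real.pi_pos]) (by finiteness)).1 h

/-! ### Moments of an oscillating Gaussian -/

/-- The moment integrals of an oscillating Gaussian. -/
noncomputable def gmom (b : ℝ) (n : ℕ) : ℂ :=
  ∫ x : ℝ, (x : ℂ) ^ n * Complex.exp (b * Complex.I * x - 2 * x ^ 2)

lemma norm_gmom_integrand (b : ℝ) (n : ℕ) (x : ℝ) :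
    ‖(x : ℂ) ^ n * Complex.exp (b * Complex.I * x - 2 * x ^ 2)‖ =
      ‖x ^ n * Real.exp (-2 * x ^ 2)‖ := by
  rw [norm_mul, norm_pow, Complex.norm_real, Complex.norm_exp, norm_mul, norm_pow,
    Real.norm_of_nonneg (Real.exp_nonneg _)]
  congr 2
  have : (b : ℂ) * Complex.I * x - 2 * x ^ 2 = ((-2 * x ^ 2 : ℝ) : ℂ) + ((b * x : ℝ) : ℂ) * Complex.I := by
    push_cast; ring
  rw [this]
  simp [-Complex.ofReal_pow, -Complex.ofReal_mul]

lemma integrable_gmom (b : ℝ) (n : ℕ) :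
    Integrable fun x : ℝ => (x : ℂ) ^ n * Complex.exp (b * Complex.I * x - 2 * x ^ 2) := by
  have h : Integrable fun x : ℝ => x ^ n * Real.exp (-2 * x ^ 2) := by
    have := integrable_rpow_mul_exp_neg_mul_sq (b := 2) two_pos (s := n)
      (by linarith [(Nat.cast_nonneg n : (0:ℝ) ≤ n)])
    simpa using this
  exact h.congr' (by fun_prop) (Filter.Eventually.of_forall fun x =>
    (norm_gmom_integrand b n x).symm)

/-- Integration of a total derivative over the line. -/
lemma gmom_rec (b : ℝ) (n : ℕ) :
    4 * gmom b (n + 1) = n * gmom b (n - 1) + b * Complex.I * gmom b n := by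
  have hd : ∀ x : ℝ, HasDerivAt
      (fun x : ℝ => (x : ℂ) ^ n * Complex.exp (b * Complex.I * x - 2 * x ^ 2))
      (n * ((x : ℂ) ^ (n - 1) * Complex.exp (b * Complex.I * x - 2 * x ^ 2)) +
        b * Complex.I * ((x : ℂ) ^ n * Complex.exp (b * Complex.I * x - 2 * x ^ 2)) -
        4 * ((x : ℂ) ^ (n + 1) * Complex.exp (b * Complex.I * x - 2 * x ^ 2))) x := by
    intro x
    have hx : HasDerivAt (fun x : ℝ => (x : ℂ)) 1 x := Complex.ofRealCLM.hasDerivAt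
    have h2 := (((hx.const_mul ((b : ℂ) * Complex.I)).sub ((hx.pow 2).const_mul 2))).cexp
    refine ((hx.pow n).mul h2).congr_deriv ?_
    simp
    ring
  have h0 := integrable_gmom b n
  have h1 := integrable_gmom b (n - 1)
  have h2 := integrable_gmom b (n + 1)
  have h3 : Integrable fun x : ℝ =>
      n * ((x : ℂ) ^ (n - 1) * Complex.exp (b * Complex.I * x - 2 * x ^ 2)) +
        b * Complex.I * ((x : ℂ) ^ n * Complex.exp (b * Complex.I * x - 2 * x ^ 2)) :=
    (h1.const_mul _).add (h0.const_mul _)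
  have := integral_eq_zero_of_hasDerivAt_of_integrable hd (h3.sub (h2.const_mul _)) h0
  rw [integral_sub h3 (h2.const_mul _), integral_add (h1.const_mul _) (h0.const_mul _), integral_const_mul, integral_const_mul,
    integral_const_mul] at this
  simp only [gmom]
  linear_combination -this

lemma gmom_zero (b : ℝ) :
    gmom b 0 = ((√(Real.pi / 2) * Real.exp (-(b ^ 2 / 8)) : ℝ) : ℂ) := by
  have h := integral_cexp_quadratic (b := -2) (by simp) (b * Complex.I) 0
  have e : ∀ x : ℝ, (x : ℂ) ^ 0 * Complex.exp (b * Complex.I * x - 2 * x ^ 2) =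
      Complex.exp (-2 * x ^ 2 + b * Complex.I * x + 0) := by
    intro x; rw [pow_zero, one_mul]; congr 1; ring
  simp only [gmom, e, h]
  push_cast
  congr 1
  · rw [neg_neg, Real.sqrt_eq_rpow, Complex.ofReal_cpow (by positivity)]
    push_cast
    norm_num
  · congr 1
    rw [mul_pow, Complex.I_sq]
    ring

lemma gmom_two (b : ℝ) : gmom b 2 = (1 / 4 - b ^ 2 / 16) * gmom b 0 := by
  have h0 := gmom_rec b 0
  have h1 := gmom_rec b 1
  simp only [zero_add, Nat.cast_zero, zero_mul, Nat.cast_one, Nat.sub_self, one_mul,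
    Nat.reduceAdd] at h0 h1
  linear_combination h1 / 4 + b * Complex.I / 16 * h0 + b ^ 2 / 16 * gmom b 0 * Complex.I_sq

lemma gmom_four (b : ℝ) : gmom b 4 = (3 / 16 - 3 * b ^ 2 / 32 + b ^ 4 / 256) * gmom b 0 := by
  have h0 := gmom_rec b 0
  have h2 := gmom_rec b 2
  have h3 := gmom_rec b 3
  simp only [zero_add, Nat.cast_zero, zero_mul, Nat.reduceAdd, Nat.reduceSub,
    Nat.cast_ofNat] at h0 h2 h3
  have e2 := gmom_two b
  linear_combination h3 / 4 + b * Complex.I / 16 * h2 + (3 / 4 + (b * Complex.I) ^ 2 / 16) * e2 +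
    (2 * b * Complex.I / 64) * h0 + ((2 * b ^ 2 / 64 + b ^ 2 / 64 - b ^ 4 / 256 ) * gmom b 0) * Complex.I_sq

lemma integral_re_mul_im (p q : ℝ → ℂ) :
    ∫ z : ℂ, p z.re * q z.im = (∫ x, p x) * ∫ y, q y := by
  rw [← integral_prod_mul, ← Measure.volume_eq_prod,
    ← Complex.volume_preserving_equiv_real_prod.integral_comp
      Complex.measurableEquivRealProd.measurableEmbedding]
  simp

lemma integrable_re_mul_im {p q : ℝ → ℂ} (hp : Integrable p) (hq : Integrable q) :
    Integrable fun z : ℂ => p z.re * q z.im := by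
  have h := hp.mul_prod hq
  rw [← Measure.volume_eq_prod] at h
  exact Complex.volume_preserving_equiv_real_prod.integrable_comp_of_integrable h

lemma exp_split (z : ℂ) : Complex.exp (4 * Complex.I * z.re - 2 * ‖z‖ ^ 2) =
    Complex.exp (((4 : ℝ) : ℂ) * Complex.I * z.re - 2 * z.re ^ 2) *
      Complex.exp (((0 : ℝ) : ℂ) * Complex.I * z.im - 2 * z.im ^ 2) := by
  rw [← Complex.exp_add]
  congr 1
  have : (‖z‖ : ℂ) ^ 2 = (z.re : ℂ) ^ 2 + (z.im : ℂ) ^ 2 := by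
    rw [← Complex.ofReal_pow, ← Complex.normSq_eq_norm_sq, Complex.normSq_apply]
    push_cast; ring
  rw [this]
  push_cast
  ring

lemma gmom_four_zero_mul : gmom 4 0 * gmom 0 0 = ((Real.pi / 2 * Real.exp (-2) : ℝ) : ℂ) := by
  rw [gmom_zero, gmom_zero, ← Complex.ofReal_mul]
  congr 1
  rw [mul_mul_mul_comm, Real.mul_self_sqrt (by positivity), ← Real.exp_add]
  norm_num

lemma integral_osc_zero : ∫ z : ℂ, Complex.exp (4 * Complex.I * z.re - 2 * ‖z‖ ^ 2) =
    ((Real.pi / 2 * Real.exp (-2) : ℝ) : ℂ) := by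
  simp only [exp_split]
  rw [integral_re_mul_im (fun x => Complex.exp (((4 : ℝ) : ℂ) * Complex.I * x - 2 * x ^ 2))
    (fun y => Complex.exp (((0 : ℝ) : ℂ) * Complex.I * y - 2 * y ^ 2)), ← gmom_four_zero_mul]
  simp only [gmom, pow_zero, one_mul]

lemma integral_osc_four :
    ∫ z : ℂ, (‖z‖ : ℂ) ^ 4 * Complex.exp (4 * Complex.I * z.re - 2 * ‖z‖ ^ 2) =
      ((-(Real.pi / 4 * Real.exp (-2)) : ℝ) : ℂ) := by
  set F : ℕ → ℝ → ℂ := fun n x => (x : ℂ) ^ n *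
    Complex.exp (((4 : ℝ) : ℂ) * Complex.I * x - 2 * x ^ 2) with hF
  set G : ℕ → ℝ → ℂ := fun n x => (x : ℂ) ^ n *
    Complex.exp (((0 : ℝ) : ℂ) * Complex.I * x - 2 * x ^ 2) with hG
  have e : ∀ z : ℂ, (‖z‖ : ℂ) ^ 4 * Complex.exp (4 * Complex.I * z.re - 2 * ‖z‖ ^ 2) =
      F 4 z.re * G 0 z.im + 2 * (F 2 z.re * G 2 z.im) + F 0 z.re * G 4 z.im := by
    intro z
    have h4 : (‖z‖ : ℂ) ^ 4 = ((z.re : ℂ) ^ 2 + (z.im : ℂ) ^ 2) ^ 2 := by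
      rw [show 4 = 2 * 2 from rfl, pow_mul, ← Complex.ofReal_pow, ← Complex.normSq_eq_norm_sq,
        Complex.normSq_apply]
      push_cast; ring
    rw [exp_split, h4]
    simp only [hF, hG]
    ring
  have hi : ∀ m n, Integrable fun z : ℂ => F m z.re * G n z.im := fun m n =>
    integrable_re_mul_im (integrable_gmom 4 m) (integrable_gmom 0 n)
  have hv : ∀ m n, ∫ z : ℂ, F m z.re * G n z.im = gmom 4 m * gmom 0 n := fun m n =>
    integral_re_mul_im (F m) (G n)
  have hi2 : Integrable fun z : ℂ => F 4 z.re * G 0 z.im + 2 * (F 2 z.re * G 2 z.im) :=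
    (hi 4 0).add ((hi 2 2).const_mul 2)
  simp only [e]
  rw [integral_add hi2 (hi 0 4), integral_add (hi 4 0) ((hi 2 2).const_mul 2),
    integral_const_mul, hv, hv, hv, gmom_four, gmom_four, gmom_two, gmom_two]
  have := gmom_four_zero_mul
  push_cast at this ⊢
  linear_combination (-1 / 2) * this

/-- The moments of the oscillating weight `1 + cos (4 Re t)`. -/
noncomputable def oscMoment (l : ℕ) : ℝ≥0∞ :=
  ∫⁻ t : ℂ, ‖t‖ₑ ^ (2 * l) * (ENNReal.ofReal (Real.exp (-(2 * ‖t‖ ^ 2))) *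
    ENNReal.ofReal (1 + Real.cos (2 * (2 * t).re)))

/-- The cosine is the real part of e^{4i Re t}, so the moment is the plain Gaussian one plus the
oscillating one. -/
lemma oscMoment_eq (l : ℕ) {x : ℝ}
    (hx : ∫ z : ℂ, (‖z‖ : ℂ) ^ (2 * l) * Complex.exp (4 * Complex.I * z.re - 2 * ‖z‖ ^ 2) = x) :
    oscMoment l = ENNReal.ofReal (Real.pi * l ! / 2 ^ (l + 1) + x) := by
  have h0 := integrable_norm_pow_mul_gaussian (2 * l) (κ := 2) two_pos
  have e : ∀ z : ℂ, ((‖z‖ : ℂ) ^ (2 * l) * Complex.exp (4 * Complex.I * z.re - 2 * ‖z‖ ^ 2)).re =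
      ‖z‖ ^ (2 * l) * Real.exp (-(2 * ‖z‖ ^ 2)) * Real.cos (2 * (2 * z).re) := by
    intro z
    have h1 : (4 : ℂ) * Complex.I * z.re - 2 * ‖z‖ ^ 2 =
        ((-(2 * ‖z‖ ^ 2) : ℝ) : ℂ) + ((2 * (2 * z).re : ℝ) : ℂ) * Complex.I := by
      simp
      ring
    rw [h1, Complex.exp_add, ← Complex.ofReal_exp, ← Complex.ofReal_pow, ← mul_assoc,
      ← Complex.ofReal_mul, Complex.re_ofReal_mul, Complex.exp_ofReal_mul_I_re]
  have hi : Integrable fun z : ℂ =>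
      (‖z‖ : ℂ) ^ (2 * l) * Complex.exp (4 * Complex.I * z.re - 2 * ‖z‖ ^ 2) := by
    refine h0.congr' (by fun_prop) (Filter.Eventually.of_forall fun z => ?_)
    have h1 : (4 : ℂ) * Complex.I * z.re - 2 * ‖z‖ ^ 2 =
        ((-(2 * ‖z‖ ^ 2) : ℝ) : ℂ) + ((4 * z.re : ℝ) : ℂ) * Complex.I := by
      push_cast
      ring
    rw [h1, Complex.exp_add, norm_mul, norm_mul, norm_mul, Complex.norm_exp_ofReal_mul_I,
      ← Complex.ofReal_exp, Complex.norm_real, ← Complex.ofReal_pow, Complex.norm_real, mul_one]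
  have hre := hi.re
  have hI := integral_re hi
  rw [hx] at hI
  simp only [RCLike.re_to_complex, e, Complex.ofReal_re] at hre hI
  have hs : Integrable fun z : ℂ => ‖z‖ ^ (2 * l) * Real.exp (-(2 * ‖z‖ ^ 2)) +
      ‖z‖ ^ (2 * l) * Real.exp (-(2 * ‖z‖ ^ 2)) * Real.cos (2 * (2 * z).re) := h0.add hre
  rw [← integral_norm_pow_mul_gaussian l (κ := 2) two_pos, ← hI, ← integral_add h0 hre,
    ofReal_integral_eq_lintegral_ofReal hs]
  · refine lintegral_congr fun z => ?_
    rw [← ofReal_norm, ← ENNReal.ofReal_pow (norm_nonneg _), ← ENNReal.ofReal_mul (by positivity),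
      ← ENNReal.ofReal_mul (by positivity)]
    congr 1
    ring
  · refine Filter.Eventually.of_forall fun z => ?_
    simp only [Pi.zero_apply]
    have h1 := Real.neg_one_le_cos (2 * (2 * z).re)
    have h2 : 0 ≤ ‖z‖ ^ (2 * l) * Real.exp (-(2 * ‖z‖ ^ 2)) := by positivity
    nlinarith

lemma oscMoment_zero : oscMoment 0 = ENNReal.ofReal (Real.pi / 2 * (1 + Real.exp (-2))) := by
  rw [oscMoment_eq 0 (x := Real.pi / 2 * Real.exp (-2))
    (by simpa using integral_osc_zero)]
  congr 1
  simp
  ring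

/-- Relative to the plain moment πl!/2^{l+1} the oscillating part is L_l(2)e^{-2}, with L_l the
Laguerre polynomial. The frequency is chosen so that this is -e^{-2} for l = 2 against +e^{-2} for l
= 0. -/
lemma oscMoment_two : oscMoment 2 = ENNReal.ofReal (Real.pi / 4 * (1 - Real.exp (-2))) := by
  rw [oscMoment_eq 2 (x := -(Real.pi / 4 * Real.exp (-2))) (by simpa using integral_osc_four)]
  congr 1
  norm_num
  ring

lemma oscMoment_le (l : ℕ) : oscMoment l ≤ 2 * ENNReal.ofReal (Real.pi * l ! / 2 ^ (l + 1)) := by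
  rw [← lintegral_norm_pow_mul_gaussian l (κ := 2) two_pos, ← lintegral_const_mul' _ _ (by finiteness)]
  refine lintegral_mono fun t => ?_
  have : ENNReal.ofReal (1 + Real.cos (2 * (2 * t).re)) ≤ 2 := by
    rw [show (2 : ℝ≥0∞) = ENNReal.ofReal 2 by simp]
    exact ENNReal.ofReal_le_ofReal (by linarith [Real.cos_le_one (2 * (2 * t).re)])
  calc _ ≤ ‖t‖ₑ ^ (2 * l) * (ENNReal.ofReal (Real.exp (-(2 * ‖t‖ ^ 2))) * 2) := by gcongr
    _ = _ := by ring

/-! ### Weights of the relative components -/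

/-- The mass of the `l`-th relative component. -/
noncomputable def relMass (c : ℕ → ℂ) (l : ℕ) : ℝ≥0∞ :=
  4 * (relNorm (holo c) l * ENNReal.ofReal (Real.pi * l ! / 2 ^ (l + 1)))

/-- The dipole moment `∫ z |u|²`. -/
noncomputable def dipole (u : ℂ → ℂ) : ℂ := ∫ z, z * ((‖u z‖ ^ 2 : ℝ) : ℂ)

lemma lintegral_enorm_sq_mul {u : ℂ → ℂ} {g : ℂ → ℝ} (hg : ∀ z, 0 ≤ g z)
    (hi : Integrable fun z => ‖u z‖ ^ 2 * g z) :
    ∫⁻ z, ‖u z‖ₑ ^ 2 * ENNReal.ofReal (g z) = ENNReal.ofReal (∫ z, ‖u z‖ ^ 2 * g z) := by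
  rw [ofReal_integral_eq_lintegral_ofReal hi
    (Filter.Eventually.of_forall fun z => mul_nonneg (by positivity) (hg z))]
  refine lintegral_congr fun z => ?_
  rw [ENNReal.ofReal_mul (by positivity), ENNReal.ofReal_pow (norm_nonneg _), ofReal_norm]

/-- The radial two-particle identity with weight one. -/
lemma tsum_relMass {c : ℕ → ℂ} (hc : SqSummable c) :
    ∑' l, relMass c l = ENNReal.ofReal (msq c ^ 2) := by
  have h := lintegral_pair_radial hc (W := fun _ => 1) measurable_const
  simp only [mul_one, lintegral_norm_pow_mul_gaussian _ two_pos] at h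
  have hm := hc.continuous_wave
  have h1 : ∀ z, ∫⁻ w, ‖wave c z‖ₑ ^ 2 * ‖wave c w‖ₑ ^ 2 =
      ‖wave c z‖ₑ ^ 2 * ENNReal.ofReal (msq c) := fun z => by
    rw [lintegral_const_mul _ (by fun_prop), lintegral_wave hc, tsum_enorm_sq hc, msq]
  simp only [h1] at h
  rw [lintegral_mul_const _ (by fun_prop), lintegral_wave hc, tsum_enorm_sq hc, ← msq,
    ← ENNReal.ofReal_mul (show 0 ≤ msq c from tsum_nonneg fun _ => by positivity), ← sq] at h
  exact h.symm

lemma relMass_ne_top {c : ℕ → ℂ} (hc : SqSummable c) (l : ℕ) : relMass c l ≠ ∞ :=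
  ne_top_of_le_ne_top (by rw [tsum_relMass hc]; exact ENNReal.ofReal_ne_top) (ENNReal.le_tsum l)

/-- The mass of the `l`-th relative component, as a real number. -/
noncomputable def relWeight (c : ℕ → ℂ) (l : ℕ) : ℝ := (relMass c l).toReal

lemma relWeight_nonneg (c : ℕ → ℂ) (l : ℕ) : 0 ≤ relWeight c l := ENNReal.toReal_nonneg

lemma ofReal_relWeight {c : ℕ → ℂ} (hc : SqSummable c) (l : ℕ) :
    ENNReal.ofReal (relWeight c l) = relMass c l := ENNReal.ofReal_toReal (relMass_ne_top hc l)

lemma hasSum_of_tsum_ofReal {b : ℕ → ℝ} (hb : ∀ n, 0 ≤ b n) {x : ℝ} (hx : 0 ≤ x)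
    (h : ∑' n, ENNReal.ofReal (b n) = ENNReal.ofReal x) : HasSum b x := by
  have h1 : Summable fun n => (ENNReal.ofReal (b n)).toReal :=
    ENNReal.summable_toReal (by rw [h]; exact ENNReal.ofReal_ne_top)
  simp only [ENNReal.toReal_ofReal (hb _)] at h1
  rw [← ENNReal.ofReal_tsum_of_nonneg hb h1,
    ENNReal.ofReal_eq_ofReal_iff (tsum_nonneg hb) hx] at h
  exact h ▸ h1.hasSum

lemma msq_nonneg (c : ℕ → ℂ) : 0 ≤ msq c := tsum_nonneg fun _ => by positivity

lemma hasSum_relWeight {c : ℕ → ℂ} (hc : SqSummable c) : HasSum (relWeight c) (msq c ^ 2) := by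
  refine hasSum_of_tsum_ofReal (relWeight_nonneg c) (by positivity) ?_
  simp only [ofReal_relWeight hc, tsum_relMass hc]

lemma relWeight_odd (c : ℕ → ℂ) {l : ℕ} (hl : Odd l) : relWeight c l = 0 := by
  simp [relWeight, relMass, relNorm, pairCoef_odd _ hl]

/-- The component l = 0 is f(s)², whose Gaussian norm is the interaction energy. -/
lemma relWeight_zero {c : ℕ → ℂ} (hc : SqSummable c) : relWeight c 0 = en c := by
  have h := lintegral_wave_four hc
  have e : ∀ z, ‖wave c z‖ₑ ^ 4 =
      ‖holo c z ^ 2‖ₑ ^ 2 * ENNReal.ofReal (Real.exp (-(2 * ‖z‖ ^ 2))) := by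
    intro z
    rw [show 4 = 2 * 2 from rfl, pow_mul, enorm_wave_sq, mul_pow, enorm_pow,
      ← ENNReal.ofReal_pow (by positivity), ← Real.exp_nat_mul]
    congr 3
    push_cast; ring
  simp only [e] at h
  rw [tsum_enorm_sq (hc.bil hc), ← msq, ← en] at h
  rw [relWeight, relMass, relNorm]
  simp only [pairCoef_zero]
  have h4 : (4 : ℝ≥0∞) * ENNReal.ofReal (Real.pi * 0 ! / 2 ^ (0 + 1)) =
      ENNReal.ofReal (2 * Real.pi) := by
    rw [show (4 : ℝ≥0∞) = ENNReal.ofReal 4 by simp, ← ENNReal.ofReal_mul (by norm_num)]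
    congr 1
    simp
    ring
  rw [mul_left_comm, h4, mul_comm, h, ENNReal.toReal_ofReal (show 0 ≤ en c from msq_nonneg _)]

lemma pairCoef_eq_zero {c : ℕ → ℂ} (hc : SqSummable c) {l : ℕ} (h : relWeight c l = 0) :
    pairCoef (holo c) l = 0 := by
  have hcont := continuous_pairCoef hc.isEntireSeries.differentiable l
  rw [relWeight, ENNReal.toReal_eq_zero_iff, or_iff_left (relMass_ne_top hc l), relMass,
    mul_eq_zero, or_iff_right (by norm_num), mul_eq_zero,
    or_iff_left (by rw [ENNReal.ofReal_eq_zero, not_le]; positivity), relNorm,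
    lintegral_eq_zero_iff (by fun_prop)] at h
  refine (hcont.ae_eq_iff_eq volume continuous_const).1 ?_
  filter_upwards [h] with s hs
  simp only [Pi.zero_apply, mul_eq_zero, ENNReal.ofReal_eq_zero, not_le.2 (Real.exp_pos _),
    or_false] at hs
  exact enorm_eq_zero.1 (pow_eq_zero_iff two_ne_zero |>.1 hs)

lemma relWeight_eq_zero {c : ℕ → ℂ} {l : ℕ} (h : pairCoef (holo c) l = 0) :
    relWeight c l = 0 := by
  simp [relWeight, relMass, relNorm, h]

lemma norm_sub_sq_complex (z a : ℂ) :
    ‖z - a‖ ^ 2 = ‖z‖ ^ 2 - 2 * ((starRingEnd ℂ) a * z).re + ‖a‖ ^ 2 := by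
  simp only [← Complex.normSq_eq_norm_sq, Complex.normSq_apply]
  simp
  ring

lemma WSummable.integrable_norm_sq {c : ℕ → ℂ} (hc : WSummable c) :
    Integrable fun z => ‖z‖ ^ 2 * ‖wave c z‖ ^ 2 := by
  have := (integrable_shift hc.sq (hc.shift 0)).1
  simpa [mul_pow] using this

lemma WSummable.integrable_dipole {c : ℕ → ℂ} (hc : WSummable c) :
    Integrable fun z => z * ((‖wave c z‖ ^ 2 : ℝ) : ℂ) := by
  have hcont := hc.sq.continuous_wave
  refine (hc.sq.integrable_wave.1.add hc.integrable_norm_sq).mono' (by fun_prop)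
    (Filter.Eventually.of_forall fun z => ?_)
  rw [norm_mul, Complex.norm_real, Real.norm_of_nonneg (by positivity)]
  simp only [Pi.add_apply]
  nlinarith [sq_nonneg (‖z‖ - 1), sq_nonneg ‖wave c z‖, norm_nonneg z,
    mul_nonneg (sq_nonneg (‖z‖ - 1)) (sq_nonneg ‖wave c z‖)]

lemma WSummable.integrable_re_dipole {c : ℕ → ℂ} (hc : WSummable c) (a : ℂ) :
    Integrable (fun z => ((starRingEnd ℂ) a * z).re * ‖wave c z‖ ^ 2) ∧
      ∫ z, ((starRingEnd ℂ) a * z).re * ‖wave c z‖ ^ 2 =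
        ((starRingEnd ℂ) a * dipole (wave c)).re := by
  have h := hc.integrable_dipole.const_mul ((starRingEnd ℂ) a)
  have e : ∀ z, ((starRingEnd ℂ) a * (z * ((‖wave c z‖ ^ 2 : ℝ) : ℂ))).re =
      ((starRingEnd ℂ) a * z).re * ‖wave c z‖ ^ 2 := by
    intro z
    rw [← mul_assoc, mul_comm, Complex.re_ofReal_mul, mul_comm]
  have h1 := h.re
  have h2 := integral_re h
  rw [integral_const_mul] at h2
  simp only [RCLike.re_to_complex, e] at h1 h2
  exact ⟨h1, h2⟩

lemma kin_eq {c : ℕ → ℂ} (hc : WSummable c) (a : ℂ) :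
    kin a c = kin 0 c - 2 * ((starRingEnd ℂ) a * dipole (wave c)).re + ‖a‖ ^ 2 * msq c := by
  have h1 := integrable_shift hc.sq (hc.shift a)
  have h0 := integrable_shift hc.sq (hc.shift 0)
  have hr := hc.integrable_re_dipole a
  have hm := hc.sq.integrable_wave
  rw [kin, kin, msq, msq, msq, ← h1.2, ← h0.2, ← hr.2, ← hm.2, ← integral_const_mul,
    ← integral_const_mul, ← integral_sub h0.1 (hr.1.const_mul 2)]
  rw [← integral_add (f := fun z => ‖(z - 0) * wave c z‖ ^ 2 -
    2 * (((starRingEnd ℂ) a * z).re * ‖wave c z‖ ^ 2)) (h0.1.sub (hr.1.const_mul 2))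
    (hm.1.const_mul _)]
  refine integral_congr_ae (Filter.Eventually.of_forall fun z => ?_)
  simp only [norm_mul, mul_pow, norm_sub_sq_complex z a, sub_zero]
  ring

/-- The radial two-particle identity with weight |z-w|² = 4|t|². The left side is 2(∫|z|²|u|²·M -
|Q|²) and the component l contributes 2(l+1)w_l; halve and subtract the total mass. -/
lemma hasSum_mul_relWeight {c : ℕ → ℂ} (hc : WSummable c) :
    HasSum (fun l : ℕ => l * relWeight c l)
      ((kin 0 c - msq c) * msq c - ‖dipole (wave c)‖ ^ 2) := by
  set Q := dipole (wave c) with hQ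
  have hcont := hc.sq.continuous_wave
  have h := lintegral_pair_radial hc.sq (W := fun r => ENNReal.ofReal (r ^ 2)) (by fun_prop)
  have hin : ∀ z, ∫⁻ w, ‖wave c z‖ₑ ^ 2 * ‖wave c w‖ₑ ^ 2 * ENNReal.ofReal (‖z - w‖ ^ 2) =
      ‖wave c z‖ₑ ^ 2 * ENNReal.ofReal (kin z c) := by
    intro z
    have e : ∀ w, ‖wave c z‖ₑ ^ 2 * ‖wave c w‖ₑ ^ 2 * ENNReal.ofReal (‖z - w‖ ^ 2) =
        ‖wave c z‖ₑ ^ 2 * (‖w - z‖ₑ ^ 2 * ‖wave c w‖ₑ ^ 2) := by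
      intro w
      rw [ENNReal.ofReal_pow (norm_nonneg _), norm_sub_rev, ofReal_norm]
      ring
    simp only [e]
    rw [lintegral_const_mul _ (by fun_prop), lintegral_shift z hc.sq, tsum_enorm_sq (hc.shift z)]
    rfl
  simp only [hin] at h
  have hr := hc.integrable_re_dipole Q
  have hm := hc.sq.integrable_wave
  have h0 := integrable_shift hc.sq (hc.shift 0)
  have ee : ∀ z, ‖wave c z‖ ^ 2 * kin z c = kin 0 c * ‖wave c z‖ ^ 2 -
      2 * (((starRingEnd ℂ) Q * z).re * ‖wave c z‖ ^ 2) +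
      msq c * ‖(z - 0) * wave c z‖ ^ 2 := by
    intro z
    rw [kin_eq hc z, norm_mul, sub_zero, ← hQ]
    have : ((starRingEnd ℂ) z * Q).re = ((starRingEnd ℂ) Q * z).re := by
      simp; ring
    rw [this]
    ring
  have hi1 : Integrable fun z => kin 0 c * ‖wave c z‖ ^ 2 -
      2 * (((starRingEnd ℂ) Q * z).re * ‖wave c z‖ ^ 2) :=
    (hm.1.const_mul _).sub (hr.1.const_mul 2)
  have hI : ∫ z, ‖wave c z‖ ^ 2 * kin z c = 2 * (kin 0 c * msq c - ‖Q‖ ^ 2) := by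
    simp only [ee]
    rw [integral_add hi1 (h0.1.const_mul _), integral_sub (hm.1.const_mul _) (hr.1.const_mul 2),
      integral_const_mul, integral_const_mul, integral_const_mul, hm.2, h0.2, hr.2, ← hQ,
      ← msq, ← msq, ← kin]
    have : ((starRingEnd ℂ) Q * Q).re = ‖Q‖ ^ 2 := by
      rw [← Complex.normSq_eq_conj_mul_self, Complex.ofReal_re, Complex.normSq_eq_norm_sq]
    rw [this]
    ring
  have hint : Integrable fun z => ‖wave c z‖ ^ 2 * kin z c := by
    simp only [ee]
    exact hi1.add (h0.1.const_mul _)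
  have hI0 : 0 ≤ ∫ z, ‖wave c z‖ ^ 2 * kin z c :=
    integral_nonneg fun z => mul_nonneg (by positivity) (msq_nonneg _)
  rw [lintegral_enorm_sq_mul (g := fun z => kin z c) (fun z => msq_nonneg _) hint, hI] at h
  rw [hI] at hI0
  have hW : ∀ l : ℕ, 4 * (relNorm (holo c) l * ∫⁻ t : ℂ, ‖t‖ₑ ^ (2 * l) *
      (ENNReal.ofReal (Real.exp (-(2 * ‖t‖ ^ 2))) * ENNReal.ofReal ((2 * ‖t‖) ^ 2))) =
      ENNReal.ofReal (2 * (l + 1) * relWeight c l) := by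
    intro l
    have e : ∀ t : ℂ, ‖t‖ₑ ^ (2 * l) * (ENNReal.ofReal (Real.exp (-(2 * ‖t‖ ^ 2))) *
        ENNReal.ofReal ((2 * ‖t‖) ^ 2)) = 4 * (‖t‖ₑ ^ (2 * (l + 1)) *
          ENNReal.ofReal (Real.exp (-(2 * ‖t‖ ^ 2)))) := by
      intro t
      rw [mul_pow, ENNReal.ofReal_mul (by positivity), ENNReal.ofReal_pow (norm_nonneg _),
        ofReal_norm, show ENNReal.ofReal (2 ^ 2) = 4 by norm_num]
      ring
    simp only [e]
    rw [lintegral_const_mul' _ _ (by finiteness), lintegral_norm_pow_mul_gaussian _ two_pos,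
      ENNReal.ofReal_mul (by positivity), ofReal_relWeight hc.sq, relMass]
    have e2 : 4 * ENNReal.ofReal (Real.pi * (l + 1) ! / 2 ^ (l + 1 + 1)) =
        ENNReal.ofReal (2 * (l + 1)) * ENNReal.ofReal (Real.pi * l ! / 2 ^ (l + 1)) := by
      rw [show (4 : ℝ≥0∞) = ENNReal.ofReal 4 by simp, ← ENNReal.ofReal_mul (by norm_num),
        ← ENNReal.ofReal_mul (by positivity)]
      congr 1
      rw [Nat.factorial_succ, pow_succ 2 (l + 1)]
      push_cast
      field_simp
      norm_num
    rw [e2]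
    ring
  simp only [hW] at h
  have h2 := hasSum_of_tsum_ofReal (fun l => mul_nonneg (by positivity) (relWeight_nonneg c l))
    hI0 h.symm
  have h3 := (h2.mul_left (1 / 2)).sub (hasSum_relWeight hc.sq)
  have e3 : 1 / 2 * (2 * (kin 0 c * msq c - ‖Q‖ ^ 2)) - msq c ^ 2 =
      (kin 0 c - msq c) * msq c - ‖Q‖ ^ 2 := by ring
  rw [e3] at h3
  refine h3.congr_fun ?_ |> id
  intro l
  ring

/-- Positivity of the oscillating two-particle integral. -/
lemma le_lintegral_pair_osc {c : ℕ → ℂ} (hc : SqSummable c) (e : ℂ) :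
    ENNReal.ofReal (msq c ^ 2) ≤ ∫⁻ z, ∫⁻ w, ‖wave c z‖ₑ ^ 2 * ‖wave c w‖ₑ ^ 2 *
      ENNReal.ofReal (1 + Real.cos (2 * (e * (z - w)).re)) := by
  have hcont := hc.continuous_wave
  have hm := hc.integrable_wave
  set X : ℂ → ℝ := fun z => 2 * (e * z).re with hX
  have hXc : Continuous X := by fun_prop
  have hiC : Integrable fun z => ‖wave c z‖ ^ 2 * Real.cos (X z) := by
    refine hm.1.mono' (by fun_prop) (Filter.Eventually.of_forall fun z => ?_)
    rw [norm_mul, Real.norm_of_nonneg (by positivity)]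
    exact mul_le_of_le_one_right (by positivity) (Real.abs_cos_le_one _)
  have hiS : Integrable fun z => ‖wave c z‖ ^ 2 * Real.sin (X z) := by
    refine hm.1.mono' (by fun_prop) (Filter.Eventually.of_forall fun z => ?_)
    rw [norm_mul, Real.norm_of_nonneg (by positivity)]
    exact mul_le_of_le_one_right (by positivity) (Real.abs_sin_le_one _)
  set C := ∫ z, ‖wave c z‖ ^ 2 * Real.cos (X z)
  set S := ∫ z, ‖wave c z‖ ^ 2 * Real.sin (X z)
  have key : ∀ p q r : ℝ, (Integrable fun z => ‖wave c z‖ ^ 2 *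
      (p + (Real.cos (X z) * q + Real.sin (X z) * r))) ∧
      ∫ z, ‖wave c z‖ ^ 2 * (p + (Real.cos (X z) * q + Real.sin (X z) * r)) =
        p * msq c + (q * C + r * S) := by
    intro p q r
    have ee : ∀ z, ‖wave c z‖ ^ 2 * (p + (Real.cos (X z) * q + Real.sin (X z) * r)) =
        p * ‖wave c z‖ ^ 2 + (q * (‖wave c z‖ ^ 2 * Real.cos (X z)) +
          r * (‖wave c z‖ ^ 2 * Real.sin (X z))) := fun z => by ring
    have i2 : Integrable fun z => q * (‖wave c z‖ ^ 2 * Real.cos (X z)) +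
          r * (‖wave c z‖ ^ 2 * Real.sin (X z)) := (hiC.const_mul q).add (hiS.const_mul r)
    simp only [ee]
    refine ⟨(hm.1.const_mul p).add i2, ?_⟩
    rw [integral_add (hm.1.const_mul p) i2, integral_add (hiC.const_mul q) (hiS.const_mul r),
      integral_const_mul, integral_const_mul, integral_const_mul, hm.2, ← msq]
  have hcos : ∀ z w, Real.cos (2 * (e * (z - w)).re) =
      Real.cos (X w) * Real.cos (X z) + Real.sin (X w) * Real.sin (X z) := by
    intro z w
    rw [mul_sub, Complex.sub_re, mul_sub, Real.cos_sub]
    ring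
  have hin : ∀ z, ∫⁻ w, ‖wave c z‖ₑ ^ 2 * ‖wave c w‖ₑ ^ 2 *
      ENNReal.ofReal (1 + Real.cos (2 * (e * (z - w)).re)) = ‖wave c z‖ₑ ^ 2 *
        ENNReal.ofReal (msq c + (Real.cos (X z) * C + Real.sin (X z) * S)) := by
    intro z
    simp only [mul_assoc]
    rw [lintegral_const_mul _ (by fun_prop)]
    have h1 := key 1 (Real.cos (X z)) (Real.sin (X z))
    simp only [hcos]
    rw [lintegral_enorm_sq_mul (fun w => ?_) h1.1, h1.2, one_mul]
    rw [← hcos]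
    linarith [Real.neg_one_le_cos (2 * (e * (z - w)).re)]
  simp only [hin]
  have h2 := key (msq c) C S
  rw [lintegral_enorm_sq_mul (fun z => ?_) h2.1, h2.2]
  · refine ENNReal.ofReal_le_ofReal ?_
    -- The excess over M² is C² + S², the squared modulus of a Fourier coefficient of |u|².
    nlinarith [mul_self_nonneg C, mul_self_nonneg S]
  · have h1 := key 1 (Real.cos (X z)) (Real.sin (X z))
    rw [one_mul] at h1
    rw [← h1.2]
    refine integral_nonneg fun w => mul_nonneg (by positivity) ?_
    rw [← hcos]
    linarith [Real.neg_one_le_cos (2 * (e * (z - w)).re)]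

/-- Averaging the positivity over all directions of the frequency makes it diagonal in the relative
components. -/
lemma le_tsum_oscMoment {c : ℕ → ℂ} (hc : SqSummable c) :
    ENNReal.ofReal (msq c ^ 2) ≤ ∑' l, 4 * (relNorm (holo c) l * oscMoment l) := by
  have h := lintegral_pair_average hc
    (G := fun z => ENNReal.ofReal (1 + Real.cos (2 * z.re))) (by fun_prop)
  have h1 : ENNReal.ofReal (2 * Real.pi) * ENNReal.ofReal (msq c ^ 2) ≤
      ∫⁻ θ : ℝ in Set.Ioo (-Real.pi) Real.pi, ∫⁻ z, ∫⁻ w, ‖wave c z‖ₑ ^ 2 * ‖wave c w‖ₑ ^ 2 *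
        ENNReal.ofReal (1 + Real.cos (2 * (Complex.exp (-(θ * Complex.I)) * (z - w)).re)) := by
    refine le_trans (le_of_eq ?_) (lintegral_mono fun θ => le_lintegral_pair_osc hc _)
    rw [lintegral_const, Measure.restrict_apply_univ, Real.volume_Ioo, mul_comm]
    congr 2
    ring
  rw [h] at h1
  exact (ENNReal.mul_le_mul_iff_right (by simp [Real.pi_pos]) (by finiteness)).1 h1

/-- The constraint on the first two relative components coming from positivity. -/
lemma relWeight_constraint {c : ℕ → ℂ} (hc : SqSummable c) :
    (1 - Real.exp (-2)) * relWeight c 0 + (1 + Real.exp (-2)) * relWeight c 2 ≤ msq c ^ 2 := by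
  have hexp : Real.exp (-2) ≤ 1 := Real.exp_le_one_iff.2 (by norm_num)
  have h := le_tsum_oscMoment hc
  set ε := Real.exp (-2)
  -- Normalized oscillating moments: exact for l = 0 and l = 2, and bounded by two elsewhere because
  -- 1 + cos ≤ 2.
  set b : ℕ → ℝ := fun l => if l = 0 then 1 + ε else if l = 2 then 1 - ε else 2 with hb
  have hb0 : ∀ l, 0 ≤ b l := by
    intro l
    simp only [hb]
    split_ifs
    · positivity
    · linarith
    · norm_num
  have hbl : ∀ l, 4 * (relNorm (holo c) l * oscMoment l) ≤ ENNReal.ofReal (b l * relWeight c l) := by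
    intro l
    rw [ENNReal.ofReal_mul (hb0 l), ofReal_relWeight hc, relMass]
    have : oscMoment l ≤ ENNReal.ofReal (b l) * ENNReal.ofReal (Real.pi * l ! / 2 ^ (l + 1)) := by
      simp only [hb]
      split_ifs with h0 h2
      · subst h0
        rw [oscMoment_zero, ← ENNReal.ofReal_mul (by positivity)]
        refine le_of_eq (congrArg _ ?_)
        simp
        ring
      · subst h2
        rw [oscMoment_two, ← ENNReal.ofReal_mul (by linarith)]
        refine le_of_eq (congrArg _ ?_)
        norm_num
        ring
      · simpa using oscMoment_le l
    calc _ ≤ 4 * (relNorm (holo c) l * (ENNReal.ofReal (b l) *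
          ENNReal.ofReal (Real.pi * l ! / 2 ^ (l + 1)))) := by gcongr
      _ = _ := by ring
  have hw := hasSum_relWeight hc
  have hsum : HasSum (fun l => b l * relWeight c l)
      (2 * msq c ^ 2 - (1 - ε) * relWeight c 0 - (1 + ε) * relWeight c 2) := by
    have h0 := hasSum_single (f := fun l => if l = 0 then (1 - ε) * relWeight c 0 else 0) 0
      (by intro l hl; simp [hl])
    have h2 := hasSum_single (f := fun l => if l = 2 then (1 + ε) * relWeight c 2 else 0) 2
      (by intro l hl; simp [hl])
    have := ((hw.mul_left 2).sub h0).sub h2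
    simp only [if_true] at this
    refine this.congr_fun ?_ |> id
    intro l
    simp only [hb]
    rcases eq_or_ne l 0 with rfl | h0
    · simp; ring
    · rcases eq_or_ne l 2 with rfl | h2
      · simp; ring
      · simp [h0, h2]
  have h3 := h.trans (ENNReal.tsum_le_tsum hbl)
  have hnn := fun l => mul_nonneg (hb0 l) (relWeight_nonneg c l)
  rw [← ENNReal.ofReal_tsum_of_nonneg hnn hsum.summable, hsum.tsum_eq,
    ENNReal.ofReal_le_ofReal_iff (by rw [← hsum.tsum_eq]; exact tsum_nonneg hnn)] at h3
  linarith

/-! ### Lower bounds for the energy at 1/2 and 5/12 -/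

/-- The coordinate energy at unit mass. -/
noncomputable def coordEnergy (μ : ℝ) (c : ℕ → ℂ) : ℝ := en c + μ * (kin 0 c - msq c)

lemma _root_.HasSum.congr_sum {f : ℕ → ℝ} {x y : ℝ} (h : HasSum f x) (hxy : x = y) : HasSum f y :=
  hxy ▸ h

/-- The terms l = 0 and l = 2 are split off; l = 1 and l = 3 vanish by parity. -/
lemma hasSum_tail {c : ℕ → ℂ} (hc : WSummable c) (hm : msq c = 1) :
    HasSum (fun l : ℕ => (l + 4 : ℕ) * relWeight c (l + 4))
      (kin 0 c - msq c - ‖dipole (wave c)‖ ^ 2 - 2 * relWeight c 2) ∧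
    HasSum (fun l : ℕ => relWeight c (l + 4)) (1 - relWeight c 0 - relWeight c 2) := by
  have h1 := hasSum_mul_relWeight hc
  have h2 := hasSum_relWeight hc.sq
  rw [← hasSum_nat_add_iff' 4] at h1 h2
  have o1 := relWeight_odd c (l := 1) (by decide)
  have o3 := relWeight_odd c (l := 3) (by decide)
  simp only [Finset.sum_range_succ, Finset.sum_range_zero, o1, o3] at h1 h2
  refine ⟨?_, ?_⟩
  · refine h1.congr_sum ?_
    rw [hm]; push_cast; ring
  · refine h2.congr_sum ?_
    rw [hm]; ring

/-- At the parameter one half the energy exceeds one by nonnegative terms. -/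
lemma coordEnergy_half {c : ℕ → ℂ} (hc : WSummable c) (hm : msq c = 1) :
    HasSum (fun l : ℕ => ((l + 2 : ℝ) / 2) * relWeight c (l + 4))
      (coordEnergy (1 / 2) c - 1 - ‖dipole (wave c)‖ ^ 2 / 2) := by
  obtain ⟨h1, h2⟩ := hasSum_tail hc hm
  have h := (h1.mul_left (1 / 2)).sub h2
  rw [relWeight_zero hc.sq] at h
  refine HasSum.congr_sum (h.congr_fun ?_ |> id) ?_
  · intro l; push_cast; ring
  · rw [coordEnergy, hm]; ring

lemma one_le_coordEnergy_half {c : ℕ → ℂ} (hc : WSummable c) (hm : msq c = 1) :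
    1 ≤ coordEnergy (1 / 2) c := by
  have h := (coordEnergy_half hc hm).nonneg
    (fun l => mul_nonneg (by positivity) (relWeight_nonneg c _))
  nlinarith [sq_nonneg ‖dipole (wave c)‖]

lemma coordEnergy_half_eq_one_iff {c : ℕ → ℂ} (hc : WSummable c) (hm : msq c = 1) :
    coordEnergy (1 / 2) c = 1 ↔
      dipole (wave c) = 0 ∧ ∀ l, 4 ≤ l → pairCoef (holo c) l = 0 := by
  have hs := coordEnergy_half hc hm
  have hnn : ∀ l : ℕ, 0 ≤ ((l + 2 : ℝ) / 2) * relWeight c (l + 4) :=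
    fun l => mul_nonneg (by positivity) (relWeight_nonneg c _)
  constructor
  · intro h
    have h0 := hs.nonneg hnn
    rw [h] at hs h0
    have hQ : ‖dipole (wave c)‖ ^ 2 = 0 := by nlinarith [sq_nonneg ‖dipole (wave c)‖]
    rw [hQ] at hs
    norm_num at hs
    have hz := (hasSum_zero_iff_of_nonneg hnn).1 hs
    refine ⟨by simpa using hQ, fun l hl => pairCoef_eq_zero hc.sq ?_⟩
    have := congrFun hz (l - 4)
    simp only [Pi.zero_apply, mul_eq_zero, Nat.sub_add_cancel hl] at this
    exact this.resolve_left (by positivity)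
  · rintro ⟨hQ, hF⟩
    have : (fun l : ℕ => ((l + 2 : ℝ) / 2) * relWeight c (l + 4)) = fun _ => 0 := by
      funext l
      rw [relWeight_eq_zero (hF (l + 4) (by omega)), mul_zero]
    rw [this, hQ] at hs
    have := hs.unique hasSum_zero
    simp at this
    linarith

/-- The energy of `φ₁` is minimal just below one half. -/
lemma le_coordEnergy {c : ℕ → ℂ} (hc : WSummable c) (hm : msq c = 1) :
    1 / 2 + 5 / 12 ≤ coordEnergy (5 / 12) c := by
  obtain ⟨h1, h2⟩ := hasSum_tail hc hm
  have h3 := relWeight_constraint hc.sq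
  -- Every remaining component has l ≥ 4.
  have hle : 4 * (1 - relWeight c 0 - relWeight c 2) ≤
      kin 0 c - msq c - ‖dipole (wave c)‖ ^ 2 - 2 * relWeight c 2 := by
    refine hasSum_le (fun l => ?_) (h2.mul_left 4) h1
    have := relWeight_nonneg c (l + 4)
    push_cast
    nlinarith [mul_nonneg (Nat.cast_nonneg l : (0 : ℝ) ≤ l) this]
  have hT := h2.nonneg (fun l => relWeight_nonneg c _)
  -- With x = w_0 and y = w_2 the energy is at least 5/3 - 2x/3 - 5y/6, and this is at least 11/12
  -- exactly when (1 - 1/9)x + (1 + 1/9)y ≤ 1.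
  have hexp : 1 / 9 ≤ Real.exp (-2) := by
    have he := Real.exp_one_lt_d9
    rw [Real.exp_neg, show (2 : ℝ) = 1 + 1 by norm_num, Real.exp_add, one_div]
    gcongr
    nlinarith [Real.exp_pos 1]
  have hw0 := relWeight_nonneg c 0
  have hw2 := relWeight_nonneg c 2
  rw [hm] at h3 hle
  rw [coordEnergy, ← relWeight_zero hc.sq, hm]
  set x := relWeight c 0
  set y := relWeight c 2
  have hQ := sq_nonneg ‖dipole (wave c)‖
  -- If x ≤ y, replacing e^{-2} by the smaller 1/9 weakens the constraint to the needed one. If y ≤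
  -- x, the total mass x + y ≤ 1 is enough.
  rcases le_total x y with hxy | hxy
  · have h4 : (1 - 1 / 9) * x + (1 + 1 / 9) * y ≤ 1 := by nlinarith
    linarith
  · linarith

/-! ### Magnetic translations -/

lemma kin_eq_lintegral {c : ℕ → ℂ} (hc : WSummable c) (a : ℂ) :
    ENNReal.ofReal (kin a c) = ∫⁻ z, ‖z - a‖ₑ ^ 2 * ‖wave c z‖ₑ ^ 2 := by
  rw [lintegral_shift a hc.sq, tsum_enorm_sq (hc.shift a)]
  rfl

/-- The magnetic translation by `a`. -/
noncomputable def trans (a : ℂ) (u : ℂ → ℂ) : ℂ → ℂ :=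
  fun z => Complex.exp ((((starRingEnd ℂ) a * z).im : ℝ) * Complex.I) * u (z - a)

lemma norm_trans (a : ℂ) (u : ℂ → ℂ) (z : ℂ) : ‖trans a u z‖ = ‖u (z - a)‖ := by
  rw [trans, norm_mul, Complex.norm_exp_ofReal_mul_I, one_mul]

/-- The phase completes the Gaussian factor e^{Re(āz)} to the holomorphic e^{āz}, so translations
preserve the form e^{-|z|²/2}·entire. -/
lemma trans_eq_exp_mul (a : ℂ) (f : ℂ → ℂ) (z : ℂ) :
    trans a (fun w => Complex.exp (-((‖w‖ ^ 2 / 2 : ℝ) : ℂ)) * f w) z =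
      Complex.exp (-((‖z‖ ^ 2 / 2 : ℝ) : ℂ)) *
        (Complex.exp ((starRingEnd ℂ) a * z - ((‖a‖ ^ 2 / 2 : ℝ) : ℂ)) * f (z - a)) := by
  rw [trans, ← mul_assoc, ← mul_assoc, ← Complex.exp_add, ← Complex.exp_add]
  congr 2
  rw [norm_sub_sq_complex z a]
  apply Complex.ext
  · simp
    ring
  · simp
    ring

lemma trans_mem {u : ℂ → ℂ} (hu : u ∈ bargmannFock) (a : ℂ) : trans a u ∈ bargmannFock := by
  obtain ⟨⟨f, hf, hfu⟩, hu2⟩ := hu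
  have hcu : Continuous u := by
    rw [funext hfu]
    have := hf.continuous
    fun_prop
  refine ⟨⟨fun z => Complex.exp ((starRingEnd ℂ) a * z - ((‖a‖ ^ 2 / 2 : ℝ) : ℂ)) * f (z - a),
    by fun_prop, fun z => ?_⟩, ?_⟩
  · rw [← trans_eq_exp_mul, ← funext hfu]
  · have h := hu2.comp_measurePreserving (measurePreserving_sub_right volume a)
    refine h.congr_norm (by unfold trans; exact Continuous.aestronglyMeasurable (by fun_prop))
      (Filter.Eventually.of_forall fun z => ?_)
    rw [norm_trans, Function.comp_apply]

/-- `c'` represents a function with the modulus of the translate of `wave c`. -/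
lemma WSummable.of_translate {c c' : ℕ → ℂ} (hc : WSummable c) (hc' : SqSummable c') {a : ℂ}
    (h : ∀ z, ‖wave c' z‖ = ‖wave c (z - a)‖) :
    WSummable c' ∧ msq c' = msq c ∧ en c' = en c ∧ kin 0 c' = kin (-a) c ∧
      dipole (wave c') = dipole (wave c) + a * msq c := by
  have he : ∀ z, ‖wave c' z‖ₑ = ‖wave c (z - a)‖ₑ := fun z => by
    rw [← ofReal_norm, h, ofReal_norm]
  have hk : ∑' n, ‖shiftCoef 0 c' n‖ₑ ^ 2 = ENNReal.ofReal (kin (-a) c) := by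
    rw [kin_eq_lintegral hc, ← lintegral_shift 0 hc',
      ← lintegral_sub_right_eq_self (fun z => ‖z - -a‖ₑ ^ 2 * ‖wave c z‖ₑ ^ 2) a]
    refine lintegral_congr fun z => ?_
    rw [he, sub_zero, sub_neg_eq_add, sub_add_cancel]
  have hw : WSummable c' := by
    rw [wsummable_iff, sqSummable_iff, hk]
    exact ENNReal.ofReal_lt_top
  have hm : msq c' = msq c := by
    rw [msq, msq, ← mass_wave hc', ← mass_wave hc.sq, mass, mass,
      ← integral_sub_right_eq_self (fun z => ‖wave c z‖ ^ 2) a]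
    simp only [h]
  refine ⟨hw, hm, ?_, ?_, ?_⟩
  · rw [en, en, msq, msq, ← hamiltonian_wave hc', ← hamiltonian_wave hc.sq, hamiltonian, hamiltonian,
      ← integral_sub_right_eq_self (fun z => ‖wave c z‖ ^ 4) a]
    simp only [h]
  · rw [tsum_enorm_sq (hw.shift 0)] at hk
    exact (ENNReal.ofReal_eq_ofReal_iff (msq_nonneg _) (msq_nonneg _)).1 hk
  · have h1 := hc.sq.integrable_wave
    have h2 : Integrable fun z => a * ((‖wave c z‖ ^ 2 : ℝ) : ℂ) := h1.1.ofReal.const_mul a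
    rw [dipole, dipole]
    simp only [h]
    rw [← integral_add_right_eq_self _ a]
    simp only [add_sub_cancel_right, add_mul]
    rw [integral_add hc.integrable_dipole h2, integral_const_mul, integral_complex_ofReal, h1.2, msq]

lemma exists_trans {c : ℕ → ℂ} (hc : WSummable c) (a : ℂ) :
    ∃ c', WSummable c' ∧ wave c' = trans a (wave c) ∧ msq c' = msq c ∧ en c' = en c ∧
      kin 0 c' = kin (-a) c ∧ dipole (wave c') = dipole (wave c) + a * msq c := by
  obtain ⟨c', hc', h⟩ := exists_eq_wave (trans_mem hc.sq.wave_mem a)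
  obtain ⟨h1, h2, h3, h4, h5⟩ := hc.of_translate hc' (a := a) fun z => by rw [← h, norm_trans]
  exact ⟨c', h1, h.symm, h2, h3, h4, h5⟩

lemma trans_neg_trans (a : ℂ) (u : ℂ → ℂ) : trans (-a) (trans a u) = u := by
  funext z
  rw [trans, trans, ← mul_assoc, ← Complex.exp_add, sub_neg_eq_add, add_sub_cancel_right]
  have : (((starRingEnd ℂ) (-a) * z).im : ℂ) * Complex.I +
      (((starRingEnd ℂ) a * (z + a)).im : ℂ) * Complex.I = 0 := by
    rw [← add_mul, ← Complex.ofReal_add]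
    have : ((starRingEnd ℂ) (-a) * z).im + ((starRingEnd ℂ) a * (z + a)).im = 0 := by
      simp
      ring
    rw [this]
    simp
  rw [this, Complex.exp_zero, one_mul]

lemma wave_add_mul {c d : ℕ → ℂ} (hc : SqSummable c) (hd : SqSummable d) (t : ℂ) (z : ℂ) :
    wave (fun n => c n + t * d n) z = wave c z + t * wave d z := by
  have h := (hc.isEntireSeries z).add ((hd.isEntireSeries z).mul_left t)
  have : HasSum (fun n : ℕ => (c n + t * d n) / (√(Real.pi * n !) : ℝ) * z ^ n)
      (holo c z + t * holo d z) := by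
    refine h.congr_fun ?_ |> id
    intro n
    ring
  rw [wave, wave, wave, holo, this.tsum_eq]
  ring

lemma WSummable.add_mul {c d : ℕ → ℂ} (hc : WSummable c) (hd : WSummable d) (t : ℂ) :
    WSummable (fun n => c n + t * d n) := by
  rw [wsummable_iff] at *
  refine Summable.congr (SqSummable.add hc (hd.const_mul t)) fun n => ?_
  simp only [shiftCoef]
  congr 2
  ring

/-- Minimality is transported by translations. -/
lemma QMin.of_trans {μ g : ℝ} {a : ℂ} {c c' : ℕ → ℂ} (hc : WSummable c) (hc' : WSummable c')
    (h : wave c' = trans a (wave c)) (hq : QMin μ g 0 c') : QMin μ g (-a) c := by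
  have key : ∀ {d d' : ℕ → ℂ}, WSummable d → SqSummable d' → wave d' = trans a (wave d) →
      quart μ g 0 d' = quart μ g (-a) d := by
    intro d d' hd hd' hdd
    obtain ⟨_, h2, h3, h4, _⟩ := hd.of_translate hd' (a := a) fun z => by rw [hdd, norm_trans]
    rw [quart, quart, h2, h3, h4]
  refine ⟨(key hc hc'.sq h).symm.trans hq.1, fun d hd => ?_⟩
  obtain ⟨d', hd', hdd, -⟩ := exists_trans hd a
  -- Translation is linear, so it carries the line through c to the line through c'.
  have e : (fun t : ℝ => quart μ g (-a) (fun n => c n + t * d n)) =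
      fun t : ℝ => quart μ g 0 (fun n => c' n + t * d' n) := by
    funext t
    refine (key (hc.add_mul hd t) (hc'.add_mul hd' t).sq ?_).symm
    funext z
    rw [wave_add_mul hc'.sq hd'.sq, h, hdd]
    simp only [trans]
    rw [wave_add_mul hc.sq hd.sq]
    ring
  rw [e]
  exact hq.2 d' hd'

/-! ### From functions to coordinates: local minimizers -/

lemma energy_wave {c : ℕ → ℂ} (hc : WSummable c) (μ : ℝ) :
    energy μ (wave c) = (coordEnergy μ c : ℝ) := by
  rw [energy, if_pos ((weightedNorm_wave_lt_top hc.sq).2 hc), hamiltonian_wave hc.sq,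
    angularMomentum_wave hc, coordEnergy, en, msq, kin_zero hc, msq,
    ← Summable.tsum_sub hc hc.sq]
  congr 4
  funext n
  ring

lemma wave_mem_unitMass {c : ℕ → ℂ} (hc : SqSummable c) (hm : msq c = 1) : wave c ∈ unitMass :=
  ⟨hc.wave_mem, by rw [mass_wave hc]; exact hm⟩

lemma exists_coords_of_unitMass {u : ℂ → ℂ} (hu : u ∈ unitMass) :
    ∃ c, SqSummable c ∧ msq c = 1 ∧ u = wave c := by
  obtain ⟨c, hc, rfl⟩ := exists_eq_wave hu.1
  exact ⟨c, hc, by rw [msq, ← mass_wave hc]; exact hu.2, rfl⟩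

lemma bil_const_mul (ζ : ℂ) (c : ℕ → ℂ) :
    bil (fun n => ζ * c n) (fun n => ζ * c n) = fun k => ζ ^ 2 * bil c c k := by
  funext k
  simp only [bil, Finset.mul_sum]
  exact Finset.sum_congr rfl fun p _ => by ring

lemma en_const_mul (ζ : ℂ) (c : ℕ → ℂ) : en (fun n => ζ * c n) = ‖ζ‖ ^ 4 * en c := by
  rw [en, bil_const_mul, msq_const_mul, norm_pow, ← pow_mul, en]

lemma kin_const_mul (ζ a : ℂ) (c : ℕ → ℂ) : kin a (fun n => ζ * c n) = ‖ζ‖ ^ 2 * kin a c := by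
  have h2 : shiftCoef a (fun n => ζ * c n) = fun k => ζ * shiftCoef a c k := by
    funext k
    simp only [shiftCoef]
    ring
  rw [kin, h2, msq_const_mul, kin]

lemma weightedNorm_wave_eq {c : ℕ → ℂ} (hc : WSummable c) :
    weightedNorm (wave c) ^ 2 = ENNReal.ofReal (msq c + kin 0 c) := by
  rw [weightedNorm_wave_sq hc.sq, tsum_enorm_sq hc.sq, tsum_enorm_sq (hc.shift 0),
    ← ENNReal.ofReal_add (tsum_nonneg fun _ => by positivity) (tsum_nonneg fun _ => by positivity)]
  rfl

lemma msq_smul_add_smul {c d : ℕ → ℂ} (hc : SqSummable c) (hd : SqSummable d) (s t : ℂ) :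
    msq (fun n => s * c n + t * d n) ≤ 2 * ‖s‖ ^ 2 * msq c + 2 * ‖t‖ ^ 2 * msq d := by
  have hs := (((Summable.hasSum hc).mul_left (2 * ‖s‖ ^ 2)).add
    ((Summable.hasSum hd).mul_left (2 * ‖t‖ ^ 2)))
  have hl : SqSummable fun n => s * c n + t * d n := (hc.const_mul s).add (hd.const_mul t)
  refine hasSum_le (fun n => ?_) (Summable.hasSum hl) hs
  have h := norm_add_le (s * c n) (t * d n)
  rw [norm_mul, norm_mul] at h
  nlinarith [norm_nonneg (s * c n + t * d n), sq_nonneg (‖s‖ * ‖c n‖ - ‖t‖ * ‖d n‖),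
    mul_nonneg (norm_nonneg s) (norm_nonneg (c n)), mul_nonneg (norm_nonneg t) (norm_nonneg (d n))]

/-- For v = c + td, homogeneity gives `quart` = M(v)²·(energy of v normalized - energy of c). For
small t the normalized v is an admissible competitor in the ε-ball. -/
lemma IsLocalMinimizer.qMin {μ : ℝ} {c : ℕ → ℂ} (hc : SqSummable c) (hm : msq c = 1)
    (h : IsLocalMinimizer μ (wave c)) : WSummable c ∧ QMin μ (coordEnergy μ c) 0 c := by
  obtain ⟨-, hfin, ε, hε, hmin⟩ := h
  have hw := (weightedNorm_wave_lt_top hc).1 hfin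
  refine ⟨hw, by rw [quart, hm, coordEnergy, hm]; ring, fun d hd => ?_⟩
  have h0 : quart μ (coordEnergy μ c) 0 (fun n => c n + (0 : ℝ) * d n) = 0 := by
    simp only [Complex.ofReal_zero, zero_mul, add_zero]
    rw [quart, hm, coordEnergy, hm]; ring
  set m : ℝ → ℝ := fun t => msq (fun n => c n + t * d n) with hmdef
  have hmc : Continuous m := by
    have : m = fun t => msq c + t * (2 * ip c d) + t ^ 2 * msq d := by
      funext t; exact msq_lin hc hd.sq t
    rw [this]
    fun_prop
  have hm0 : m 0 = 1 := by simp [hmdef, hm]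
  have hpos : ∀ᶠ t in nhds (0 : ℝ), 0 < m t :=
    hmc.continuousAt.eventually (lt_mem_nhds (by rw [hm0]; norm_num))
  -- An upper bound for the squared weighted distance from c to the normalized v, which is the
  -- combination of c and d with coefficients 1/√m - 1 and t/√m.
  set B : ℝ → ℝ := fun t => 2 * (1 / √(m t) - 1) ^ 2 * (msq c + kin 0 c) +
    2 * (t / √(m t)) ^ 2 * (msq d + kin 0 d) with hB
  have hBc : ContinuousAt B 0 := by
    have : √(m 0) ≠ 0 := by rw [hm0]; simp
    have h1 : ContinuousAt m 0 := hmc.continuousAt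
    fun_prop (disch := assumption)
  have hB0 : B 0 = 0 := by simp [hB, hm0]
  have hsmall : ∀ᶠ t in nhds (0 : ℝ), B t < ε ^ 2 :=
    hBc.eventually (gt_mem_nhds (by rw [hB0]; positivity))
  filter_upwards [hpos, hsmall] with t ht1 ht2
  rw [h0]
  set v : ℕ → ℂ := fun n => c n + t * d n with hv
  have hvw : WSummable v := hw.add_mul hd t
  set s : ℝ := 1 / √(m t) with hs
  have hs2 : s ^ 2 * msq v = 1 := by
    rw [hs, div_pow, one_pow, Real.sq_sqrt ht1.le]
    exact one_div_mul_cancel ht1.ne'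
  have hs0 : 0 < s := by positivity
  have hsn : ‖(s : ℂ)‖ = s := by rw [Complex.norm_real, Real.norm_of_nonneg hs0.le]
  have hvs : WSummable fun n => (s : ℂ) * v n := by
    have := WSummable.add_mul (wsummable_of_finite (d := 0) (N := 0) (by simp)) hvw s
    simpa using this
  have hvm : msq (fun n => (s : ℂ) * v n) = 1 := by rw [msq_const_mul, hsn, hs2]
  have hle := hmin _ (wave_mem_unitMass hvs.sq hvm) (by
    set e : ℕ → ℂ := fun n => ((s - 1 : ℝ) : ℂ) * c n + ((t / √(m t) : ℝ) : ℂ) * d n with he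
    have hew : WSummable e := by
      have := (WSummable.add_mul (wsummable_of_finite (d := 0) (N := 0) (by simp)) hw
        ((s - 1 : ℝ) : ℂ)).add_mul hd ((t / √(m t) : ℝ) : ℂ)
      simpa only [he, Pi.zero_apply, zero_add] using this
    have h1 : wave (fun n => (s : ℂ) * v n) - wave c = wave e := by
      have e1 : (fun n => (s : ℂ) * v n) = fun n => e n + 1 * c n := by
        funext n
        simp only [hv, he, hs]
        push_cast
        ring
      funext z
      rw [Pi.sub_apply, e1, wave_add_mul hew.sq hc]
      ring
    rw [h1, ← ENNReal.pow_lt_pow_left_iff two_ne_zero, weightedNorm_wave_eq hew,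
      ← ENNReal.ofReal_pow hε.le]
    refine (ENNReal.ofReal_lt_ofReal_iff (by positivity)).2 (lt_of_le_of_lt ?_ ht2)
    have h2 := msq_smul_add_smul hc hd.sq ((s - 1 : ℝ) : ℂ) ((t / √(m t) : ℝ) : ℂ)
    have h3 := msq_smul_add_smul (hw.shift 0) (hd.shift 0) ((s - 1 : ℝ) : ℂ)
      ((t / √(m t) : ℝ) : ℂ)
    have h4 : kin 0 e = msq fun n => ((s - 1 : ℝ) : ℂ) * shiftCoef 0 c n +
        ((t / √(m t) : ℝ) : ℂ) * shiftCoef 0 d n := by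
      rw [kin]
      congr 1
      funext n
      simp only [shiftCoef, he]
      ring
    rw [h4]
    simp only [Complex.norm_real, Real.norm_eq_abs, sq_abs] at h2 h3
    simp only [hB, kin]
    linarith)
  rw [energy_wave hw, energy_wave hvs, EReal.coe_le_coe_iff] at hle
  nth_rewrite 2 [coordEnergy] at hle
  rw [hvm, en_const_mul, kin_const_mul, hsn] at hle
  have hmv : 0 < msq v := ht1
  have h5 : quart μ (coordEnergy μ c) 0 v = msq v ^ 2 * (s ^ 4 * en v + μ * (s ^ 2 * kin 0 v - 1) -
      coordEnergy μ c) := by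
    rw [quart]
    linear_combination (-(en v) * (s ^ 2 * msq v + 1) - μ * kin 0 v * msq v) * hs2
  rw [h5]
  exact mul_nonneg (by positivity) (by linarith)

/-! ### The functional equation of the equality case -/

/-- A zero at x would give h(x₀)² = 0 on taking s = x₀ and t = x - x₀. So h vanishes nowhere, and
h/h(0) is multiplicative, whence it satisfies k' = k'(0)k. -/
lemma exp_of_functional_equation {h : ℂ → ℂ} (hd : Differentiable ℂ h)
    (hf : ∀ s t, h (s + t) * h (s - t) = h s ^ 2) {x₀ : ℂ} (hx₀ : h x₀ ≠ 0) :
    ∃ α, h 0 ≠ 0 ∧ ∀ z, h z = h 0 * Complex.exp (α * z) := by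
  have hne : ∀ x, h x ≠ 0 := by
    intro x hx
    have := hf x₀ (x - x₀)
    rw [add_sub_cancel, hx, zero_mul] at this
    exact hx₀ (pow_eq_zero_iff two_ne_zero |>.1 this.symm)
  have h0 := hne 0
  set k : ℂ → ℂ := fun z => h z / h 0 with hk
  have hkd : Differentiable ℂ k := by fun_prop
  have hk0 : k 0 = 1 := div_self h0
  have hkf : ∀ s t, k (s + t) * k (s - t) = k s ^ 2 := by
    intro s t
    simp only [hk]
    field_simp
    exact hf s t
  have hadd : ∀ x y, k (x + y) = k x * k y := by
    intro x y
    have h1 := hkf ((x + y) / 2) ((x - y) / 2)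
    have h2 := hkf ((x + y) / 2) ((x + y) / 2)
    rw [sub_self, hk0, mul_one, add_halves] at h2
    rw [h2, ← h1]
    congr 2 <;> ring
  have hder : ∀ x, HasDerivAt k (deriv k 0 * k x) x := by
    intro x
    have h1 : HasDerivAt k (deriv k 0) (x - x) := by
      rw [sub_self]; exact (hkd 0).hasDerivAt
    have h2 := (h1.comp_sub_const x x).mul_const (k x)
    have h3 : (fun y => k (y - x) * k x) = k := by
      funext y
      rw [← hadd, sub_add_cancel]
    rwa [h3] at h2
  set α := deriv k 0
  refine ⟨α, h0, fun z => ?_⟩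
  have hc : ∀ x, HasDerivAt (fun y => k y * Complex.exp (-(α * y))) 0 x := by
    intro x
    have h1 : HasDerivAt (fun y => Complex.exp (-(α * y))) (Complex.exp (-(α * x)) * (-(α * 1))) x :=
      ((hasDerivAt_id x).const_mul α).neg.cexp
    have h2 := (hder x).mul h1
    have e : α * k x * Complex.exp (-(α * x)) + k x * (Complex.exp (-(α * x)) * (-(α * 1))) = 0 := by
      ring
    rw [e] at h2
    exact h2
  have h3 := is_const_of_deriv_eq_zero (fun x => (hc x).differentiableAt) (fun x => (hc x).deriv) z 0
  simp only [mul_zero, neg_zero, Complex.exp_zero, hk0, mul_one] at h3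
  have h4 : k z = Complex.exp (α * z) := by
    rw [Complex.exp_neg] at h3
    field_simp at h3
    exact h3
  rw [← h4, hk]
  field_simp

/-- Solutions of the quadratic functional equation of the two-particle ground states. -/
lemma linear_mul_exp_of_functional_equation {f B : ℂ → ℂ} (hd : Differentiable ℂ f)
    (hf : ∀ s t, f (s + t) * f (s - t) = f s ^ 2 + B s * t ^ 2) {x₀ : ℂ} (hx₀ : f x₀ ≠ 0) :
    ∃ p q α : ℂ, ∀ z, f z = (p + q * z) * Complex.exp (α * z) := by
  by_cases hz : ∃ z₀, f z₀ = 0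
  · obtain ⟨z₀, hz₀⟩ := hz
    set h := dslope f z₀ with hh
    have hhd : Differentiable ℂ h := by
      rw [← differentiableOn_univ] at hd ⊢
      exact (Complex.differentiableOn_dslope Filter.univ_mem).2 hd
    have hfh : ∀ z, f z = (z - z₀) * h z := by
      intro z
      have := sub_smul_dslope f z₀ z
      rw [hz₀, sub_zero, smul_eq_mul] at this
      exact this.symm
    -- Reflecting z₀ + s onto the zero z₀ (t = s) determines B, and the equation for f reduces to
    -- the one without B for the quotient h.
    have hB : ∀ s, B (z₀ + s) * s ^ 2 = -f (z₀ + s) ^ 2 := by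
      intro s
      have := hf (z₀ + s) s
      rw [add_sub_cancel_right, hz₀, mul_zero] at this
      linear_combination -this
    have h1 : ∀ s t, s ≠ 0 → s ^ 2 ≠ t ^ 2 →
        h (z₀ + s + t) * h (z₀ + s - t) = h (z₀ + s) ^ 2 := by
      intro s t hs hst
      have e := hf (z₀ + s) t
      have e2 := hB s
      rw [hfh (z₀ + s + t), hfh (z₀ + s - t)] at e
      rw [hfh (z₀ + s)] at e e2
      refine mul_left_cancel₀ (mul_ne_zero (pow_ne_zero 2 hs) (sub_ne_zero.2 hst)) ?_
      linear_combination s ^ 2 * e + t ^ 2 * e2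
    have hhc := hhd.continuous
    have h2 : ∀ s, s ≠ 0 → ∀ t, h (z₀ + s + t) * h (z₀ + s - t) = h (z₀ + s) ^ 2 := by
      intro s hs t
      -- The exceptional values s² = t², and s = 0 below, are recovered by continuity.
      have hden : Dense ({s, -s}ᶜ : Set ℂ) := by
        have : ({s, -s} : Set ℂ).Finite := by simp
        exact this.countable.dense_compl ℂ
      have := Continuous.ext_on hden (f := fun t => h (z₀ + s + t) * h (z₀ + s - t))
        (g := fun _ => h (z₀ + s) ^ 2) (by fun_prop) (by fun_prop) (fun t ht => h1 s t hs ?_)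
      · exact congrFun this t
      · intro hst
        rcases sq_eq_sq_iff_eq_or_eq_neg.1 hst with h | h
        · exact ht (by simp [h])
        · exact ht (by simp [h])
    have h3 : ∀ t s, h (z₀ + s + t) * h (z₀ + s - t) = h (z₀ + s) ^ 2 := by
      intro t
      have hden : Dense ({0}ᶜ : Set ℂ) := dense_compl_singleton 0
      have := Continuous.ext_on hden (f := fun s => h (z₀ + s + t) * h (z₀ + s - t))
        (g := fun s => h (z₀ + s) ^ 2) (by fun_prop) (by fun_prop) (fun s hs => h2 s hs t)
      exact fun s => congrFun this s
    obtain ⟨α, -, hα⟩ := exp_of_functional_equation hhd (fun s t => by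
      have := h3 t (s - z₀)
      rwa [add_sub_cancel] at this) (x₀ := x₀) (by
        intro h0
        rw [hfh, h0, mul_zero] at hx₀
        exact hx₀ rfl)
    refine ⟨-(h 0 * z₀), h 0, α, fun z => ?_⟩
    rw [hfh, hα]
    ring
  · push Not at hz
    -- Without zeros, B(s) ≠ 0 is impossible: the choice t² = -f(s)²/B(s) would make the product on
    -- the left vanish.
    have hB : ∀ s, B s = 0 := by
      intro s
      by_contra hBs
      obtain ⟨t, ht⟩ := IsAlgClosed.exists_pow_nat_eq (-(f s ^ 2 / B s)) two_pos
      have := hf s t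
      rw [ht] at this
      have e : f s ^ 2 + B s * -(f s ^ 2 / B s) = 0 := by field_simp; ring
      rw [e] at this
      exact (mul_ne_zero (hz _) (hz _)) this
    obtain ⟨α, -, hα⟩ := exp_of_functional_equation hd (fun s t => by
      rw [hf, hB, zero_mul, add_zero]) hx₀
    exact ⟨f 0, 0, α, fun z => by rw [hα]; ring⟩

/-! ### Functions of the first two levels and ψ_b -/

/-- Coordinates in the span of the first two special Hermite functions. -/
noncomputable def twoCoef (x y : ℂ) : ℕ → ℂ := fun n => if n = 0 then x else if n = 1 then y else 0

lemma twoCoef_of_lt {x y : ℂ} (n : ℕ) (hn : 1 < n) : twoCoef x y n = 0 := by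
  simp [twoCoef, show n ≠ 0 by omega, show n ≠ 1 by omega]

lemma wsummable_twoCoef (x y : ℂ) : WSummable (twoCoef x y) :=
  wsummable_of_finite (N := 1) fun n hn => twoCoef_of_lt n hn

lemma msq_twoCoef (x y : ℂ) : msq (twoCoef x y) = ‖x‖ ^ 2 + ‖y‖ ^ 2 :=
  msq_pair fun i hi => twoCoef_of_lt i hi

lemma holo_twoCoef (x y z : ℂ) : holo (twoCoef x y) z = (x + y * z) / (√Real.pi : ℝ) := by
  rw [holo, tsum_eq_sum (s := Finset.range 2)]
  · simp [Finset.sum_range_succ, twoCoef]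
    ring
  · intro n hn
    rw [twoCoef_of_lt n (by simpa [Finset.mem_range] using hn), zero_div, zero_mul]

lemma kin_twoCoef (a x y : ℂ) :
    kin a (twoCoef x y) = ‖a * x‖ ^ 2 + ‖x - a * y‖ ^ 2 + 2 * ‖y‖ ^ 2 := by
  rw [kin, msq, tsum_eq_sum (s := Finset.range 3)]
  · simp only [Finset.sum_range_succ, Finset.sum_range_zero, shiftCoef, twoCoef]
    norm_num
    rw [mul_pow, sq_abs, Real.sq_sqrt (by norm_num)]
  · intro n hn
    simp only [Finset.mem_range, not_lt] at hn
    rw [shiftCoef, twoCoef_of_lt n (by omega), twoCoef_of_lt (n - 1) (by omega)]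
    simp

/-- The dipole is read off from the part of `kin a` linear in a, which is explicit here; a = 1 and a
= i give its real and imaginary parts. -/
lemma dipole_twoCoef (x y : ℂ) : dipole (wave (twoCoef x y)) = x * (starRingEnd ℂ) y := by
  have h : ∀ a : ℂ, ((starRingEnd ℂ) a * dipole (wave (twoCoef x y))).re =
      ((starRingEnd ℂ) a * (x * (starRingEnd ℂ) y)).re := by
    intro a
    have := kin_eq (wsummable_twoCoef x y) a
    rw [kin_twoCoef, kin_twoCoef, msq_twoCoef, norm_mul, norm_sub_sq_complex x] at this
    simp only [map_mul, zero_mul, norm_zero, sub_zero, norm_mul] at this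
    have e : ((starRingEnd ℂ) a * (x * (starRingEnd ℂ) y)).re =
        ((starRingEnd ℂ) a * (starRingEnd ℂ) y * x).re := by congr 1; ring
    rw [e]
    nlinarith
  have h1 := h 1
  have h2 := h Complex.I
  apply Complex.ext
  · simpa using h1
  · simp at h2 ⊢; linarith

lemma en_twoCoef (x y : ℂ) :
    en (twoCoef x y) = ‖x‖ ^ 4 + 2 * (‖x‖ ^ 2 * ‖y‖ ^ 2) + ‖y‖ ^ 4 / 2 := by
  rw [en, msq, tsum_eq_sum (s := Finset.range 3)]
  · have h0 : bil (twoCoef x y) (twoCoef x y) 0 = x * x := by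
      simp [bil, gw_zero, twoCoef]
    have h1 : bil (twoCoef x y) (twoCoef x y) 1 = (√2 : ℝ) * (x * y) := by
      have e : ((√2 : ℝ) : ℂ) = 2 * (√(1 / 2) : ℝ) := by
        rw [← Complex.ofReal_ofNat, ← Complex.ofReal_mul]
        congr 1
        rw [Real.sqrt_div (by norm_num), Real.sqrt_one]
        field_simp
        norm_num
      simp only [bil, Finset.Nat.antidiagonal_succ, Finset.Nat.antidiagonal_zero]
      simp [gw_one, twoCoef]
      simp only [one_div, Real.sqrt_inv] at e
      push_cast at e
      linear_combination (x * y) * -e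
    have h2 : bil (twoCoef x y) (twoCoef x y) 2 = (√(1 / 2) : ℝ) * (y * y) := by
      simp only [bil, Finset.Nat.antidiagonal_succ, Finset.Nat.antidiagonal_zero]
      simp [gw_two_one, twoCoef]
    simp only [Finset.sum_range_succ, Finset.sum_range_zero, h0, h1, h2, norm_mul,
      Complex.norm_real, Real.norm_of_nonneg (Real.sqrt_nonneg _), mul_pow]
    rw [Real.sq_sqrt (by norm_num), Real.sq_sqrt (by norm_num)]
    ring
  · intro n hn
    simp only [Finset.mem_range, not_lt] at hn
    rw [bil_eq_zero_of_lt (n := 1) (fun i hi => twoCoef_of_lt i hi) (by omega)]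
    simp

/-- The centred translates of the functions of the first two levels. -/
noncomputable def centred (x y : ℂ) : ℂ → ℂ :=
  trans (-(x * (starRingEnd ℂ) y)) (wave (twoCoef x y))

/-- Translating by minus the dipole x·ȳ lowers the angular momentum from |y|² to |y|² - |x|²|y|² =
|y|⁴. The interaction energy is invariant, so G_{1/2} = 1 along the whole family. -/
lemma centred_coords {x y : ℂ} (h : ‖x‖ ^ 2 + ‖y‖ ^ 2 = 1) :
    ∃ c, WSummable c ∧ centred x y = wave c ∧ msq c = 1 ∧ en c = 1 - ‖y‖ ^ 4 / 2 ∧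
      kin 0 c - msq c = ‖y‖ ^ 4 := by
  obtain ⟨c, hc, hw, hm, he, hk, -⟩ := exists_trans (wsummable_twoCoef x y) (-(x * (starRingEnd ℂ) y))
  have hm1 : msq c = 1 := by rw [hm, msq_twoCoef, h]
  refine ⟨c, hc, hw.symm, hm1, ?_, ?_⟩
  · rw [he, en_twoCoef]
    linear_combination (‖x‖ ^ 2 + ‖y‖ ^ 2 + 1) * h
  · rw [hk, hm1, neg_neg, kin_twoCoef]
    have e : x - x * (starRingEnd ℂ) y * y = x * ((‖x‖ ^ 2 : ℝ) : ℂ) := by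
      have h2 : (starRingEnd ℂ) y * y = ((‖y‖ ^ 2 : ℝ) : ℂ) := by
        rw [← Complex.normSq_eq_conj_mul_self, Complex.normSq_eq_norm_sq]
      have h3 : ((‖x‖ ^ 2 : ℝ) : ℂ) + ((‖y‖ ^ 2 : ℝ) : ℂ) = 1 := by exact_mod_cast h
      linear_combination x * (-h2) - x * h3
    rw [e, norm_mul, norm_mul, norm_mul, RCLike.norm_conj, Complex.norm_real,
      Real.norm_of_nonneg (by positivity)]
    linear_combination (‖x‖ ^ 4 + ‖x‖ ^ 2 * 1 - ‖y‖ ^ 2 + 1) * h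

/-- Equality leaves only the powers t⁰ and t² in f(s+t)f(s-t), so f is affine times an exponential.
A translation removes the exponential, and the vanishing dipole identifies which translation it was.
-/
lemma coordEnergy_half_eq_one_iff_centred {c : ℕ → ℂ} (hc : WSummable c) (hm : msq c = 1) :
    coordEnergy (1 / 2) c = 1 ↔ ∃ x y, ‖x‖ ^ 2 + ‖y‖ ^ 2 = 1 ∧ wave c = centred x y := by
  constructor
  · intro h
    obtain ⟨hQ, hF⟩ := (coordEnergy_half_eq_one_iff hc hm).1 h
    have hd := hc.sq.isEntireSeries.differentiable
    have hfun : ∀ s t, holo c (s + t) * holo c (s - t) =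
        holo c s ^ 2 + pairCoef (holo c) 2 s * t ^ 2 := by
      intro s t
      have h1 := isEntireSeries_pair hd s t
      have h2 := hasSum_sum_of_ne_finset_zero (L := .unconditional ℕ) (f := fun n => pairCoef (holo c) n s * t ^ n)
        (s := Finset.range 4) (fun n hn => by
          rw [hF n (by simpa using hn)]; simp)
      refine (h1.unique h2).trans ?_
      simp [Finset.sum_range_succ, pairCoef_zero, pairCoef_odd _ (show Odd 1 by decide),
        pairCoef_odd _ (show Odd 3 by decide)]
    have hne : ∃ x₀, holo c x₀ ≠ 0 := by
      by_contra! h0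
      have : mass (wave c) = 0 := by simp [mass, wave, h0]
      rw [mass_wave hc.sq, ← msq, hm] at this
      norm_num at this
    obtain ⟨x₀, hx₀⟩ := hne
    obtain ⟨p, q, α, hf⟩ := linear_mul_exp_of_functional_equation hd hfun hx₀
    -- Translation by -ā' multiplies f by the exponential of -āz for a the conjugate of α, which
    -- cancels e^{αz}; K collects the remaining constants.
    set a := (starRingEnd ℂ) α with ha
    set K := Complex.exp (α * a - ((‖a‖ ^ 2 / 2 : ℝ) : ℂ)) * (√Real.pi : ℝ) with hK
    set x := K * (p + q * a) with hx
    set y := K * q with hy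
    have ht : trans (-a) (wave c) = wave (twoCoef x y) := by
      funext z
      have e : wave c = fun w => Complex.exp (-((‖w‖ ^ 2 / 2 : ℝ) : ℂ)) * holo c w := rfl
      rw [e, trans_eq_exp_mul, wave, holo_twoCoef, hf]
      congr 1
      have hpi : ((√Real.pi : ℝ) : ℂ) ≠ 0 := by
        exact_mod_cast (Real.sqrt_pos.2 Real.pi_pos).ne'
      have e2 : Complex.exp ((starRingEnd ℂ) (-a) * z - ((‖-a‖ ^ 2 / 2 : ℝ) : ℂ)) *
          Complex.exp (α * (z - -a)) = Complex.exp (α * a - ((‖a‖ ^ 2 / 2 : ℝ) : ℂ)) := by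
        rw [← Complex.exp_add, norm_neg, map_neg, ha, Complex.conj_conj]
        congr 1
        ring
      rw [mul_left_comm, e2, hx, hy, hK]
      field_simp
      ring
    have hback : wave c = trans a (wave (twoCoef x y)) := by
      rw [← ht]
      have := trans_neg_trans (-a) (wave c)
      rw [neg_neg] at this
      exact this.symm
    obtain ⟨-, h2, -, -, h5⟩ := (wsummable_twoCoef x y).of_translate hc.sq (a := a)
      fun z => by rw [hback, norm_trans]
    rw [hm, msq_twoCoef] at h2
    rw [hQ, dipole_twoCoef, msq_twoCoef, ← h2] at h5
    refine ⟨x, y, h2.symm, ?_⟩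
    rw [hback, centred]
    congr 1
    simp only [Complex.ofReal_one, mul_one] at h5
    linear_combination -h5
  · rintro ⟨x, y, hxy, hw⟩
    obtain ⟨c', hc', hw', hm', he', hk'⟩ := centred_coords hxy
    have h := energy_wave hc (1 / 2)
    rw [hw, hw', energy_wave hc'] at h
    have h2 : coordEnergy (1 / 2) c' = coordEnergy (1 / 2) c := by exact_mod_cast h
    rw [← h2, coordEnergy, he', hk']
    ring

lemma phi_eq_wave (n : ℕ) : phi n = wave (Pi.single n 1) := by
  funext z
  rw [phi, wave, holo, tsum_eq_single n]
  · simp only [Pi.single_eq_same]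
    push_cast
    ring
  · intro m hm
    rw [Pi.single_eq_of_ne hm]
    simp

lemma phi_coords (n : ℕ) : ∃ c, WSummable c ∧ phi n = wave c ∧ msq c = 1 ∧
    en c = gw (2 * n) n ^ 2 ∧ kin 0 c - msq c = n := by
  refine ⟨Pi.single n 1, wsummable_single n 1, phi_eq_wave n, by simp [msq_single], ?_, ?_⟩
  · rw [en, bil_single_single, msq_single, Complex.norm_real, Real.norm_eq_abs, sq_abs]
  · rw [kin_single, msq_single]
    simp

lemma holo_rotate (ζ e : ℂ) {c : ℕ → ℂ} (hc : SqSummable c) (z : ℂ) :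
    holo (fun n => ζ * (e ^ n * c n)) z = ζ * holo c (e * z) := by
  have h := (hc.isEntireSeries (e * z)).mul_left ζ
  rw [holo, ← h.tsum_eq]
  refine tsum_congr fun n => ?_
  rw [mul_pow]
  ring

lemma wave_rotate (ζ : ℂ) {e : ℂ} (he : ‖e‖ = 1) {c : ℕ → ℂ} (hc : SqSummable c) (z : ℂ) :
    wave (fun n => ζ * (e ^ n * c n)) z = ζ * wave c (e * z) := by
  rw [wave, wave, holo_rotate ζ e hc, norm_mul, he, one_mul]
  ring

lemma EqUpToRotations.coords {u : ℂ → ℂ} {c : ℕ → ℂ} (hc : SqSummable c)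
    (h : EqUpToRotations u (wave c)) :
    ∃ ζ e : ℂ, ‖ζ‖ = 1 ∧ ‖e‖ = 1 ∧ u = wave (fun n => ζ * (e ^ n * c n)) := by
  obtain ⟨γ, θ, rfl⟩ := h
  refine ⟨_, _, Complex.norm_exp_ofReal_mul_I γ, Complex.norm_exp_ofReal_mul_I θ, ?_⟩
  funext z
  rw [wave_rotate _ (Complex.norm_exp_ofReal_mul_I θ) hc]
  rfl

lemma bil_rotate (ζ e : ℂ) (c : ℕ → ℂ) (k : ℕ) :
    bil (fun n => ζ * (e ^ n * c n)) (fun n => ζ * (e ^ n * c n)) k = ζ ^ 2 * e ^ k * bil c c k := by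
  simp only [bil, Finset.mul_sum]
  refine Finset.sum_congr rfl fun p hp => ?_
  rw [← Finset.HasAntidiagonal.mem_antidiagonal.1 hp, pow_add]
  ring

/-- Rotations preserve the constraint and the energy. -/
lemma EqUpToRotations.energy_eq {u v : ℂ → ℂ} (h : EqUpToRotations u v) (hv : v ∈ unitMass)
    (μ : ℝ) : u ∈ unitMass ∧ energy μ u = energy μ v := by
  obtain ⟨c, hc, hm, rfl⟩ := exists_coords_of_unitMass hv
  obtain ⟨ζ, e, hζ, he, rfl⟩ := h.coords hc
  set c' : ℕ → ℂ := fun n => ζ * (e ^ n * c n) with hc'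
  have hn : ∀ n, ‖c' n‖ = ‖c n‖ := fun n => by simp [hc', hζ, he]
  have hs : SqSummable c' := by
    refine Summable.congr hc fun n => ?_
    rw [hn]
  have hm' : msq c' = msq c := by simp only [msq, hn]
  refine ⟨wave_mem_unitMass hs (hm'.trans hm), ?_⟩
  have hww : WSummable c' ↔ WSummable c := by simp only [WSummable, hn]
  by_cases hw : WSummable c
  · have hw' := hww.2 hw
    have hE : en c' = en c := by
      simp only [en, msq, hc', bil_rotate, norm_mul, norm_pow, hζ, he, one_pow, one_mul]
    rw [energy_wave hw, energy_wave hw', coordEnergy, coordEnergy, hm', hE, kin_zero hw,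
      kin_zero hw']
    simp only [hn]
  · rw [energy, energy, if_neg (by rwa [weightedNorm_wave_lt_top hs, hww]),
      if_neg (by rwa [weightedNorm_wave_lt_top hc])]

lemma IsGlobalMinimizer.of_eqUpToRotations {μ : ℝ} {u v : ℂ → ℂ} (hv : IsGlobalMinimizer μ v)
    (h : EqUpToRotations u v) : IsGlobalMinimizer μ u := by
  obtain ⟨h1, h2⟩ := h.energy_eq hv.1 μ
  exact ⟨h1, fun w hw => by rw [h2]; exact hv.2 w hw⟩

lemma centred_apply (x y z : ℂ) : centred x y z =
    Complex.exp (-((‖z‖ ^ 2 / 2 : ℝ) : ℂ)) *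
      (Complex.exp (-((starRingEnd ℂ) x * y) * z - ((‖x * y‖ ^ 2 / 2 : ℝ) : ℂ)) *
        ((x + y * (z + x * (starRingEnd ℂ) y)) / (√Real.pi : ℝ))) := by
  have e : wave (twoCoef x y) = fun w => Complex.exp (-((‖w‖ ^ 2 / 2 : ℝ) : ℂ)) *
      holo (twoCoef x y) w := rfl
  rw [centred, e, trans_eq_exp_mul, holo_twoCoef, norm_neg, norm_mul, RCLike.norm_conj, ← norm_mul,
    map_neg, map_mul, Complex.conj_conj, sub_neg_eq_add]

/-- The parameter b is |x|/|y|, with x ≤ 0 < y; the zero is at b + b/(1+b²), the second summand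
coming from the translation. -/
lemma psi_eq_centred (b : ℝ) :
    psi b = centred ((-(b / √(1 + b ^ 2)) : ℝ) : ℂ) ((1 / √(1 + b ^ 2) : ℝ) : ℂ) := by
  have hb : (0 : ℝ) < 1 + b ^ 2 := by positivity
  have hs : √(1 + b ^ 2) ^ 2 = 1 + b ^ 2 := Real.sq_sqrt hb.le
  have hxy : -(b / √(1 + b ^ 2)) * (1 / √(1 + b ^ 2)) = -(b / (1 + b ^ 2)) := by
    rw [neg_mul, div_mul_div_comm, mul_one, ← sq, hs]
  funext z
  rw [centred_apply, psi, Complex.conj_ofReal, Complex.conj_ofReal, ← Complex.ofReal_mul, hxy,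
    Complex.norm_real, Real.norm_eq_abs, sq_abs, Real.sqrt_mul Real.pi_pos.le]
  have e1 : Complex.exp (-((-(b / (1 + b ^ 2)) : ℝ) : ℂ) * z -
      (((-(b / (1 + b ^ 2))) ^ 2 / 2 : ℝ) : ℂ)) = Complex.exp (((b / (1 + b ^ 2) : ℝ) : ℂ) * z) *
        (Real.exp (-(1 / 2) * (b / (1 + b ^ 2)) ^ 2) : ℝ) := by
    rw [Complex.ofReal_exp, ← Complex.exp_add]
    congr 1
    push_cast
    ring
  have e2 : Complex.exp (((b / (1 + b ^ 2) : ℝ) : ℂ) * z - ((‖z‖ ^ 2 / 2 : ℝ) : ℂ)) =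
      Complex.exp (((b / (1 + b ^ 2) : ℝ) : ℂ) * z) *
        Complex.exp (-((‖z‖ ^ 2 / 2 : ℝ) : ℂ)) := by
    rw [← Complex.exp_add, sub_eq_add_neg]
  have e3 : ((-(b / √(1 + b ^ 2)) : ℝ) : ℂ) + ((1 / √(1 + b ^ 2) : ℝ) : ℂ) *
      (z + ((-(b / (1 + b ^ 2)) : ℝ) : ℂ)) =
      ((1 / √(1 + b ^ 2) : ℝ) : ℂ) * (z - ((b * (2 + b ^ 2) / (1 + b ^ 2) : ℝ) : ℂ)) := by
    have e4 : b * (2 + b ^ 2) / (1 + b ^ 2) = b + b / (1 + b ^ 2) := by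
      field_simp; ring
    rw [e4]
    push_cast
    ring
  rw [e1, e2, e3, Complex.ofReal_div (Real.exp _), Complex.ofReal_div 1, Complex.ofReal_mul (√_),
    Complex.ofReal_one]
  ring

lemma psi_zero : psi 0 = phi 1 := by
  funext z
  simp [psi, phi]

/-- The energy of `ψ_b` at the parameter one half is one. -/
lemma psi_coords (b : ℝ) : ∃ c, WSummable c ∧ psi b = wave c ∧ msq c = 1 ∧
    coordEnergy (1 / 2) c = 1 := by
  have hb : (0 : ℝ) < 1 + b ^ 2 := by positivity
  have hs : √(1 + b ^ 2) ^ 2 = 1 + b ^ 2 := Real.sq_sqrt hb.le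
  obtain ⟨c, hc, hw, hm, he, hk⟩ := centred_coords (x := ((-(b / √(1 + b ^ 2)) : ℝ) : ℂ))
    (y := ((1 / √(1 + b ^ 2) : ℝ) : ℂ)) (by
      rw [Complex.norm_real, Complex.norm_real, Real.norm_eq_abs, Real.norm_eq_abs, sq_abs, sq_abs,
        neg_sq, div_pow, div_pow, hs]
      field_simp
      ring)
  refine ⟨c, hc, by rw [psi_eq_centred, hw], hm, ?_⟩
  rw [coordEnergy, he, hk]
  ring

/-! ### Reduction of the centred family by rotations -/

lemma exists_phase {w : ℂ} (hw : ‖w‖ = 1) : ∃ γ : ℝ, Complex.exp (γ * Complex.I) = w := by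
  refine ⟨w.arg, ?_⟩
  have := Complex.norm_mul_exp_arg_mul_I w
  rwa [hw, Complex.ofReal_one, one_mul] at this

lemma eqUpToRotations_of_phase {u v : ℂ → ℂ} {ζ e : ℂ} (hζ : ‖ζ‖ = 1) (he : ‖e‖ = 1)
    (h : ∀ z, u z = ζ * v (e * z)) : EqUpToRotations u v := by
  obtain ⟨γ, rfl⟩ := exists_phase hζ
  obtain ⟨θ, rfl⟩ := exists_phase he
  exact ⟨γ, θ, funext h⟩

lemma exists_norm_mul_phase (w : ℂ) : ∃ e : ℂ, ‖e‖ = 1 ∧ w = ‖w‖ * e :=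
  ⟨Complex.exp (w.arg * Complex.I), Complex.norm_exp_ofReal_mul_I _,
    (Complex.norm_mul_exp_arg_mul_I w).symm⟩

/-- The two phases of x and y are matched by the two rotations, so only the ratio |x|/|y| is an
invariant. -/
lemma centred_rotate {x y : ℂ} {p q : ℂ} (hp : ‖p‖ = 1) (hq : ‖q‖ = 1) (z : ℂ) :
    centred (x * p) (y * q) z = p * centred x y (q * (starRingEnd ℂ) p * z) := by
  have hp2 : p * (starRingEnd ℂ) p = 1 := by
    rw [Complex.mul_conj, Complex.normSq_eq_norm_sq, hp]; simp
  have hq2 : q * (starRingEnd ℂ) q = 1 := by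
    rw [Complex.mul_conj, Complex.normSq_eq_norm_sq, hq]; simp
  rw [centred_apply, centred_apply]
  have e1 : ‖q * (starRingEnd ℂ) p * z‖ = ‖z‖ := by
    rw [norm_mul, norm_mul, RCLike.norm_conj, hp, hq, one_mul, one_mul]
  have e2 : ‖x * p * (y * q)‖ = ‖x * y‖ := by
    simp only [norm_mul, hp, hq, mul_one]
  have e3 : -((starRingEnd ℂ) (x * p) * (y * q)) * z =
      -((starRingEnd ℂ) x * y) * (q * (starRingEnd ℂ) p * z) := by
    rw [map_mul]; ring
  rw [e1, e2, e3]
  simp only [map_mul]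
  have e4 : x * p + y * q * (z + x * p * ((starRingEnd ℂ) y * (starRingEnd ℂ) q)) =
      p * (x + y * (q * (starRingEnd ℂ) p * z + x * (starRingEnd ℂ) y)) := by
    linear_combination (x * y * (starRingEnd ℂ) y * p) * hq2 - y * q * z * hp2
  rw [e4]
  ring

lemma centred_eqUpToRotations {x y : ℂ} (h : ‖x‖ ^ 2 + ‖y‖ ^ 2 = 1) :
    (y = 0 ∧ EqUpToRotations (centred x y) (phi 0)) ∨
      (y ≠ 0 ∧ EqUpToRotations (centred x y) (psi (‖x‖ / ‖y‖))) := by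
  rcases eq_or_ne y 0 with rfl | hy
  · refine Or.inl ⟨rfl, eqUpToRotations_of_phase (ζ := x) (e := 1) ?_ (by simp) fun z => ?_⟩
    · rw [norm_zero] at h
      nlinarith [norm_nonneg x]
    · rw [centred_apply, phi]
      simp
      ring
  · refine Or.inr ⟨hy, ?_⟩
    obtain ⟨p, hp, hxp⟩ := exists_norm_mul_phase (-x)
    obtain ⟨q, hq, hyq⟩ := exists_norm_mul_phase y
    have hy0 : 0 < ‖y‖ := norm_pos_iff.2 hy
    have hs : √(1 + (‖x‖ / ‖y‖) ^ 2) = 1 / ‖y‖ := by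
      rw [div_pow, one_add_div (by positivity), add_comm, h, Real.sqrt_div (by norm_num),
        Real.sqrt_one, Real.sqrt_sq hy0.le]
    rw [psi_eq_centred, hs]
    have e1 : -(‖x‖ / ‖y‖ / (1 / ‖y‖)) = -‖x‖ := by field_simp
    rw [e1, one_div_one_div]
    refine eqUpToRotations_of_phase hp (e := q * (starRingEnd ℂ) p) ?_ fun z => ?_
    · rw [norm_mul, RCLike.norm_conj, hp, hq, one_mul]
    · rw [← centred_rotate hp hq, ← hyq]
      congr 1
      rw [norm_neg] at hxp
      push_cast
      linear_combination -hxp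

/-! ### Entire functions of order two with finitely many zeros -/

/-- Cauchy's estimate, as a single term of Parseval on the circle. -/
lemma IsEntireSeries.norm_coef_mul_pow_le {a : ℕ → ℂ} {g : ℂ → ℂ} (h : IsEntireSeries a g) {r M : ℝ}
    (hr : 0 ≤ r) (hM : ∀ z : ℂ, ‖z‖ = r → ‖g z‖ ≤ M) (n : ℕ) : ‖a n‖ * r ^ n ≤ M := by
  have hM0 : 0 ≤ M := (norm_nonneg _).trans (hM r (by simp [abs_of_nonneg hr]))
  have h1 := lintegral_circle h r
  have h2 : ∫⁻ θ in Set.Ioo (-Real.pi) Real.pi, ‖g (r * Complex.exp (θ * Complex.I))‖ₑ ^ 2 ≤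
      ENNReal.ofReal (2 * Real.pi * M ^ 2) := by
    calc _ ≤ ∫⁻ θ : ℝ in Set.Ioo (-Real.pi) Real.pi, ENNReal.ofReal (M ^ 2) := by
          refine lintegral_mono fun θ => ?_
          rw [← ofReal_norm, ← ENNReal.ofReal_pow (norm_nonneg _)]
          refine ENNReal.ofReal_le_ofReal (pow_le_pow_left₀ (norm_nonneg _) (hM _ ?_) 2)
          rw [norm_mul, Complex.norm_exp_ofReal_mul_I, mul_one, Complex.norm_real,
            Real.norm_of_nonneg hr]
      _ = _ := by
          rw [lintegral_const, Measure.restrict_apply_univ, Real.volume_Ioo,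
            ← ENNReal.ofReal_mul (by positivity)]
          congr 1
          ring
  rw [h1] at h2
  have h3 := (ENNReal.le_tsum n).trans h2
  rw [ENNReal.ofReal_le_ofReal_iff (by positivity)] at h3
  have h4 : (‖a n‖ * r ^ n) ^ 2 ≤ M ^ 2 := by
    have h5 : ‖a n‖ ^ 2 * r ^ (2 * n) ≤ M ^ 2 := le_of_mul_le_mul_left h3 (by positivity)
    rw [mul_pow, ← pow_mul, mul_comm n 2]
    exact h5
  exact abs_le_of_sq_le_sq' h4 hM0 |>.2

lemma IsEntireSeries.coef_eq_zero_of_growth {a : ℕ → ℂ} {g : ℂ → ℂ} (h : IsEntireSeries a g)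
    {C : ℝ} {N : ℕ} (hg : ∀ z, ‖g z‖ ≤ C * (1 + ‖z‖) ^ N) {n : ℕ} (hn : N < n) : a n = 0 := by
  have hC : 0 ≤ C := by simpa using (norm_nonneg _).trans (hg 0)
  by_contra ha
  have ha' : 0 < ‖a n‖ := norm_pos_iff.2 ha
  have key : ∀ r : ℝ, 1 ≤ r → ‖a n‖ * r ≤ C * 2 ^ N := by
    intro r hr
    have h0 : 0 < r := by linarith
    have h1 := h.norm_coef_mul_pow_le h0.le (M := C * (1 + r) ^ N) (fun z hz => hz ▸ hg z) n
    have h2 : C * (1 + r) ^ N ≤ C * 2 ^ N * r ^ N := by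
      rw [mul_assoc, ← mul_pow]
      gcongr
      linarith
    have h3 : r * r ^ N ≤ r ^ n := by
      rw [← pow_succ']
      exact pow_le_pow_right₀ hr hn
    have h4 : (‖a n‖ * r) * r ^ N ≤ (C * 2 ^ N) * r ^ N := by
      calc (‖a n‖ * r) * r ^ N = ‖a n‖ * (r * r ^ N) := by ring
        _ ≤ ‖a n‖ * r ^ n := by gcongr
        _ ≤ _ := h1.trans h2
    exact le_of_mul_le_mul_right h4 (by positivity)
  have h1 := key (max 1 ((C * 2 ^ N + 1) / ‖a n‖)) (le_max_left _ _)
  have h2 : ‖a n‖ * ((C * 2 ^ N + 1) / ‖a n‖) ≤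
      ‖a n‖ * max 1 ((C * 2 ^ N + 1) / ‖a n‖) := by gcongr; exact le_max_right _ _
  rw [mul_div_cancel₀ _ ha'.ne'] at h2
  linarith

/-- Removal of one zero of an entire function. -/
lemma exists_eq_pow_mul {f : ℂ → ℂ} (hf : Differentiable ℂ f) {z₀ : ℂ}
    (h : ¬∀ᶠ z in nhds z₀, f z = 0) : ∃ (n : ℕ) (g : ℂ → ℂ), Differentiable ℂ g ∧ g z₀ ≠ 0 ∧
      ∀ z, f z = (z - z₀) ^ n * g z := by
  have han : AnalyticAt ℂ f z₀ := hf.analyticAt z₀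
  obtain ⟨n, hn⟩ := ENat.ne_top_iff_exists.1 (mt analyticOrderAt_eq_top.1 h)
  obtain ⟨g, hg, hg0, hfg⟩ := han.analyticOrderAt_eq_natCast.1 hn.symm
  have hk : ∀ z, z ≠ z₀ → Function.update (fun z => f z / (z - z₀) ^ n) z₀ (g z₀) z =
      f z / (z - z₀) ^ n := fun z hz => Function.update_of_ne hz _ _
  have hloc : Function.update (fun z => f z / (z - z₀) ^ n) z₀ (g z₀) =ᶠ[nhds z₀] g := by
    filter_upwards [hfg] with z hz
    rcases eq_or_ne z z₀ with rfl | hne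
    · exact Function.update_self _ _ _
    · rw [hk z hne, hz, smul_eq_mul, mul_div_cancel_left₀ _ (pow_ne_zero n (sub_ne_zero.2 hne))]
  refine ⟨n, Function.update (fun z => f z / (z - z₀) ^ n) z₀ (g z₀), fun z => ?_, by simpa, fun z => ?_⟩
  · rcases eq_or_ne z z₀ with rfl | hne
    · exact hg.differentiableAt.congr_of_eventuallyEq hloc
    · have h1 : DifferentiableAt ℂ (fun z => f z / (z - z₀) ^ n) z :=
        (hf z).div (by fun_prop) (pow_ne_zero n (sub_ne_zero.2 hne))
      refine h1.congr_of_eventuallyEq ?_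
      filter_upwards [isOpen_ne.mem_nhds hne] with w hw using hk w hw
  · rcases eq_or_ne z z₀ with rfl | hne
    · rw [Function.update_self]
      simpa using hfg.self_of_nhds
    · rw [hk z hne, mul_div_cancel₀ _ (pow_ne_zero n (sub_ne_zero.2 hne))]

lemma not_eventually_zero_of_finite {f : ℂ → ℂ} (h : {z | f z = 0}.Finite) (z₀ : ℂ) :
    ¬∀ᶠ z in nhds z₀, f z = 0 := fun h0 => (infinite_of_mem_nhds z₀ h0) h

/-- Induction on the zero set, dividing out one zero with its full multiplicity at each stage. -/
lemma exists_polynomial_mul {f : ℂ → ℂ} (hf : Differentiable ℂ f) (h : {z | f z = 0}.Finite) :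
    ∃ (p : Polynomial ℂ) (g : ℂ → ℂ), Differentiable ℂ g ∧ (∀ z, g z ≠ 0) ∧
      ∀ z, f z = p.eval z * g z := by
  obtain ⟨s, hs⟩ : ∃ s : Finset ℂ, {z | f z = 0} = s := ⟨h.toFinset, by simp⟩
  clear h
  induction s using Finset.induction_on generalizing f with
  | empty =>
    refine ⟨1, f, hf, fun z hz => ?_, by simp⟩
    have : z ∈ {z | f z = 0} := hz
    rw [hs] at this
    simp at this
  | insert z₀ s hz₀ ih =>
    obtain ⟨n, g, hg, hg0, hfg⟩ := exists_eq_pow_mul hf (not_eventually_zero_of_finite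
      (hs ▸ Finset.finite_toSet _) z₀)
    obtain ⟨p, k, hk, hk0, hgk⟩ := ih hg (by
      ext z
      have hz : f z = 0 ↔ z = z₀ ∨ z ∈ s := by
        have : z ∈ {z | f z = 0} ↔ z ∈ ((insert z₀ s : Finset ℂ) : Set ℂ) := by rw [hs]
        simpa using this
      simp only [Set.mem_ofPred_eq, Finset.mem_coe]
      constructor
      · intro h0
        refine (hz.1 (by rw [hfg, h0, mul_zero])).resolve_left ?_
        rintro rfl
        exact hg0 h0
      · intro h0
        have hne : z ≠ z₀ := by rintro rfl; exact hz₀ h0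
        have := hz.2 (Or.inr h0)
        rw [hfg] at this
        exact (mul_eq_zero.1 this).resolve_left (pow_ne_zero n (sub_ne_zero.2 hne)))
    refine ⟨(Polynomial.X - Polynomial.C z₀) ^ n * p, k, hk, hk0, fun z => ?_⟩
    rw [hfg, hgk]
    simp [mul_assoc]

/-- A primitive g of h'/h with g(0) = log h(0) makes h·e^{-g} constant and equal to one. -/
lemma exists_eq_exp {h : ℂ → ℂ} (hd : Differentiable ℂ h) (h0 : ∀ z, h z ≠ 0) :
    ∃ g : ℂ → ℂ, Differentiable ℂ g ∧ ∀ z, h z = Complex.exp (g z) := by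
  have hd' : Differentiable ℂ (deriv h) := by
    have := (hd.contDiff (n := 2)).differentiable_deriv_two
    exact this
  obtain ⟨g, hg0, hg⟩ := Complex.IsExactOn.with_val_at
    (Differentiable.isExactOn_univ (hd'.div hd h0)) 0 (Complex.log (h 0))
  have hg' := fun x => hg x (Set.mem_univ x)
  refine ⟨g, fun x => (hg' x).differentiableAt, fun z => ?_⟩
  have hc : ∀ x, HasDerivAt (fun y => h y * Complex.exp (-g y)) 0 x := by
    intro x
    have h2 := (hd x).hasDerivAt.mul (hg' x).neg.cexp
    have e : deriv h x * Complex.exp (-g x) + h x * (Complex.exp (-g x) * -(deriv h / h) x) = 0 := by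
      rw [Pi.div_apply]
      have := h0 x
      field_simp
      ring
    rw [← e]
    exact h2
  have h3 := is_const_of_deriv_eq_zero (fun x => (hc x).differentiableAt) (fun x => (hc x).deriv) z 0
  simp only [hg0, Complex.exp_neg, Complex.exp_log (h0 0), mul_inv_cancel₀ (h0 0)] at h3
  rwa [mul_inv_eq_one₀ (Complex.exp_ne_zero _)] at h3

/-- An entire function whose real part grows at most quadratically is a quadratic polynomial. -/
lemma quadratic_of_re_le {g : ℂ → ℂ} (hg : Differentiable ℂ g) {A : ℝ}
    (h : ∀ z, (g z).re ≤ A * (1 + ‖z‖) ^ 2) : ∃ p q r : ℂ, ∀ z, g z = p + q * z + r * z ^ 2 := by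
  have hb : ∀ z, ‖g z‖ ≤ (2 * (9 * (|A| + 1)) + 3 * ‖g 0‖) * (1 + ‖z‖) ^ 2 := by
    -- Borel-Carathéodory on the disc of radius 2‖z‖ + 1 converts the bound on the real part into a
    -- quadratic bound on the modulus; the coefficients beyond degree two then vanish.
    intro z
    set R := 2 * ‖z‖ + 1
    have hz := norm_nonneg z
    have hR : 0 < R := by positivity
    set M := (|A| + 1) * (1 + R) ^ 2
    have hM : 0 < M := by positivity
    have h1 := Complex.borelCaratheodory hM hg.differentiableOn (R := R) (f := g) (fun x hx => by
      simp only [Set.mem_ofPred_eq]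
      have hx' : ‖x‖ < R := by simpa using hx
      calc (g x).re ≤ A * (1 + ‖x‖) ^ 2 := h x
        _ ≤ (|A| + 1) * (1 + R) ^ 2 := by
          gcongr
          linarith [le_abs_self A]) hR (z := z) (by simp [R]; linarith)
    have hRz : R - ‖z‖ = ‖z‖ + 1 := by simp [R]; ring
    rw [hRz] at h1
    have h2 : 2 * M * ‖z‖ / (‖z‖ + 1) ≤ 2 * M := by
      rw [div_le_iff₀ (by positivity)]
      nlinarith
    have h3 : ‖g 0‖ * (R + ‖z‖) / (‖z‖ + 1) ≤ 3 * ‖g 0‖ := by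
      rw [div_le_iff₀ (by positivity)]
      have : R + ‖z‖ ≤ 3 * (‖z‖ + 1) := by simp [R]; linarith
      nlinarith [norm_nonneg (g 0), mul_le_mul_of_nonneg_left this (norm_nonneg (g 0))]
    have h4 : M ≤ 9 * (|A| + 1) * (1 + ‖z‖) ^ 2 := by
      have : (1 + R) ^ 2 ≤ 9 * (1 + ‖z‖) ^ 2 := by simp only [R]; nlinarith
      calc M ≤ (|A| + 1) * (9 * (1 + ‖z‖) ^ 2) := mul_le_mul_of_nonneg_left this (by positivity)
        _ = _ := by ring
    have h5 : ‖g 0‖ ≤ ‖g 0‖ * (1 + ‖z‖) ^ 2 :=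
      le_mul_of_one_le_right (norm_nonneg _) (by nlinarith)
    linarith
  have hs := Differentiable.isEntireSeries hg
  set a : ℕ → ℂ := fun n => (n ! : ℂ)⁻¹ * iteratedDeriv n g 0
  refine ⟨a 0, a 1, a 2, fun z => ?_⟩
  have h2 := hasSum_sum_of_ne_finset_zero (L := .unconditional ℕ)
    (f := fun n => a n * z ^ n) (s := Finset.range 3) (fun n hn => by
      rw [hs.coef_eq_zero_of_growth hb (n := n) (by simp at hn; omega), zero_mul])
  rw [(hs z).unique h2, Finset.sum_range_succ, Finset.sum_range_succ, Finset.sum_range_one, pow_zero,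
    pow_one, mul_one]

lemma exists_le_norm_eval {p : Polynomial ℂ} (hp : p ≠ 0) :
    ∃ R δ : ℝ, 0 < δ ∧ ∀ z : ℂ, R ≤ ‖z‖ → δ ≤ ‖p.eval z‖ := by
  rcases le_or_gt p.degree 0 with h | h
  · refine ⟨0, ‖p.coeff 0‖, ?_, fun z _ => ?_⟩
    · rw [norm_pos_iff]
      intro h0
      rw [Polynomial.eq_C_of_degree_le_zero h, h0] at hp
      simp at hp
    · conv_rhs => rw [Polynomial.eq_C_of_degree_le_zero h]
      simp
  · have h1 := p.tendsto_norm_atTop h (l := Filter.comap norm Filter.atTop) (z := fun z => z)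
      Filter.tendsto_comap
    have h2 := h1.eventually_ge_atTop 1
    rw [Filter.eventually_comap] at h2
    obtain ⟨R, hR⟩ := Filter.eventually_atTop.1 h2
    exact ⟨R, 1, one_pos, fun z hz => hR _ hz z rfl⟩

lemma exists_norm_eval_le (p : Polynomial ℂ) :
    ∃ (N : ℕ) (C : ℝ), 0 ≤ C ∧ ∀ z : ℂ, ‖p.eval z‖ ≤ C * (1 + ‖z‖) ^ N := by
  refine ⟨p.natDegree, ∑ i ∈ Finset.range (p.natDegree + 1), ‖p.coeff i‖,
    Finset.sum_nonneg fun _ _ => norm_nonneg _, fun z => ?_⟩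
  rw [Polynomial.eval_eq_sum_range, Finset.sum_mul]
  refine (norm_sum_le _ _).trans (Finset.sum_le_sum fun i hi => ?_)
  rw [norm_mul, norm_pow]
  have : ‖z‖ ^ i ≤ (1 + ‖z‖) ^ p.natDegree :=
    (pow_le_pow_left₀ (norm_nonneg _) (by linarith) i).trans
      (pow_le_pow_right₀ (by linarith [norm_nonneg z]) (by simpa [Nat.lt_succ_iff] using hi))
  gcongr

/-- Entire functions of order two with finitely many zeros. -/
lemma eq_polynomial_mul_exp {f : ℂ → ℂ} (hf : Differentiable ℂ f) (h : {z | f z = 0}.Finite)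
    {C : ℝ} (hC : ∀ z, ‖f z‖ ≤ C * Real.exp (‖z‖ ^ 2 / 2)) :
    ∃ (p : Polynomial ℂ) (α γ : ℂ), p ≠ 0 ∧
      ∀ z, f z = p.eval z * Complex.exp (α * z + γ * z ^ 2) := by
  obtain ⟨p, k, hk, hk0, hfk⟩ := exists_polynomial_mul hf h
  obtain ⟨g, hg, hkg⟩ := exists_eq_exp hk hk0
  have hp : p ≠ 0 := by
    rintro rfl
    refine not_eventually_zero_of_finite h 0 (Filter.Eventually.of_forall fun z => ?_)
    rw [hfk]; simp
  obtain ⟨R, δ, hδ, hR⟩ := exists_le_norm_eval hp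
  have hC0 : 0 ≤ C := by
    have := (norm_nonneg _).trans (hC 0)
    simpa using this
  -- Outside a disc the polynomial is bounded below by δ, so the growth of f bounds Re g. The
  -- summand 1 keeps the argument of the logarithm positive.
  have h1 : ∀ z, R ≤ ‖z‖ → (g z).re ≤ Real.log (C / δ + 1) + ‖z‖ ^ 2 / 2 := by
    intro z hz
    have h2 := hC z
    rw [hfk, hkg, norm_mul, Complex.norm_exp] at h2
    have h3 : Real.exp (g z).re ≤ (C / δ + 1) * Real.exp (‖z‖ ^ 2 / 2) := by
      have h4 : δ * Real.exp (g z).re ≤ C * Real.exp (‖z‖ ^ 2 / 2) :=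
        (mul_le_mul_of_nonneg_right (hR z hz) (Real.exp_nonneg _)).trans h2
      rw [← mul_le_mul_iff_right₀ hδ]
      calc _ ≤ C * Real.exp (‖z‖ ^ 2 / 2) := h4
        _ ≤ C * Real.exp (‖z‖ ^ 2 / 2) + δ * Real.exp (‖z‖ ^ 2 / 2) :=
          le_add_of_nonneg_right (by positivity)
        _ = _ := by field_simp
    rw [← Real.exp_le_exp, Real.exp_add, Real.exp_log (by positivity)]
    exact h3
  obtain ⟨K, hK⟩ := (isCompact_closedBall (0 : ℂ) R).bddAbove_image
    (f := fun z => (g z).re) (Complex.continuous_re.comp hg.continuous).continuousOn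
  have h2 : ∀ z, (g z).re ≤ (|K| + |Real.log (C / δ + 1)| + 1) * (1 + ‖z‖) ^ 2 := by
    intro z
    have hz := norm_nonneg z
    have h5 : (1 : ℝ) ≤ (1 + ‖z‖) ^ 2 := by nlinarith
    have h6 : ‖z‖ ^ 2 / 2 ≤ (1 + ‖z‖) ^ 2 := by nlinarith
    have h7 := mul_le_mul_of_nonneg_left h5 (abs_nonneg K)
    have h8 := mul_le_mul_of_nonneg_left h5 (abs_nonneg (Real.log (C / δ + 1)))
    rcases le_total R ‖z‖ with hzR | hzR
    · have := h1 z hzR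
      nlinarith [le_abs_self (Real.log (C / δ + 1)), abs_nonneg K]
    · have := hK ⟨z, by simpa using hzR, rfl⟩
      simp only at this
      nlinarith [le_abs_self K, abs_nonneg (Real.log (C / δ + 1))]
  obtain ⟨x, α, γ, hq⟩ := quadratic_of_re_le hg h2
  refine ⟨Polynomial.C (Complex.exp x) * p, α, γ, ?_, fun z => ?_⟩
  · exact mul_ne_zero (by simp [Complex.exp_ne_zero]) hp
  · rw [hfk, hkg, hq, add_assoc, Complex.exp_add, Polynomial.eval_mul, Polynomial.eval_C]
    ring

/-! ### Growth of f and decay of the coordinates -/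

/-- Termwise 2xy ≤ l·w·x² + y²/(l·w). The free parameter l is chosen afterwards to balance the two
sums, as in Cauchy-Schwarz. -/
lemma norm_holo_le_weighted {c : ℕ → ℂ} {w : ℕ → ℝ} (hw : ∀ n, 0 < w n) {S T l : ℝ} (hl : 0 < l)
    (z : ℂ) (hS : HasSum (fun n => w n * ‖c n‖ ^ 2) S)
    (hT : HasSum (fun n => (‖z‖ ^ 2) ^ n / (n ! * w n)) T) :
    ‖holo c z‖ ≤ (l * S + T / l) / 2 := by
  have h := ((hS.mul_left l).add (hT.div_const l)).div_const 2
  refine tsum_of_norm_bounded h fun n => ?_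
  have hf : (0 : ℝ) < n ! := by positivity
  rw [norm_mul, norm_div, norm_pow, Complex.norm_real, Real.norm_of_nonneg (Real.sqrt_nonneg _)]
  have h1 : √(n ! : ℝ) ≤ √(Real.pi * n !) := by
    refine Real.sqrt_le_sqrt ?_
    nlinarith [Real.pi_gt_three]
  have h2 : 0 < √(n ! : ℝ) := Real.sqrt_pos.2 hf
  have h3 : ‖c n‖ / √(Real.pi * n !) * ‖z‖ ^ n ≤ ‖c n‖ * (‖z‖ ^ n / √(n ! : ℝ)) := by
    rw [div_mul_eq_mul_div, mul_div_assoc]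
    gcongr
  refine h3.trans ?_
  have h4 : (‖z‖ ^ 2) ^ n / (n ! * w n) = (‖z‖ ^ n / √(n ! : ℝ)) ^ 2 / w n := by
    rw [div_pow, Real.sq_sqrt hf.le, div_div, ← pow_mul, ← pow_mul, mul_comm 2]
  rw [h4]
  set x := ‖c n‖
  set y := ‖z‖ ^ n / √(n ! : ℝ)
  have h5 : l * (w n * x ^ 2) + y ^ 2 / w n / l - 2 * (x * y) =
      (l * w n * x - y) ^ 2 / (l * w n) := by
    have := hw n
    field_simp
    ring
  have h6 : 0 ≤ (l * w n * x - y) ^ 2 / (l * w n) := by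
    have := hw n
    positivity
  linarith

lemma SqSummable.norm_holo_le {c : ℕ → ℂ} (hc : SqSummable c) (z : ℂ) :
    ‖holo c z‖ ≤ (msq c + 1) / 2 * Real.exp (‖z‖ ^ 2 / 2) := by
  have hT := NormedSpace.expSeries_div_hasSum_exp (‖z‖ ^ 2)
  rw [← Real.exp_eq_exp_ℝ] at hT
  have h := norm_holo_le_weighted (w := fun _ => 1) (fun _ => one_pos) (Real.exp_pos (‖z‖ ^ 2 / 2)) z
    (by simpa using Summable.hasSum hc) (by simpa using hT)
  have e : Real.exp (‖z‖ ^ 2) / Real.exp (‖z‖ ^ 2 / 2) = Real.exp (‖z‖ ^ 2 / 2) := by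
    rw [← Real.exp_sub]; congr 1; ring
  rw [e] at h
  simp only [msq]
  linarith

/-- The weight n + 1 replaces e^{|z|²} by (e^{|z|²} - 1)/|z|². The gain 1/|z| is what rules out the
borderline Gaussian type |γ| = 1/2. -/
lemma WSummable.norm_wave_le {c : ℕ → ℂ} (hc : WSummable c) :
    ∃ K : ℝ, 0 ≤ K ∧ ∀ z, z ≠ 0 → ‖wave c z‖ ≤ K / ‖z‖ := by
  refine ⟨(kin 0 c + 1) / 2, by have := msq_nonneg (shiftCoef 0 c); rw [kin]; positivity,
    fun z hz => ?_⟩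
  have hz' : 0 < ‖z‖ := norm_pos_iff.2 hz
  have hT := NormedSpace.expSeries_div_hasSum_exp (‖z‖ ^ 2)
  rw [← Real.exp_eq_exp_ℝ] at hT
  have hT1 := ((hasSum_nat_add_iff' 1).2 hT).div_const (‖z‖ ^ 2)
  have hT2 : HasSum (fun n : ℕ => (‖z‖ ^ 2) ^ n / (n ! * ((n : ℝ) + 1)))
      ((Real.exp (‖z‖ ^ 2) - 1) / ‖z‖ ^ 2) := by
    simp only [Finset.sum_range_one, pow_zero, Nat.factorial_zero, Nat.cast_one, div_one] at hT1
    refine hT1.congr_fun ?_ |> id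
    intro n
    rw [Nat.factorial_succ, pow_succ]
    push_cast
    field_simp
    ring
  have hS := Summable.hasSum hc
  rw [← kin_zero hc] at hS
  have h := norm_holo_le_weighted (w := fun n => (n : ℝ) + 1) (fun n => by positivity)
    (l := Real.exp (‖z‖ ^ 2 / 2) / ‖z‖) (by positivity) z hS hT2
  have e : Real.exp (‖z‖ ^ 2) = Real.exp (‖z‖ ^ 2 / 2) * Real.exp (‖z‖ ^ 2 / 2) := by
    rw [← Real.exp_add]; congr 1; ring
  have h2 : (Real.exp (‖z‖ ^ 2) - 1) / ‖z‖ ^ 2 / (Real.exp (‖z‖ ^ 2 / 2) / ‖z‖) ≤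
      Real.exp (‖z‖ ^ 2 / 2) / ‖z‖ := by
    rw [div_le_iff₀ (by positivity), e]
    rw [div_mul_div_comm, ← _root_.sq ‖z‖]
    gcongr
    linarith
  rw [norm_wave, Real.exp_neg]
  calc _ ≤ (Real.exp (‖z‖ ^ 2 / 2))⁻¹ * ((Real.exp (‖z‖ ^ 2 / 2) / ‖z‖ * kin 0 c +
        Real.exp (‖z‖ ^ 2 / 2) / ‖z‖) / 2) := by gcongr; linarith
    _ = _ := by
      have := Real.exp_pos (‖z‖ ^ 2 / 2)
      field_simp

/-- Gaussian growth of small type gives geometric decay of the coordinates. -/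
lemma norm_le_geom_of_growth {c : ℕ → ℂ} (hc : SqSummable c) {C κ : ℝ} (hκ : 0 ≤ κ) (hκ1 : κ < 1)
    (h : ∀ z, ‖holo c z‖ ≤ C * Real.exp (κ * ‖z‖ ^ 2 / 2)) :
    ∃ r : ℝ, 0 < r ∧ r < 1 ∧ ∃ K, ∀ n, ‖c n‖ ≤ K * r ^ n := by
  -- Under the weight e^{-q|z|²} the function is still square integrable since q > κ, and Parseval
  -- yields |c_n|² = O(q^n) with q < 1.
  obtain ⟨q, hq, hq1⟩ := exists_between hκ1
  have hq0 : 0 < q := by linarith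
  have hP := lintegral_gaussian hc.isEntireSeries hq0
  have hfin : ∫⁻ z : ℂ, ‖holo c z‖ₑ ^ 2 * ENNReal.ofReal (Real.exp (-(q * ‖z‖ ^ 2))) < ∞ := by
    calc _ ≤ ∫⁻ z : ℂ, ENNReal.ofReal (C ^ 2) *
          ENNReal.ofReal (Real.exp (-((q - κ) * ‖z‖ ^ 2))) := by
          refine lintegral_mono fun z => ?_
          rw [← ofReal_norm, ← ENNReal.ofReal_pow (norm_nonneg _),
            ← ENNReal.ofReal_mul (by positivity), ← ENNReal.ofReal_mul (by positivity)]
          refine ENNReal.ofReal_le_ofReal ?_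
          have e : C ^ 2 * Real.exp (-((q - κ) * ‖z‖ ^ 2)) =
              (C * Real.exp (κ * ‖z‖ ^ 2 / 2)) ^ 2 * Real.exp (-(q * ‖z‖ ^ 2)) := by
            rw [mul_pow, ← Real.exp_nat_mul, mul_assoc, ← Real.exp_add]
            congr 2
            push_cast; ring
          rw [e]
          gcongr
          exact h z
      _ < ∞ := by
          have := lintegral_norm_pow_mul_gaussian 0 (κ := q - κ) (by linarith)
          simp only [mul_zero, pow_zero, one_mul] at this
          rw [lintegral_const_mul' _ _ (by finiteness), this]
          finiteness
  rw [hP] at hfin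
  have ht : ∀ n, ‖c n / (√(Real.pi * n !) : ℝ)‖ₑ ^ 2 *
      ENNReal.ofReal (Real.pi * n ! / q ^ (n + 1)) = ENNReal.ofReal (‖c n‖ ^ 2 / q ^ (n + 1)) := by
    intro n
    have h := pi_mul_factorial_pos n
    rw [← ofReal_norm, ← ENNReal.ofReal_pow (norm_nonneg _), ← ENNReal.ofReal_mul (by positivity),
      norm_div, Complex.norm_real, Real.norm_of_nonneg (Real.sqrt_nonneg _), div_pow,
      Real.sq_sqrt h.le]
    congr 1
    field_simp
  simp only [ht] at hfin
  set S := (∑' n, ENNReal.ofReal (‖c n‖ ^ 2 / q ^ (n + 1))).toReal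
  refine ⟨√q, Real.sqrt_pos.2 hq0, by rw [Real.sqrt_lt' one_pos]; simpa using hq1, √(S * q),
    fun n => ?_⟩
  have h1 : ‖c n‖ ^ 2 / q ^ (n + 1) ≤ S := by
    rw [← ENNReal.toReal_ofReal (by positivity : 0 ≤ ‖c n‖ ^ 2 / q ^ (n + 1))]
    exact ENNReal.toReal_mono hfin.ne (ENNReal.le_tsum n)
  rw [div_le_iff₀ (by positivity)] at h1
  refine (abs_le_of_sq_le_sq' (h1.trans (le_of_eq ?_)) (by positivity)).2
  have hS : 0 ≤ S := ENNReal.toReal_nonneg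
  rw [mul_pow, Real.sq_sqrt (by positivity), ← pow_mul, mul_comm n 2, pow_mul,
    Real.sq_sqrt hq0.le]
  ring

/-- Geometric decay of the coordinates gives Gaussian growth of small type. -/
lemma norm_holo_le_of_geom {c : ℕ → ℂ} {s : ℝ} (hs : 0 < s)
    (h : ∃ K, ∀ n, ‖c n‖ ≤ K * (s / 2) ^ n) :
    ∃ C, ∀ z, ‖holo c z‖ ≤ C * Real.exp (s ^ 2 * ‖z‖ ^ 2 / 2) := by
  obtain ⟨K, hK⟩ := h
  -- Rescaling: f at z is the function with coordinates d at sz, and d is still square summable.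
  set d : ℕ → ℂ := fun n => c n / (s : ℂ) ^ n with hd
  have hs0 : (s : ℂ) ≠ 0 := by exact_mod_cast hs.ne'
  have hdn : ∀ n, ‖d n‖ ≤ K * (1 / 2) ^ n := by
    intro n
    rw [hd, norm_div, norm_pow, Complex.norm_real, Real.norm_of_nonneg hs.le,
      div_le_iff₀ (by positivity), mul_assoc, ← mul_pow,
      one_div_mul_eq_div]
    exact hK n
  have hds : SqSummable d := by
    refine Summable.of_nonneg_of_le (fun _ => by positivity) (fun n => ?_)
      ((summable_geometric_of_lt_one (r := 1 / 4) (by norm_num) (by norm_num)).mul_left (K ^ 2))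
    calc ‖d n‖ ^ 2 ≤ (K * (1 / 2) ^ n) ^ 2 := by gcongr; exact hdn n
      _ = _ := by rw [mul_pow, ← pow_mul, mul_comm n 2, pow_mul]; norm_num
  refine ⟨(msq d + 1) / 2, fun z => ?_⟩
  have e : holo c z = holo d (s * z) := by
    simp only [holo, hd]
    refine tsum_congr fun n => ?_
    rw [mul_pow]
    field_simp
  have h1 := hds.norm_holo_le (s * z)
  rw [norm_mul, Complex.norm_real, Real.norm_of_nonneg hs.le, mul_pow] at h1
  rwa [e]

/-- Choose e with γe² = |γ|; the sign of e is still free and is used to make Re(αe) nonnegative. -/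
lemma exists_direction (α γ : ℂ) : ∃ e : ℂ, ‖e‖ = 1 ∧ ∀ ρ : ℝ, 0 ≤ ρ →
    ‖γ‖ * ρ ^ 2 ≤ (α * (ρ * e) + γ * (ρ * e) ^ 2).re := by
  obtain ⟨ε, hε, hγ⟩ := exists_norm_mul_phase γ
  obtain ⟨e, he⟩ := IsAlgClosed.exists_pow_nat_eq ((starRingEnd ℂ) ε) two_pos
  have hen : ‖e‖ = 1 := by
    have : ‖e‖ ^ 2 = 1 := by rw [← norm_pow, he, RCLike.norm_conj, hε]
    nlinarith [norm_nonneg e]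
  have hεe : ε * e ^ 2 = 1 := by
    rw [he, Complex.mul_conj, Complex.normSq_eq_norm_sq, hε]; simp
  have key : ∀ e' : ℂ, e' ^ 2 = e ^ 2 → 0 ≤ (α * e').re → ∀ ρ : ℝ, 0 ≤ ρ →
      ‖γ‖ * ρ ^ 2 ≤ (α * (ρ * e') + γ * (ρ * e') ^ 2).re := by
    intro e' he' hre ρ hρ
    have h1 : α * (ρ * e') + γ * (ρ * e') ^ 2 = (ρ : ℂ) * (α * e') + ((‖γ‖ * ρ ^ 2 : ℝ) : ℂ) := by
      rw [mul_pow, he']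
      nth_rewrite 1 [hγ]
      push_cast
      linear_combination (‖γ‖ * ρ ^ 2 : ℂ) * hεe
    rw [h1, Complex.add_re, Complex.re_ofReal_mul, Complex.ofReal_re]
    have := mul_nonneg hρ hre
    linarith
  rcases le_total 0 (α * e).re with h | h
  · exact ⟨e, hen, key e rfl h⟩
  · refine ⟨-e, by rwa [norm_neg], key (-e) (by ring) ?_⟩
    rw [mul_neg, Complex.neg_re]
    linarith

lemma exists_ray_bound {p : Polynomial ℂ} (hp : p ≠ 0) (α γ : ℂ) :
    ∃ R δ : ℝ, 0 < R ∧ 0 < δ ∧ ∀ ρ : ℝ, R ≤ ρ → ∃ z : ℂ, ‖z‖ = ρ ∧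
      δ * Real.exp (‖γ‖ * ρ ^ 2) ≤ ‖p.eval z * Complex.exp (α * z + γ * z ^ 2)‖ := by
  obtain ⟨e, he, hray⟩ := exists_direction α γ
  obtain ⟨R, δ, hδ, hR⟩ := exists_le_norm_eval hp
  refine ⟨max R 1, δ, by positivity, hδ, fun ρ hρ => ?_⟩
  have hρ0 : 0 ≤ ρ := by linarith [le_max_right R 1]
  have hn : ‖(ρ : ℂ) * e‖ = ρ := by rw [norm_mul, he, mul_one, Complex.norm_real, Real.norm_of_nonneg hρ0]
  refine ⟨ρ * e, hn, ?_⟩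
  rw [norm_mul, Complex.norm_exp]
  have h1 := hR (ρ * e) (by rw [hn]; exact (le_max_left _ _).trans hρ)
  have h2 := hray ρ hρ0
  gcongr

/-- The polynomial and the linear exponent grow at most like e^{m|z|}, which completing the square
absorbs into the spare Gaussian growth ε|z|². -/
lemma exists_growth_bound (p : Polynomial ℂ) (α γ : ℂ) {κ : ℝ} (hκ : 2 * ‖γ‖ < κ) :
    ∃ C : ℝ, ∀ z, ‖p.eval z * Complex.exp (α * z + γ * z ^ 2)‖ ≤ C * Real.exp (κ * ‖z‖ ^ 2 / 2) := by
  obtain ⟨N, C, hC, hp⟩ := exists_norm_eval_le p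
  set ε := κ / 2 - ‖γ‖ with hε
  have hε0 : 0 < ε := by rw [hε]; linarith
  set m := N + ‖α‖ with hm
  refine ⟨C * Real.exp (m ^ 2 / (4 * ε)), fun z => ?_⟩
  have hz := norm_nonneg z
  have h1 : (1 + ‖z‖) ^ N ≤ Real.exp (N * ‖z‖) := by
    rw [Real.exp_nat_mul]
    exact pow_le_pow_left₀ (by positivity) (by linarith [Real.add_one_le_exp ‖z‖]) N
  have h2 : (α * z + γ * z ^ 2).re ≤ ‖α‖ * ‖z‖ + ‖γ‖ * ‖z‖ ^ 2 := by
    refine (Complex.re_le_norm _).trans ((norm_add_le _ _).trans ?_)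
    rw [norm_mul, norm_mul, norm_pow]
  rw [norm_mul, Complex.norm_exp]
  calc _ ≤ C * (1 + ‖z‖) ^ N * Real.exp (‖α‖ * ‖z‖ + ‖γ‖ * ‖z‖ ^ 2) := by
        gcongr; exact hp z
    _ ≤ C * Real.exp (N * ‖z‖) * Real.exp (‖α‖ * ‖z‖ + ‖γ‖ * ‖z‖ ^ 2) := by gcongr
    _ = C * Real.exp (m * ‖z‖ + ‖γ‖ * ‖z‖ ^ 2) := by
        rw [mul_assoc, ← Real.exp_add]; congr 2; rw [hm]; ring
    _ ≤ C * Real.exp (m ^ 2 / (4 * ε) + κ * ‖z‖ ^ 2 / 2) := by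
        refine mul_le_mul_of_nonneg_left (Real.exp_le_exp.2 ?_) hC
        have e : m ^ 2 / (4 * ε) + κ * ‖z‖ ^ 2 / 2 - (m * ‖z‖ + ‖γ‖ * ‖z‖ ^ 2) =
            (2 * ε * ‖z‖ - m) ^ 2 / (4 * ε) := by
          have : κ = 2 * (ε + ‖γ‖) := by rw [hε]; ring
          rw [this]
          field_simp
          ring
        have : 0 ≤ (2 * ε * ‖z‖ - m) ^ 2 / (4 * ε) := by positivity
        linarith
    _ = _ := by rw [Real.exp_add, mul_assoc]

lemma exists_pow_two_large (R K : ℝ) : ∃ ρ : ℝ, R ≤ ρ ∧ 0 < ρ ∧ K < ρ ∧ K < ρ ^ 2 := by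
  refine ⟨max R (max 1 (K + 1)), le_max_left _ _, ?_, ?_, ?_⟩
  · have := le_max_right R (max 1 (K + 1)); have := le_max_left 1 (K + 1); linarith
  · have := le_max_right R (max 1 (K + 1)); have := le_max_right 1 (K + 1); linarith
  · have h1 := le_max_right R (max 1 (K + 1))
    have h2 := le_max_right 1 (K + 1)
    have h3 := le_max_left 1 (K + 1)
    nlinarith

/-! ### Local minimizers with finitely many zeros -/

/-- A local minimizer with finitely many zeros is a polynomial times an exponential. -/
lemma QMin.eq_polynomial_mul_exp {μ g : ℝ} (hμ : 0 < μ) {c : ℕ → ℂ} (hc : WSummable c)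
    (hm : msq c = 1) (hq : QMin μ g 0 c) (hfin : {z | wave c z = 0}.Finite) :
    ∃ (p : Polynomial ℂ) (α : ℂ), ∀ z, holo c z = p.eval z * Complex.exp (α * z) := by
  have hz : {z | holo c z = 0} = {z | wave c z = 0} := by
    ext z
    simp [wave, Complex.exp_ne_zero]
  obtain ⟨p, α, γ, hp, hf⟩ := LLL.eq_polynomial_mul_exp hc.sq.isEntireSeries.differentiable (hz ▸ hfin)
    hc.sq.norm_holo_le
  obtain ⟨R, δ, hR, hδ, hray⟩ := exists_ray_bound hp α γ
  -- Otherwise |u| stays bounded below along points going to infinity, against the decay K/|z|.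
  have hγ : ‖γ‖ < 1 / 2 := by
    by_contra! hge
    obtain ⟨K, hK, hdec⟩ := hc.norm_wave_le
    obtain ⟨ρ, h1, h2, h3, -⟩ := exists_pow_two_large R (K / δ)
    obtain ⟨z, hzρ, hle⟩ := hray ρ h1
    have h4 := hdec z (by rw [← norm_pos_iff, hzρ]; exact h2)
    rw [norm_wave, hf, hzρ, Real.exp_neg] at h4
    have h5 : δ * Real.exp (ρ ^ 2 / 2) ≤ δ * Real.exp (‖γ‖ * ρ ^ 2) := by
      gcongr
      nlinarith [sq_nonneg ρ]
    have h6 : δ ≤ K / ρ := by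
      refine le_trans ?_ h4
      rw [← div_eq_inv_mul, le_div_iff₀ (Real.exp_pos _)]
      exact h5.trans hle
    rw [le_div_iff₀ h2] at h6
    rw [div_lt_iff₀ hδ] at h3
    linarith
  obtain ⟨κ, hκ, hκ1⟩ := exists_between (show 2 * ‖γ‖ < 1 by linarith)
  obtain ⟨C, hC⟩ := exists_growth_bound p α γ hκ
  obtain ⟨r, hr0, hr1, hr⟩ := norm_le_geom_of_growth hc.sq
    (by linarith [norm_nonneg γ] : (0 : ℝ) ≤ κ) hκ1 (fun z => by rw [hf]; exact hC z)
  obtain ⟨L, hEL⟩ := hq.euler_lagrange hc hm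
  -- Fast decay of the coordinates bounds f by a multiple of e^{|γ|ρ²/2}, while on the ray f has
  -- size at least δe^{|γ|ρ²}.
  have hγ0 : γ = 0 := by
    by_contra hne
    have hpos : 0 < ‖γ‖ := norm_pos_iff.2 hne
    have hs : 0 < √‖γ‖ := Real.sqrt_pos.2 hpos
    obtain ⟨C, hC⟩ := norm_holo_le_of_geom hs (decay_all hμ hEL hr0 hr1 hr (by positivity))
    rw [Real.sq_sqrt hpos.le] at hC
    obtain ⟨ρ, h1, h2, -, h3⟩ := exists_pow_two_large R (2 * (C / δ) / ‖γ‖)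
    obtain ⟨z, hzρ, hle⟩ := hray ρ h1
    have h4 := hC z
    rw [hf, hzρ] at h4
    have h5 := hle.trans h4
    have h6 : Real.exp (‖γ‖ * ρ ^ 2) =
        Real.exp (‖γ‖ * ρ ^ 2 / 2) * Real.exp (‖γ‖ * ρ ^ 2 / 2) := by
      rw [← Real.exp_add]; congr 1; ring
    rw [h6, ← mul_assoc] at h5
    have h7 := le_of_mul_le_mul_right h5 (Real.exp_pos _)
    have h8 := Real.add_one_le_exp (‖γ‖ * ρ ^ 2 / 2)
    rw [div_lt_iff₀ hpos] at h3
    have h9 : C / δ < Real.exp (‖γ‖ * ρ ^ 2 / 2) := by linarith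
    rw [div_lt_iff₀ hδ] at h9
    linarith
  exact ⟨p, α, fun z => by rw [hf, hγ0, zero_mul, add_zero]⟩

/-- A local minimizer with finitely many zeros is a special Hermite function. -/
lemma QMin.eq_single_of_finite {μ g : ℝ} (hμ : 0 < μ) (hμ2 : μ ≠ 1 / 2) {c : ℕ → ℂ}
    (hc : WSummable c) (hm : msq c = 1) (hq : QMin μ g 0 c) (hfin : {z | wave c z = 0}.Finite) :
    ∃ (n : ℕ) (ζ : ℂ), ‖ζ‖ = 1 ∧ wave c = wave (Pi.single n ζ) ∧ QMin μ g 0 (Pi.single n ζ) := by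
  obtain ⟨p, α, hf⟩ := hq.eq_polynomial_mul_exp hμ hc hm hfin
  -- Translation by -a turns e^{αz} into a constant, leaving a polynomial that is critical for the
  -- functional centred at -a. The vanishing of the centre then shows that there was no exponential.
  set a := (starRingEnd ℂ) α with ha
  obtain ⟨d, hd, hw, hmd, -⟩ := exists_trans hc (-a)
  have hback : wave c = trans a (wave d) := by
    have := trans_neg_trans (-a) (wave c)
    rw [neg_neg, ← hw] at this
    exact this.symm
  have hqd := hq.of_trans hd hc hback
  have hpoly : ∀ z, holo d z = (p.comp (Polynomial.X + Polynomial.C a)).eval z *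
      Complex.exp (α * a - ((‖a‖ ^ 2 / 2 : ℝ) : ℂ)) := by
    intro z
    have h1 := congrFun hw z
    have e : wave c = fun w => Complex.exp (-((‖w‖ ^ 2 / 2 : ℝ) : ℂ)) * holo c w := rfl
    rw [e, trans_eq_exp_mul, wave] at h1
    have h2 := mul_left_cancel₀ (Complex.exp_ne_zero _) h1
    rw [h2, hf, mul_left_comm, ← Complex.exp_add, norm_neg, map_neg, ha, Complex.conj_conj]
    simp only [Polynomial.eval_comp, Polynomial.eval_add, Polynomial.eval_X, Polynomial.eval_C,
      sub_neg_eq_add]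
    congr 2
    ring
  obtain ⟨N, C, hC, hN⟩ := exists_norm_eval_le (p.comp (Polynomial.X + Polynomial.C a))
  have hdz : ∀ n, N < n → d n = 0 := by
    intro n hn
    have h1 := hd.sq.isEntireSeries.coef_eq_zero_of_growth (N := N)
      (C := C * ‖Complex.exp (α * a - ((‖a‖ ^ 2 / 2 : ℝ) : ℂ))‖) (fun z => by
        rw [hpoly, norm_mul, mul_right_comm]
        gcongr
        exact hN z) hn
    refine (div_eq_zero_iff.1 h1).resolve_right ?_
    exact_mod_cast (Real.sqrt_pos.2 (pi_mul_factorial_pos n)).ne'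
  have hmd1 : msq d = 1 := hmd.trans hm
  obtain ⟨ha0, n, hn⟩ := hqd.eq_single hμ hμ2 hdz hmd1
  have hds : d = Pi.single n (d n) := by
    funext i
    rcases eq_or_ne i n with rfl | hi
    · simp
    · rw [hn i hi, Pi.single_eq_of_ne hi]
  have hnorm : ‖d n‖ = 1 := by
    rw [hds, msq_single] at hmd1
    nlinarith [norm_nonneg (d n)]
  have ha1 : a = 0 := neg_eq_zero.1 ha0
  refine ⟨n, d n, hnorm, ?_, ?_⟩
  · rw [← hds, hback, ha1]
    funext z
    simp [trans]
  · rw [← hds]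
    rwa [ha0] at hqd

/-! ### Existence by compactness -/

/-- The coordinates of unit mass with bounded second moment. -/
def momentBall (R : ℝ) : Set (ℕ → ℂ) :=
  {c | ∀ N : ℕ, ∑ n ∈ Finset.range N, ((n : ℝ) + 1) * ‖c n‖ ^ 2 ≤ R ∧
    ∑ n ∈ Finset.range N, ‖c n‖ ^ 2 ≤ 1 ∧
    1 - R / (N + 1) ≤ ∑ n ∈ Finset.range N, ‖c n‖ ^ 2}

/-- Each condition concerns finitely many coordinates, hence is closed in the product topology; the
ambient product of discs is compact. -/
lemma isCompact_momentBall (R : ℝ) : IsCompact (momentBall R) := by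
  have h1 : IsCompact (Set.univ.pi fun _ : ℕ => Metric.closedBall (0 : ℂ) 1) :=
    isCompact_univ_pi fun _ => isCompact_closedBall _ _
  refine h1.of_isClosed_subset ?_ ?_
  · simp only [momentBall, Set.ofPred_forall, Set.ofPred_and]
    refine isClosed_iInter fun N => ?_
    have c1 : Continuous fun c : ℕ → ℂ => ∑ n ∈ Finset.range N, ((n : ℝ) + 1) * ‖c n‖ ^ 2 := by
      fun_prop
    have c2 : Continuous fun c : ℕ → ℂ => ∑ n ∈ Finset.range N, ‖c n‖ ^ 2 := by
      fun_prop
    exact (isClosed_le c1 continuous_const).inter ((isClosed_le c2 continuous_const).inter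
      (isClosed_le continuous_const c2))
  · intro c hc n _
    have h2 := (hc (n + 1)).2.1
    have h3 := Finset.single_le_sum (f := fun n => ‖c n‖ ^ 2) (fun i _ => by positivity)
      (Finset.self_mem_range_succ n)
    rw [mem_closedBall_zero_iff]
    have h4 : ‖c n‖ ^ 2 ≤ 1 := h3.trans h2
    nlinarith [norm_nonneg (c n)]

/-- The lower bounds on partial sums are Chebyshev's inequality for the tail, of mass at most
R/(N+1); they prevent loss of mass in the limit. -/
lemma mem_momentBall {R : ℝ} {c : ℕ → ℂ} :
    c ∈ momentBall R ↔ WSummable c ∧ msq c = 1 ∧ kin 0 c ≤ R := by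
  constructor
  · intro h
    have hw : WSummable c := summable_of_sum_range_le (fun _ => by positivity) fun N => (h N).1
    have hR : 0 ≤ R := by simpa using (h 0).1
    refine ⟨hw, le_antisymm (hw.sq.tsum_le_of_sum_range_le fun N => (h N).2.1) ?_, ?_⟩
    · have h1 : ∀ N : ℕ, 1 - R / (N + 1) ≤ msq c := fun N =>
        (h N).2.2.trans (hw.sq.sum_le_tsum _ fun _ _ => by positivity)
      have h2 : Filter.Tendsto (fun N : ℕ => 1 - R * (1 / ((N : ℝ) + 1))) Filter.atTop
          (nhds (1 - R * 0)) := (tendsto_one_div_add_atTop_nhds_zero_nat.const_mul R).const_sub 1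
      have h3 := le_of_tendsto' h2 (b := msq c) fun N => by
        have := h1 N
        rwa [div_eq_mul_one_div] at this
      linarith
    · rw [kin_zero hw]
      exact Summable.tsum_le_of_sum_range_le hw fun N => (h N).1
  · rintro ⟨hw, hm, hk⟩ N
    rw [kin_zero hw] at hk
    have hsplit := hw.sq.sum_add_tsum_nat_add N
    have htail : (N + 1) * ∑' n, ‖c (n + N)‖ ^ 2 ≤ R := by
      have hs1 : Summable fun n => ‖c (n + N)‖ ^ 2 := (summable_nat_add_iff N).2 hw.sq
      have hs2 : Summable fun n : ℕ => (((n + N : ℕ) : ℝ) + 1) * ‖c (n + N)‖ ^ 2 :=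
        (summable_nat_add_iff (f := fun n : ℕ => ((n : ℝ) + 1) * ‖c n‖ ^ 2) N).2 hw
      have h1 := Summable.sum_add_tsum_nat_add N hw
      have h2 : 0 ≤ ∑ n ∈ Finset.range N, ((n : ℝ) + 1) * ‖c n‖ ^ 2 :=
        Finset.sum_nonneg fun _ _ => by positivity
      rw [← tsum_mul_left]
      refine (Summable.tsum_le_tsum (fun n => ?_) (hs1.mul_left _) hs2).trans
        (by linarith)
      gcongr
      linarith [(Nat.cast_nonneg n : (0 : ℝ) ≤ n)]
    refine ⟨(Summable.sum_le_tsum _ (fun _ _ => by positivity) hw).trans hk, ?_, ?_⟩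
    · rw [← hm]
      exact hw.sq.sum_le_tsum _ fun _ _ => by positivity
    · have h3 : ∑' n, ‖c (n + N)‖ ^ 2 ≤ R / (N + 1) := by
        rw [le_div_iff₀ (by positivity)]
        linarith
      rw [msq, ← hsplit] at hm
      linarith

lemma momentum_eq {c : ℕ → ℂ} (hc : WSummable c) :
    HasSum (fun n : ℕ => (n : ℝ) * ‖c n‖ ^ 2) (kin 0 c - msq c) := by
  have h1 := Summable.hasSum hc
  rw [← kin_zero hc] at h1
  refine (h1.sub (Summable.hasSum hc.sq)).congr_fun ?_ |> id
  intro n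
  ring

lemma momentum_nonneg {c : ℕ → ℂ} (hc : WSummable c) : 0 ≤ kin 0 c - msq c :=
  (momentum_eq hc).nonneg fun n => by positivity

lemma hasSum_coordEnergy (μ : ℝ) {c : ℕ → ℂ} (hc : WSummable c) :
    HasSum (fun n : ℕ => ‖bil c c n‖ ^ 2 + μ * (n * ‖c n‖ ^ 2)) (coordEnergy μ c) :=
  (Summable.hasSum (hc.sq.bil hc.sq)).add ((momentum_eq hc).mul_left μ)

/-- The energy is a sum of nonnegative continuous functions of finitely many coordinates each, so it
is lower semicontinuous and attains its minimum on the compact set. -/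
lemma exists_minimal_coords {μ : ℝ} (hμ : 0 < μ) : ∃ c, WSummable c ∧ msq c = 1 ∧
    ∀ d, WSummable d → msq d = 1 → coordEnergy μ c ≤ coordEnergy μ d := by
  obtain ⟨c₀, h0, -, hm0, he0, hk0⟩ := phi_coords 0
  have hE0 : coordEnergy μ c₀ = 1 := by
    rw [coordEnergy, he0, hk0]
    simp [gw]
  -- Since φ₀ has energy one, coordinates whose second moment exceeds this R cannot do better.
  set R := 1 / μ + 1
  have hR : 0 < 1 / μ := by positivity
  set J : (ℕ → ℂ) → ℝ≥0∞ := fun c =>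
    ∑' n : ℕ, ENNReal.ofReal (‖bil c c n‖ ^ 2 + μ * (n * ‖c n‖ ^ 2)) with hJ
  have hJE : ∀ c, WSummable c → J c = ENNReal.ofReal (coordEnergy μ c) := by
    intro c hc
    have h := hasSum_coordEnergy μ hc
    rw [← h.tsum_eq, ENNReal.ofReal_tsum_of_nonneg (fun n => by positivity) h.summable]
  have hlsc : LowerSemicontinuous J := by
    refine lowerSemicontinuous_tsum fun n => Continuous.lowerSemicontinuous ?_
    refine ENNReal.continuous_ofReal.comp ?_
    simp only [bil]
    fun_prop
  have hmem0 : c₀ ∈ momentBall R := mem_momentBall.2 ⟨h0, hm0, by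
    rw [hm0] at hk0; push_cast at hk0; linarith⟩
  obtain ⟨c, hc, hmin⟩ := (hlsc.lowerSemicontinuousOn _).exists_isMinOn ⟨c₀, hmem0⟩
    (isCompact_momentBall R)
  obtain ⟨hcw, hcm, -⟩ := mem_momentBall.1 hc
  have hle : ∀ d ∈ momentBall R, coordEnergy μ c ≤ coordEnergy μ d := by
    intro d hd
    obtain ⟨hdw, -, -⟩ := mem_momentBall.1 hd
    have h := hmin hd
    simp only [Set.mem_ofPred_eq] at h
    rw [hJE c hcw, hJE d hdw] at h
    exact (ENNReal.ofReal_le_ofReal_iff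
      ((hasSum_coordEnergy μ hdw).nonneg fun n => by positivity)).1 h
  refine ⟨c, hcw, hcm, fun d hd hdm => ?_⟩
  by_cases hdk : kin 0 d ≤ R
  · exact hle d (mem_momentBall.2 ⟨hd, hdm, hdk⟩)
  · refine (hle c₀ hmem0).trans ?_
    rw [hE0, coordEnergy, hdm]
    have h1 : 0 ≤ en d := msq_nonneg _
    have h2 : 1 / μ ≤ kin 0 d - 1 := by linarith
    have h3 : μ * (1 / μ) ≤ μ * (kin 0 d - 1) := by gcongr
    rw [mul_one_div_cancel hμ.ne'] at h3
    linarith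

lemma energy_wave_eq_top {c : ℕ → ℂ} (hc : SqSummable c) (hw : ¬WSummable c) (μ : ℝ) :
    energy μ (wave c) = ⊤ := by
  rw [energy, if_neg (by rwa [weightedNorm_wave_lt_top hc])]

/-! ### Classification of the global minimizers -/

lemma isGlobalMinimizer_wave_iff {μ : ℝ} {c : ℕ → ℂ} (hc : WSummable c) (hm : msq c = 1) :
    IsGlobalMinimizer μ (wave c) ↔
      ∀ d, WSummable d → msq d = 1 → coordEnergy μ c ≤ coordEnergy μ d := by
  constructor
  · intro h d hd hdm
    have := h.2 _ (wave_mem_unitMass hd.sq hdm)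
    rw [energy_wave hc, energy_wave hd] at this
    exact_mod_cast this
  · intro h
    refine ⟨wave_mem_unitMass hc.sq hm, fun v hv => ?_⟩
    obtain ⟨d, hd, hdm, rfl⟩ := exists_coords_of_unitMass hv
    by_cases hw : WSummable d
    · rw [energy_wave hc, energy_wave hw]
      exact_mod_cast h d hw hdm
    · rw [energy_wave_eq_top hd hw]
      exact le_top

lemma phi_mem_unitMass (n : ℕ) : phi n ∈ unitMass := by
  obtain ⟨c, hc, h, hm, -⟩ := phi_coords n
  rw [h]
  exact wave_mem_unitMass hc.sq hm

lemma IsGlobalMinimizer.coords {μ : ℝ} {u : ℂ → ℂ} (h : IsGlobalMinimizer μ u) :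
    ∃ c, WSummable c ∧ msq c = 1 ∧ u = wave c := by
  obtain ⟨c, hc, hm, rfl⟩ := exists_coords_of_unitMass h.1
  refine ⟨c, ?_, hm, rfl⟩
  by_contra hw
  obtain ⟨d, hd, hd2, -⟩ := phi_coords 0
  have h1 := h.2 _ (phi_mem_unitMass 0)
  rw [hd2, energy_wave hd, energy_wave_eq_top hc hw] at h1
  exact (EReal.coe_ne_top _) (top_le_iff.1 h1)

lemma IsGlobalMinimizer.isLocalMinimizer {μ : ℝ} {u : ℂ → ℂ} (h : IsGlobalMinimizer μ u) :
    IsLocalMinimizer μ u := by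
  obtain ⟨c, hc, hm, rfl⟩ := h.coords
  exact ⟨h.1, (weightedNorm_wave_lt_top hc.sq).2 hc, 1, one_pos, fun v hv _ => h.2 v hv⟩

lemma EqUpToRotations.of_wave_single {n : ℕ} {ζ : ℂ} (hζ : ‖ζ‖ = 1) :
    EqUpToRotations (wave (Pi.single n ζ)) (phi n) := by
  refine eqUpToRotations_of_phase hζ (e := 1) (by simp) fun z => ?_
  rw [one_mul, phi_eq_wave, wave, wave, holo, holo, tsum_eq_single n, tsum_eq_single n]
  · simp only [Pi.single_eq_same]
    ring
  · intro m hm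
    rw [Pi.single_eq_of_ne hm]
    simp
  · intro m hm
    rw [Pi.single_eq_of_ne hm]
    simp

lemma EqUpToRotations.to_wave_single {n : ℕ} {ζ : ℂ} (hζ : ‖ζ‖ = 1) :
    EqUpToRotations (phi n) (wave (Pi.single n ζ)) := by
  have hζ0 : ζ ≠ 0 := by rw [← norm_pos_iff, hζ]; exact one_pos
  refine eqUpToRotations_of_phase (ζ := ζ⁻¹) (by rw [norm_inv, hζ, inv_one]) (e := 1) (by simp)
    fun z => ?_
  rw [one_mul, phi_eq_wave, wave, wave, holo, holo, tsum_eq_single n, tsum_eq_single n]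
  · simp only [Pi.single_eq_same]
    field_simp
  · intro m hm
    rw [Pi.single_eq_of_ne hm]
    simp
  · intro m hm
    rw [Pi.single_eq_of_ne hm]
    simp

/-- Local minimizers with finitely many zeros below one half are the first Hermite function. -/
lemma IsLocalMinimizer.eq_single_one {μ : ℝ} (hμ : 0 < μ) (hμ2 : μ < 1 / 2) {u : ℂ → ℂ}
    (h : IsLocalMinimizer μ u) (hfin : {z | u z = 0}.Finite) :
    5 / 32 ≤ μ ∧ EqUpToRotations (phi 1) u := by
  obtain ⟨c, hc, hm, rfl⟩ := exists_coords_of_unitMass h.1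
  obtain ⟨hw, hq⟩ := h.qMin hc hm
  obtain ⟨n, ζ, hζ, he, hq'⟩ := hq.eq_single_of_finite hμ hμ2.ne hw hm hfin
  rcases n with _ | _ | k
  · exact absurd (QMin.zero_not_single hζ hq') (by linarith)
  · exact ⟨QMin.one_not_single hζ hq', he ▸ EqUpToRotations.to_wave_single hζ⟩
  · exact (QMin.not_single_add_two hζ k hq').elim

lemma exists_isGlobalMinimizer {μ : ℝ} (hμ : 0 < μ) : ∃ u, IsGlobalMinimizer μ u := by
  obtain ⟨c, hc, hm, h⟩ := exists_minimal_coords hμ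
  exact ⟨wave c, (isGlobalMinimizer_wave_iff hc hm).2 h⟩

/-- For a fixed function the energy is affine in μ with slope P; bounds at two parameters therefore
control all those in between. -/
lemma coordEnergy_affine (μ ν : ℝ) (c : ℕ → ℂ) :
    coordEnergy μ c = coordEnergy ν c + (μ - ν) * (kin 0 c - msq c) := by
  rw [coordEnergy, coordEnergy]
  ring

lemma momentum_eq_of_wave_eq {c d : ℕ → ℂ} (hc : WSummable c) (hd : WSummable d)
    (h : wave c = wave d) : kin 0 c - msq c = kin 0 d - msq d := by
  rw [← (momentum_eq hc).tsum_eq, ← (momentum_eq hd).tsum_eq, ← angularMomentum_wave hc,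
    ← angularMomentum_wave hd, h]

/-- The ground state is a minimizer above the parameter one half. -/
lemma isGlobalMinimizer_phi_zero {μ : ℝ} (hμ : 1 / 2 ≤ μ) : IsGlobalMinimizer μ (phi 0) := by
  obtain ⟨c, hc, hw, hm, he, hk⟩ := phi_coords 0
  rw [hw]
  refine (isGlobalMinimizer_wave_iff hc hm).2 fun d hd hdm => ?_
  have h1 := one_le_coordEnergy_half hd hdm
  have h2 := momentum_nonneg hd
  rw [coordEnergy_affine μ (1 / 2) d, coordEnergy, he, hk]
  simp only [mul_zero, gw_zero, Nat.cast_zero]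
  nlinarith

/-- The bound at 1/2 and the value one of φ₀ force P = 0, so only the coordinate of index zero is
nonzero. -/
lemma isGlobalMinimizer_iff_of_half_lt {μ : ℝ} (hμ : 1 / 2 < μ) (u : ℂ → ℂ) :
    IsGlobalMinimizer μ u ↔ EqUpToRotations u (phi 0) := by
  refine ⟨fun h => ?_, fun h => (isGlobalMinimizer_phi_zero hμ.le).of_eqUpToRotations h⟩
  obtain ⟨c, hc, hm, rfl⟩ := h.coords
  obtain ⟨d, hd, -, hdm, hde, hdk⟩ := phi_coords 0
  have h1 := (isGlobalMinimizer_wave_iff hc hm).1 h d hd hdm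
  have h2 := one_le_coordEnergy_half hc hm
  have h3 := momentum_nonneg hc
  have hd1 : coordEnergy μ d = 1 := by
    rw [coordEnergy, hde, hdk]
    simp [gw_zero]
  rw [coordEnergy_affine μ (1 / 2) c, hd1] at h1
  have h4 : kin 0 c - msq c = 0 := by nlinarith
  have h5 := momentum_eq hc
  rw [h4, hasSum_zero_iff_of_nonneg fun n => by positivity] at h5
  have h6 : c = Pi.single 0 (c 0) := by
    funext n
    rcases eq_or_ne n 0 with rfl | hn
    · simp
    · rw [Pi.single_eq_of_ne hn]
      have := congrFun h5 n
      simpa [hn] using this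
  rw [h6, msq_single] at hm
  rw [h6]
  exact EqUpToRotations.of_wave_single (by nlinarith [norm_nonneg (c 0)])

lemma isGlobalMinimizer_half_wave_iff {c : ℕ → ℂ} (hc : WSummable c) (hm : msq c = 1) :
    IsGlobalMinimizer (1 / 2) (wave c) ↔ coordEnergy (1 / 2) c = 1 := by
  rw [isGlobalMinimizer_wave_iff hc hm]
  constructor
  · intro h
    obtain ⟨d, hd, -, hdm, hde, hdk⟩ := phi_coords 0
    have h1 := h d hd hdm
    have hd1 : coordEnergy (1 / 2) d = 1 := by
      rw [coordEnergy, hde, hdk]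
      simp [gw_zero]
    exact le_antisymm (h1.trans hd1.le) (one_le_coordEnergy_half hc hm)
  · intro h d hd hdm
    rw [h]
    exact one_le_coordEnergy_half hd hdm

lemma isGlobalMinimizer_psi (b : ℝ) : IsGlobalMinimizer (1 / 2) (psi b) := by
  obtain ⟨c, hc, hw, hm, h⟩ := psi_coords b
  rw [hw, isGlobalMinimizer_half_wave_iff hc hm, h]

lemma isGlobalMinimizer_half_iff (u : ℂ → ℂ) : IsGlobalMinimizer (1 / 2) u ↔
    EqUpToRotations u (phi 0) ∨ EqUpToRotations u (phi 1) ∨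
      ∃ b : ℝ, 0 ≤ b ∧ EqUpToRotations u (psi b) := by
  constructor
  · intro h
    obtain ⟨c, hc, hm, rfl⟩ := h.coords
    rw [isGlobalMinimizer_half_wave_iff hc hm, coordEnergy_half_eq_one_iff_centred hc hm] at h
    obtain ⟨x, y, hxy, hw⟩ := h
    rw [hw]
    rcases centred_eqUpToRotations hxy with ⟨-, h⟩ | ⟨-, h⟩
    · exact Or.inl h
    · exact Or.inr (Or.inr ⟨_, by positivity, h⟩)
  · rintro (h | h | ⟨b, -, h⟩)
    · exact (isGlobalMinimizer_phi_zero le_rfl).of_eqUpToRotations h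
    · rw [← psi_zero] at h
      exact (isGlobalMinimizer_psi 0).of_eqUpToRotations h
    · exact (isGlobalMinimizer_psi b).of_eqUpToRotations h

lemma coordEnergy_phi_one (μ : ℝ) :
    ∃ c, WSummable c ∧ phi 1 = wave c ∧ msq c = 1 ∧ coordEnergy μ c = 1 / 2 + μ := by
  obtain ⟨c, hc, hw, hm, he, hk⟩ := phi_coords 1
  refine ⟨c, hc, hw, hm, ?_⟩
  rw [coordEnergy, he, hk, gw_sq]
  norm_num

lemma isGlobalMinimizer_phi_one_iff {μ : ℝ} : IsGlobalMinimizer μ (phi 1) ↔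
    ∀ d, WSummable d → msq d = 1 → 1 / 2 + μ ≤ coordEnergy μ d := by
  obtain ⟨c, hc, hw, hm, he⟩ := coordEnergy_phi_one μ
  rw [hw, isGlobalMinimizer_wave_iff hc hm, he]

/-- Below one half, minimality of `φ₁` persists up to one half, with uniqueness. -/
lemma isGlobalMinimizer_iff_phi_one {ν μ : ℝ} (hν : IsGlobalMinimizer ν (phi 1)) (h1 : ν < μ)
    (h2 : μ < 1 / 2) (u : ℂ → ℂ) : IsGlobalMinimizer μ u ↔ EqUpToRotations u (phi 1) := by
  rw [isGlobalMinimizer_phi_one_iff] at hν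
  have hmin : IsGlobalMinimizer μ (phi 1) := by
    rw [isGlobalMinimizer_phi_one_iff]
    intro d hd hdm
    have h3 := hν d hd hdm
    have h4 := one_le_coordEnergy_half hd hdm
    rw [coordEnergy_affine μ ν]
    rw [coordEnergy_affine (1 / 2) ν] at h4
    -- If P ≥ 1 extrapolate from ν upwards; if P ≤ 1 extrapolate from 1/2 downwards.
    rcases le_total 1 (kin 0 d - msq d) with h | h
    · nlinarith
    · nlinarith
  refine ⟨fun h => ?_, fun h => hmin.of_eqUpToRotations h⟩
  obtain ⟨c, hc, hm, rfl⟩ := h.coords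
  obtain ⟨d, hd, -, hdm, hde⟩ := coordEnergy_phi_one μ
  have h5 := (isGlobalMinimizer_wave_iff hc hm).1 h d hd hdm
  rw [hde] at h5
  have h3 := hν c hc hm
  have h4 := one_le_coordEnergy_half hc hm
  rw [coordEnergy_affine μ ν] at h5
  have h6 := coordEnergy_affine (1 / 2) ν c
  -- Both extrapolations are strict unless P = 1. The energy at 1/2 is then one, so the function is
  -- centred with |y|⁴ = 1, which leaves x = 0 and ψ_0 = φ₁.
  have hP : kin 0 c - msq c = 1 := by
    refine le_antisymm ?_ ?_
    · by_contra! hlt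
      nlinarith
    · by_contra! hlt
      nlinarith
  rw [hP] at h5 h6
  have h7 : coordEnergy (1 / 2) c = 1 := le_antisymm (by linarith) h4
  obtain ⟨x, y, hxy, hw⟩ := (coordEnergy_half_eq_one_iff_centred hc hm).1 h7
  obtain ⟨c', hc', hw', -, -, hk'⟩ := centred_coords hxy
  rw [← momentum_eq_of_wave_eq hc hc' (hw.trans hw'), hP] at hk'
  have hy : ‖y‖ ^ 2 = 1 := by nlinarith [sq_nonneg ‖y‖]
  have hx : ‖x‖ = 0 := by
    have : ‖x‖ ^ 2 = 0 := by linarith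
    exact pow_eq_zero_iff two_ne_zero |>.1 this
  rw [hw]
  rcases centred_eqUpToRotations hxy with ⟨h0, -⟩ | ⟨-, h0⟩
  · rw [h0] at hy
    norm_num at hy
  · rwa [hx, zero_div, psi_zero] at h0

lemma isGlobalMinimizer_phi_one_five_twelfths : IsGlobalMinimizer (5 / 12) (phi 1) :=
  isGlobalMinimizer_phi_one_iff.2 fun _ hd hdm => le_coordEnergy hd hdm

lemma finite_zeros_phi_one : {z | phi 1 z = 0}.Finite := by
  refine (Set.finite_singleton (0 : ℂ)).subset fun z hz => ?_
  have h : phi 1 z = 0 := hz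
  have hpi : √Real.pi ≠ 0 := (Real.sqrt_pos.2 Real.pi_pos).ne'
  simpa [phi, Complex.exp_ne_zero, hpi] using h

end LLL

theorem theorem1p5 :
    -- (i) existence of a global minimizer
    (∀ μ : ℝ, 0 < μ → ∃ u : ℂ → ℂ, LLL.IsGlobalMinimizer μ u) ∧
    -- (ii) the Gaussian is the unique global minimizer above one half
    (∀ μ : ℝ, 1 / 2 < μ → ∀ u : ℂ → ℂ,
      LLL.IsGlobalMinimizer μ u ↔ LLL.EqUpToRotations u (LLL.phi 0)) ∧
    -- (iii) the global minimizers at one half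
    (∀ u : ℂ → ℂ, LLL.IsGlobalMinimizer (1 / 2) u ↔
      LLL.EqUpToRotations u (LLL.phi 0) ∨ LLL.EqUpToRotations u (LLL.phi 1) ∨
        ∃ b : ℝ, 0 ≤ b ∧ LLL.EqUpToRotations u (LLL.psi b)) ∧
    -- (iv) the transition value
    (∃ μ₀ : ℝ, 5 / 32 ≤ μ₀ ∧ μ₀ < 1 / 2 ∧
      (∀ μ : ℝ, μ₀ < μ → μ < 1 / 2 → ∀ u : ℂ → ℂ,
        LLL.IsGlobalMinimizer μ u ↔ LLL.EqUpToRotations u (LLL.phi 1)) ∧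
      (∀ μ : ℝ, 0 < μ → μ < μ₀ → ∀ u : ℂ → ℂ,
        LLL.IsGlobalMinimizer μ u → LLL.HasInfinitelyManyZeros u)) ∧
    -- (v) local and global minimizers for small parameters
    (∀ μ : ℝ, 0 < μ → μ < 5 / 32 → ∀ u : ℂ → ℂ,
      LLL.IsLocalMinimizer μ u ∨ LLL.IsGlobalMinimizer μ u →
        LLL.HasInfinitelyManyZeros u) := by 
  refine ⟨fun μ hμ => LLL.exists_isGlobalMinimizer hμ,
    fun μ hμ u => LLL.isGlobalMinimizer_iff_of_half_lt hμ u, LLL.isGlobalMinimizer_half_iff, ?_, ?_⟩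
  -- The transition value is the infimum of the parameters at which φ₁ is minimal.
  · set S : Set ℝ := {μ | 0 < μ ∧ μ < 1 / 2 ∧ LLL.IsGlobalMinimizer μ (LLL.phi 1)} with hS
    have hlow : ∀ μ ∈ S, 5 / 32 ≤ μ := fun μ hμ =>
      (hμ.2.2.isLocalMinimizer.eq_single_one hμ.1 hμ.2.1 LLL.finite_zeros_phi_one).1
    have hmem : (5 / 12 : ℝ) ∈ S :=
      ⟨by norm_num, by norm_num, LLL.isGlobalMinimizer_phi_one_five_twelfths⟩
    have hbdd : BddBelow S := ⟨5 / 32, hlow⟩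
    refine ⟨sInf S, le_csInf ⟨_, hmem⟩ hlow, (csInf_le hbdd hmem).trans_lt (by norm_num), ?_, ?_⟩
    · intro μ h1 h2 u
      obtain ⟨ν, hν, hνμ⟩ := exists_lt_of_csInf_lt ⟨_, hmem⟩ h1
      exact LLL.isGlobalMinimizer_iff_phi_one hν.2.2 hνμ h2 u
    · intro μ h1 h2 u hu hfin
      have h3 : μ < 1 / 2 := h2.trans ((csInf_le hbdd hmem).trans_lt (by norm_num))
      -- A minimizer with finitely many zeros would be φ₁ up to rotations, which would place μ in S
      -- below its infimum.
      have h4 := (hu.isLocalMinimizer.eq_single_one h1 h3 hfin).2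
      exact absurd (csInf_le hbdd ⟨h1, h3, hu.of_eqUpToRotations h4⟩) (not_le.2 h2)
  · rintro μ h1 h2 u hu hfin
    have hloc : LLL.IsLocalMinimizer μ u := hu.elim id LLL.IsGlobalMinimizer.isLocalMinimizer
    have h3 : μ < 1 / 2 := h2.trans (by norm_num)
    exact absurd (hloc.eq_single_one h1 h3 hfin).1 (not_le.2 h2)
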